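/- Let $\mathbf{k}$ be a field, $X$ a finite set with $|X|=n$, $V$ the $\mathbf{k}$-vector space with basis $X$, and let $A=\mathbf{k}\langle X\rangle/(\Re)$ be a quantum binomial algebra. This means that $\Re$ is a set of elements of the free associative algebra $\mathbf{k}\langle X\rangle$ such that: (a) each element of $\Re$ is a binomial $xy-c_{xy}\,y'x'$ with $x,y,x',y'\in X$, $xy\ne y'x'$ and $c_{xy}\in\mathbf{k}^{\times}$; (b) each monomial $xy$ with $x\neq y$ occurs at most once in $\Re$; (c) no monomial $xx$, $x\in X$, occurs in $\Re$; (d) the associated map $r\colon X\times X\to X\times X$ is nondegenerate. Here $r$ is given by $r(x,y)=(y',x')$ and $r(y',x')=(x,y)$ for $xy-c_{xy}\,y'x'\in\Re$, and $r(x,y)=(x,y)$ if $xy$ occurs in no relation; writing $r(x,y)=({}^xy,x^y)$, nondegenerate means that the maps $y\mapsto{}^xy$ and $y\mapsto y^x$ are bijective for every $x\in X$. The associated linear map $R=R(\Re)\colon V\otimes V\to V\otimes V$ is given by $R(x\otimes y)=c_{xy}\,y'\otimes x'$ and $R(y'\otimes x')=c_{xy}^{-1}\,x\otimes y$ for $xy-c_{xy}\,y'x'\in\Re$,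 and $R(x\otimes y)=x\otimes y$ if $xy$ occurs in no relation. Let $A_3$ be the degree $3$ component of $A$, that is, the span of the images of the words of length $3$. Then the following three conditions are equivalent. 1. $R$ is a linear automorphism of $V\otimes V$ that solves the Yang–Baxter equation $R^{12}R^{23}R^{12}=R^{23}R^{12}R^{23}$ on $V\otimes V\otimes V$. 2. $A$ is a binomial skew polynomial ring with respect to some enumeration $X=\{x_1,\dots,x_n\}$. That is, the two-sided ideal $(\Re)$ is generated by a set of $\binom n2$ relations $\{x_jx_i-c_{ij}\,x_{i'}x_{j'}\}_{1\le i<j\le n}$ (where $i',j'$ depend on $i,j$) such that all $c_{ij}\in\mathbf{k}^{\times}$; for every $i<j$ one has $j>i'$ and $i'<j'$; every monomial $x_ax_b$ with $a<b$ occurs on the right-hand side of one of these relations, as $x_{i'}x_{j'}$; and these relations form the reduced Gröbner basis of $(\Re)$ with respect to the degree-lexicographic order with $x_1<\dots<x_n$. 3. $\dim_{\mathbf{k}}A_3=\binom{n+2}{3}$. -/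

import Mathlib

open scoped TensorProduct

noncomputable section

namespace QuantumBinomial

/-- The free associative unital algebra `k⟨X⟩`, realized as the monoid algebra of the free monoid
`⟨X⟩`, so that polynomials have coefficients at words. -/
abbrev FreeAlg (k X : Type*) [Field k] : Type _ := MonoidAlgebra k (FreeMonoid X)

section Relations

variable {k X : Type*} [Field k]

/-- The monomial `x y` of length two, as an element of `k⟨X⟩`. -/
def mon (k : Type*) {X : Type*} [Field k] (p : X × X) : FreeAlg k X :=
  MonoidAlgebra.single (FreeMonoid.of p.1 * FreeMonoid.of p.2) (1 : k)

/-- The word `w` occurs in the polynomial `f` (with nonzero coefficient). -/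
def Occurs (w : FreeMonoid X) (f : FreeAlg k X) : Prop := f.coeff w ≠ 0

/-- `Linked S p q c`: one of the relations in `S` is the binomial `p - c q`, or the binomial
`q - c⁻¹ p`; in both cases the relation says `p = c q`, with `p ≠ q` and `c ≠ 0`. -/
def Linked (S : Set (FreeAlg k X)) (p q : X × X) (c : k) : Prop :=
  c ≠ 0 ∧ p ≠ q ∧ (mon k p - c • mon k q ∈ S ∨ mon k q - c⁻¹ • mon k p ∈ S)

open Classical in
/-- The pair `q` and the coefficient `c` with `p = c q` according to `S`; if `p` does not
occur in a relation, then the pair is `p` and the coefficient is `1`. -/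
def partner (S : Set (FreeAlg k X)) (p : X × X) : (X × X) × k :=
  if h : ∃ qc : (X × X) × k, Linked S p qc.1 qc.2 then h.choose else (p, 1)

/-- The map `r = r(S) : X × X → X × X` associated with a set `S` of binomial relations. -/
def assocMap (S : Set (FreeAlg k X)) (p : X × X) : X × X := (partner S p).1

/-- A map `r(x, y) = (ˣy, xʸ)` is nondegenerate if all maps `y ↦ ˣy` and all maps `x ↦ xʸ` are
bijective. -/
def Nondegenerate (r : X × X → X × X) : Prop :=
  (∀ x, Function.Bijective fun y => (r (x, y)).1) ∧
    (∀ y, Function.Bijective fun x => (r (x, y)).2)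

/-- `S` is a set of quantum binomial relations; `k⟨X⟩/(S)` is then a quantum binomial algebra. -/
structure IsQuantumBinomial (S : Set (FreeAlg k X)) : Prop where
  /-- Each relation is a binomial `xy - c y'x'` (two distinct monomials) with `c ≠ 0`. -/
  binomial : ∀ f ∈ S, ∃ (p q : X × X) (c : k), p ≠ q ∧ c ≠ 0 ∧ f = mon k p - c • mon k q
  /-- Each monomial `xy` with `x ≠ y` occurs at most once in the relations. -/
  occurs_once : ∀ x y : X, x ≠ y → ∀ f ∈ S, ∀ g ∈ S,
    Occurs (FreeMonoid.of x * FreeMonoid.of y) f →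
    Occurs (FreeMonoid.of x * FreeMonoid.of y) g → f = g
  /-- No monomial `xx` occurs in a relation. -/
  square_free : ∀ f ∈ S, ∀ x : X, ¬ Occurs (FreeMonoid.of x * FreeMonoid.of x) f
  /-- The associated map `r` is nondegenerate. -/
  nondegenerate : Nondegenerate (assocMap S)

/-- The space `V` with basis `X`. -/
abbrev V (k X : Type*) [Field k] : Type _ := X →₀ k

/-- The linear map `R = R(S) : V ⊗ V → V ⊗ V` associated with `S`: it maps `x ⊗ y` to
`c y' ⊗ x'` if `xy = c y'x'` according to `S`, and to `x ⊗ y` if `xy` occurs in no relation. -/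
def assocLin (S : Set (FreeAlg k X)) : V k X ⊗[k] V k X →ₗ[k] V k X ⊗[k] V k X :=
  ((Finsupp.basisSingleOne (R := k) (ι := X)).tensorProduct
    (Finsupp.basisSingleOne (R := k) (ι := X))).constr k fun p =>
      (partner S p).2 • (Finsupp.single (partner S p).1.1 (1 : k) ⊗ₜ[k]
        Finsupp.single (partner S p).1.2 (1 : k))

theorem word_inj (p q : X × X) : (FreeMonoid.of p.1 * FreeMonoid.of p.2 = FreeMonoid.of q.1 * FreeMonoid.of q.2) ↔ p = q := by
  constructor
  · intro h
    have h2 := congrArg FreeMonoid.toList h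
    simp at h2
    exact Prod.ext h2.1 h2.2
  · rintro rfl; rfl

open Classical in
theorem coeff_mon (p q : X × X) :
    (mon k p).coeff (FreeMonoid.of q.1 * FreeMonoid.of q.2) = if p = q then 1 else 0 := by
  simp only [mon, MonoidAlgebra.coeff_single, Finsupp.single_apply, word_inj]

/-- For quantum binomial relations, the partner of a monomial and its coefficient are unique. -/
theorem linked_unique (S : Set (FreeAlg k X)) (hS : IsQuantumBinomial S) {p q q' : X × X} {c c' : k}
    (h : Linked S p q c) (h' : Linked S p q' c') : q = q' ∧ c = c' := by
  classical
  obtain ⟨hc, hpq, h⟩ := h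
  obtain ⟨hc', hpq', h'⟩ := h'
  have key : ∀ {q : X × X} {c : k}, c ≠ 0 → p ≠ q →
      (mon k p - c • mon k q ∈ S ∨ mon k q - c⁻¹ • mon k p ∈ S) →
      ∃ f ∈ S, ∃ d : k, d ≠ 0 ∧ f = d • (mon k p - c • mon k q) := by
    intro q c hc _ h
    rcases h with h | h
    · exact ⟨_, h, 1, one_ne_zero, by simp⟩
    · refine ⟨_, h, -c⁻¹, by simpa using hc, ?_⟩
      rw [smul_sub, smul_smul]; simp [hc]; abel
  obtain ⟨f, hf, d, hd, rfl⟩ := key hc hpq h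
  obtain ⟨g, hg, d', hd', rfl⟩ := key hc' hpq' h'
  have o1 : ∀ {d c : k} {q : X × X}, d ≠ 0 → p ≠ q → Occurs (FreeMonoid.of p.1 * FreeMonoid.of p.2) (d • (mon k p - c • mon k q)) := by
    intro d c q hd hpq
    simp [Occurs, coeff_mon, hd, hpq.symm]
  have hne : p.1 ≠ p.2 := by
    intro e
    have := hS.square_free _ hf p.1
    have h2 := o1 (c := c) hd hpq
    rw [← e] at h2
    exact this h2
  have E := hS.occurs_once _ _ hne _ hf _ hg (o1 hd hpq) (o1 hd' hpq')
  have C := fun u : X × X => congrArg (fun f : FreeAlg k X => f.coeff (FreeMonoid.of u.1 * FreeMonoid.of u.2)) E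
  simp [coeff_mon] at C
  have Cp := C p.1 p.2
  have Cq := C q.1 q.2
  simp [hpq.symm, hpq'.symm, hpq] at Cp Cq
  subst Cp
  have : q' = q := by
    by_contra hh
    simp [hh, hd, hc] at Cq
  subst this
  simp [hd] at Cq
  exact ⟨rfl, Cq⟩

/-- Hence `partner`, and with it `assocMap` and `assocLin`, involves no arbitrary choice. -/
theorem partner_eq {S : Set (FreeAlg k X)} (hS : IsQuantumBinomial S) {p q : X × X} {c : k}
    (h : Linked S p q c) : partner S p = (q, c) := by
  have hx : ∃ qc : (X × X) × k, Linked S p qc.1 qc.2 := ⟨(q, c), h⟩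
  unfold partner
  rw [dif_pos hx]
  obtain ⟨h1, h2⟩ := linked_unique S hS hx.choose_spec h
  exact Prod.ext h1 h2

end Relations

section YangBaxter

variable {k W : Type*} [Field k] [AddCommGroup W] [Module k W]

/-- `R` acting on the second and third factors of `W ⊗ W ⊗ W`. -/
def act23 (R : W ⊗[k] W →ₗ[k] W ⊗[k] W) : W ⊗[k] (W ⊗[k] W) →ₗ[k] W ⊗[k] (W ⊗[k] W) :=
  R.lTensor W

/-- `R` acting on the first and second factors of `W ⊗ W ⊗ W`. -/
def act12 (R : W ⊗[k] W →ₗ[k] W ⊗[k] W) : W ⊗[k] (W ⊗[k] W) →ₗ[k] W ⊗[k] (W ⊗[k] W) :=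
  (TensorProduct.assoc k W W W).toLinearMap ∘ₗ R.rTensor W ∘ₗ
    (TensorProduct.assoc k W W W).symm.toLinearMap

/-- `R` is a linear automorphism of `W ⊗ W` that solves the Yang–Baxter equation. -/
def IsYangBaxterSolution (R : W ⊗[k] W →ₗ[k] W ⊗[k] W) : Prop :=
  Function.Bijective R ∧
    act12 R ∘ₗ act23 R ∘ₗ act12 R = act23 R ∘ₗ act12 R ∘ₗ act23 R

end YangBaxter

section Algebra

variable {k X : Type*} [Field k]

/-- The algebra `A = k⟨X⟩/(S)`. -/
abbrev QuotAlg (S : Set (FreeAlg k X)) : Type _ := (TwoSidedIdeal.span S).ringCon.Quotient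

/-- The component `A_m` of `A = k⟨X⟩/(S)`: the span of the images of the words of length `m`. -/
def component (S : Set (FreeAlg k X)) (m : ℕ) : Submodule k (QuotAlg S) :=
  Submodule.span k ((fun w : FreeMonoid X =>
    (TwoSidedIdeal.span S).ringCon.mkₐ (α := k) (MonoidAlgebra.single w (1 : k))) ''
      {w | w.length = m})

end Algebra

section Groebner

variable {k X : Type*} [Field k]

/-- The degree-lexicographic order on words induced by `x_1 < x_2 < ... < x_n`, where
`x_i = e i`. -/
def DegLex {n : ℕ} (e : Fin n ≃ X) (u v : FreeMonoid X) : Prop :=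
  List.Shortlex (fun x y => e.symm x < e.symm y) u.toList v.toList

/-- `w` is the leading (largest) monomial of `f`. -/
def IsLeading (lt : FreeMonoid X → FreeMonoid X → Prop) (f : FreeAlg k X) (w : FreeMonoid X) :
    Prop :=
  Occurs w f ∧ ∀ v, Occurs v f → v ≠ w → lt v w

/-- `u` is a subword (a contiguous factor) of `v`. -/
def IsFactor (u v : FreeMonoid X) : Prop := ∃ a b : FreeMonoid X, v = a * u * b

/-- `G` is the reduced Gröbner basis of the two-sided ideal `I` with respect to `lt`. -/
structure IsReducedGroebnerBasis (lt : FreeMonoid X → FreeMonoid X → Prop)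
    (G : Set (FreeAlg k X)) (I : TwoSidedIdeal (FreeAlg k X)) : Prop where
  subset : ∀ g ∈ G, g ∈ I
  /-- The leading monomial of every nonzero element of `I` is divisible by that of an element
  of `G`. -/
  leading : ∀ f ∈ I, f ≠ 0 → ∃ w, IsLeading lt f w ∧ ∃ g ∈ G, ∃ u, IsLeading lt g u ∧ IsFactor u w
  /-- The elements of `G` are monic. -/
  monic : ∀ g ∈ G, ∃ u, IsLeading lt g u ∧ g.coeff u = 1
  /-- No monomial of an element of `G` is divisible by the leading monomial of another one. -/
  reduced : ∀ g ∈ G, ∀ h ∈ G, h ≠ g → ∀ v, Occurs v g → ∀ u, IsLeading lt h u → ¬ IsFactor u v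

/-- `G` is a set of relations of skew-polynomial type for the enumeration `x_i = e i` of `X`:
it consists of one relation `x_j x_i - c_{ij} x_{i'} x_{j'}` for each pair `i < j`. -/
def IsSkewPolynomialType {n : ℕ} (e : Fin n ≃ X) (G : Set (FreeAlg k X)) : Prop :=
  ∃ (c : Fin n → Fin n → k) (i' j' : Fin n → Fin n → Fin n),
    G = {f | ∃ i j, i < j ∧ f = mon k (e j, e i) - c i j • mon k (e (i' i j), e (j' i j))} ∧
    (∀ i j, i < j → c i j ≠ 0) ∧
    (∀ i j, i < j → i' i j < j ∧ i' i j < j' i j) ∧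
    (∀ a b, a < b → ∃ i j, i < j ∧ i' i j = a ∧ j' i j = b)

/-- `k⟨X⟩/(S)` is a binomial skew polynomial ring with respect to some enumeration of `X`: its
ideal of relations is generated by relations of skew-polynomial type which form the reduced
Gröbner basis of this ideal. -/
def IsBinomialSkewPolynomialRing (S : Set (FreeAlg k X)) : Prop :=
  ∃ (n : ℕ) (e : Fin n ≃ X) (G : Set (FreeAlg k X)),
    TwoSidedIdeal.span G = TwoSidedIdeal.span S ∧
    IsSkewPolynomialType e G ∧
    IsReducedGroebnerBasis (DegLex e) G (TwoSidedIdeal.span S)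

end Groebner

end QuantumBinomial

end

/-! ### Burnside's theorem on conjugacy classes of prime power size -/

section Burnside

/-! Conditions 1 and 3 are compared by counting orbits in degree three. The dual of $A_3$ is the
space of functions $F$ on $X^3$ that transform by the coefficients under the involutions
$r_{12}=r\times 1$ and $r_{23}=1\times r$ (`dualComponentEquiv`). Such an $F$ is determined by one
value on each orbit of the group they generate, so $\dim A_3$ is at most the number of orbits.
Nondegeneracy together with $r(x,x)=(x,x)$ makes the orbits long: a common fixed point, a path with
at least 3 points, or a cycle with at least 6 (`isLongOrbitPair`). Give a triple weight 2, plus 3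
for each involution fixing it, plus 4 if both do. Every orbit then weighs at least 12, while the
total weight is $2n^3+6n^2+4n=12\binom{n+2}{3}$. Hence $\dim A_3\le\binom{n+2}{3}$. Equality forces
every orbit to weigh exactly 12, which is the braid relation for $r$, and yields a nowhere zero $F$,
which gives the braid relation for the coefficients. Conversely, under the braid relation
symmetrization over $S_3$ gives an invariant function on each orbit.

For 2 ⇒ 3, the sorted words of length three are irreducible for the Gröbner basis, so they are
independent in $A_3$; there are $\binom{n+2}{3}$ of them, which meets the upper bound.

For 1 ⇒ 2, the crux is an enumeration of $X$ in which the relations rewrite descents to smaller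
ascents. It comes from Rump's theorem (`subsingleton_of_squareFree_of_isPretransitive`): if a finite
square-free solution has more than one point, the group $G$ generated by the permutations $l_x\colon
y\mapsto{}^xy$ is intransitive, and one can split $X$ into invariant parts and induct. In Rump's
theorem $l$ extends to a cocycle from $\mathbb N^X$ onto $G$, with a finite period $d$. Its values
on multiples of the factors of $d$ give $p$-complements for all $p$, so $G$ is solvable by Hall's
theorem, which rests on Burnside's $p^aq^b$ theorem. They also give Sylow subgroups generated by
elements with fixed points, and a transitive solvable group with this property acts on a single
point (`eq_top_of_sylow_generated_by_conj`). Given the enumeration, sorted words span $A_3$ and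
their number is its dimension, so they are independent; this resolves all overlaps, and the diamond
lemma yields the Gröbner basis. -/

theorem roots_of_unity_eq_of_integral_average {ι : Type*} [Fintype ι] {m : ℕ} (hm : 0 < m)
    (ζ : ι → ℂ) (hζ : ∀ i, ζ i ^ m = 1) {α : ℂ} (hsum : ∑ i, ζ i = Fintype.card ι * α)
    (hα : IsIntegral ℤ α) (h0 : α ≠ 0) (hι : 0 < Fintype.card ι) (i : ι) : ζ i = α := by
  classical
  have hint : ∀ i, IsIntegral ℚ (ζ i) := fun i => by
    refine IsIntegral.of_pow hm ?_
    rw [hζ i]; exact isIntegral_one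
  let K := IntermediateField.adjoin ℚ (Set.range ζ)
  have hfd : FiniteDimensional ℚ K := by
    have : Finite (Set.range ζ) := Set.finite_range ζ
    refine IntermediateField.finiteDimensional_adjoin ?_
    rintro _ ⟨i, rfl⟩; exact hint i
  have : NumberField K := { to_charZero := inferInstance, to_finiteDimensional := hfd }
  let z : ι → K := fun i => ⟨ζ i, IntermediateField.subset_adjoin _ _ ⟨i, rfl⟩⟩
  have hcard : (Fintype.card ι : ℂ) ≠ 0 := by exact_mod_cast hι.ne'
  have hcardK : (Fintype.card ι : K) ≠ 0 := by exact_mod_cast hι.ne'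
  let a : K := (∑ i, z i) / Fintype.card ι
  have ha : (a : ℂ) = α := by
    have : (a : ℂ) = (∑ i, ζ i) / Fintype.card ι := by
      simp [a, z]
    rw [this, hsum]; field_simp
  have hz : ∀ i, z i ^ m = 1 := fun i => by
    apply Subtype.ext; simpa [z] using hζ i
  have ha0 : a ≠ 0 := by
    rintro h; apply h0; rw [← ha, h]; rfl
  have haint : IsIntegral ℤ a := by
    have : IsIntegral ℤ (algebraMap K ℂ a) := by
      rw [show algebraMap K ℂ a = α from ha]; exact hα
    exact (isIntegral_algebraMap_iff (algebraMap K ℂ).injective).1 this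
  have hnorm : ∀ (w : ℂ), w ^ m = 1 → ‖w‖ = 1 := fun w hw => by
    have : ‖w‖ ^ m = 1 := by rw [← norm_pow, hw, norm_one]
    exact (pow_eq_one_iff_of_nonneg (norm_nonneg _) hm.ne').1 this
  -- Kronecker's theorem: every conjugate of the average is again an average of roots of unity,
  -- hence has absolute value at most 1.
  obtain ⟨N, hN, haN⟩ := NumberField.Embeddings.pow_eq_one_of_norm_le_one K ℂ ha0 haint (by
    intro φ
    have : φ a = (∑ i, φ (z i)) / Fintype.card ι := by simp [a]
    rw [this, norm_div, RCLike.norm_natCast, div_le_one (by exact_mod_cast hι)]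
    calc ‖∑ i, φ (z i)‖ ≤ ∑ i, ‖φ (z i)‖ := norm_sum_le _ _
      _ = ∑ i : ι, (1 : ℝ) := by
        refine Finset.sum_congr rfl fun i _ => hnorm _ ?_
        rw [← map_pow, hz, map_one]
      _ = _ := by simp)
  have hα1 : ‖α‖ = 1 := by
    have h1 : α ^ N = 1 := by rw [← ha, ← IntermediateField.coe_pow, haN]; rfl
    have : ‖α‖ ^ N = 1 := by rw [← norm_pow, h1, norm_one]
    exact (pow_eq_one_iff_of_nonneg (norm_nonneg _) hN.ne').1 this
  have hαα : α * (starRingEnd ℂ) α = 1 := by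
    rw [Complex.mul_conj, Complex.normSq_eq_norm_sq, hα1]; norm_num
  have hle : ∀ i ∈ Finset.univ, (ζ i * (starRingEnd ℂ) α).re ≤ 1 := fun i _ => by
    refine (Complex.re_le_norm _).trans ?_
    rw [norm_mul, hnorm _ (hζ i), RCLike.norm_conj, hα1]; norm_num
  -- Equality case of the triangle inequality: real parts bounded by 1 whose sum is the number of
  -- terms must all equal 1.
  have hsumre : ∑ i, (ζ i * (starRingEnd ℂ) α).re = ∑ i : ι, (1 : ℝ) := by
    rw [← Complex.re_sum, ← Finset.sum_mul, hsum, mul_assoc, hαα]; simp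
  have hre := (Finset.sum_eq_sum_iff_of_le hle).1 hsumre i (Finset.mem_univ i)
  have hn : ‖ζ i * (starRingEnd ℂ) α‖ = 1 := by
    rw [norm_mul, hnorm _ (hζ i), RCLike.norm_conj, hα1]; norm_num
  have him : (ζ i * (starRingEnd ℂ) α).im = 0 := by
    have := Complex.sq_norm_sub_sq_re (ζ i * (starRingEnd ℂ) α)
    rw [hn, hre] at this
    have h2 : (ζ i * (starRingEnd ℂ) α).im ^ 2 = 0 := by linarith
    exact pow_eq_zero_iff (two_ne_zero) |>.1 h2
  have h1 : ζ i * (starRingEnd ℂ) α = 1 := Complex.ext (by simpa using hre) (by simpa using him)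
  calc ζ i = ζ i * (starRingEnd ℂ) α * α := by rw [mul_assoc, mul_comm _ α, hαα, mul_one]
    _ = α := by rw [h1, one_mul]

theorem Matrix.roots_charpoly_pow_eq_one {d m : ℕ} (M : Matrix (Fin d) (Fin d) ℂ)
    (hM : M ^ m = 1) {μ : ℂ} (hμ : μ ∈ M.charpoly.roots) : μ ^ m = 1 := by
  have h1 : μ ∈ spectrum ℂ M := by
    rw [Matrix.mem_spectrum_iff_isRoot_charpoly]
    exact (Polynomial.mem_roots'.1 hμ).2
  have h2 := spectrum.pow_mem_pow M m h1
  rw [hM] at h2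
  have : Nontrivial (Matrix (Fin d) (Fin d) ℂ) := by
    by_contra hn
    rw [not_nontrivial_iff_subsingleton] at hn
    rw [spectrum.of_subsingleton] at h1
    exact h1
  rw [spectrum.one_eq] at h2
  exact h2

/-- The average of the eigenvalues, which are roots of unity, is the nonzero algebraic integer `α`,
so all of them equal `α`. Finite order makes the minimal polynomial squarefree, hence a divisor of
$X-\alpha$. -/
theorem Matrix.exists_scalar_of_integral_trace {d m : ℕ} (hd : 0 < d) (hm : 0 < m)
    (M : Matrix (Fin d) (Fin d) ℂ) (hM : M ^ m = 1) {α : ℂ} (htr : M.trace = d * α)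
    (hα : IsIntegral ℤ α) (h0 : α ≠ 0) : M = Matrix.scalar (Fin d) α := by
  classical
  have hroots : M.charpoly.roots = Multiset.replicate d α := by
    have hc : Multiset.card M.charpoly.roots = d := by
      rw [← (IsAlgClosed.splits M.charpoly).natDegree_eq_card_roots,
        Matrix.charpoly_natDegree_eq_dim, Fintype.card_fin]
    obtain ⟨l, hl⟩ := Quot.exists_rep M.charpoly.roots
    have hl' : M.charpoly.roots = (l : Multiset ℂ) := hl.symm
    have hlen : l.length = d := by rw [← hc, hl']; simp
    rw [Multiset.eq_replicate]
    refine ⟨hc, fun b hb => ?_⟩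
    rw [hl', Multiset.mem_coe] at hb
    obtain ⟨i, rfl⟩ := List.get_of_mem hb
    refine roots_of_unity_eq_of_integral_average hm (fun i : Fin l.length => l.get i)
      (fun i => ?_) ?_ hα h0 (by simp [hlen, hd]) i
    · exact Matrix.roots_charpoly_pow_eq_one M hM (by rw [hl']; simp)
    · have hcast : ((Fintype.card (Fin l.length) : ℕ) : ℂ) = d := by rw [Fintype.card_fin, hlen]
      rw [hcast, ← htr, Matrix.trace_eq_sum_roots_charpoly, hl',
        Multiset.sum_coe]
      simp [Fin.sum_univ_getElem]
  have hchar : M.charpoly = (Polynomial.X - Polynomial.C α) ^ d := by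
    have := (IsAlgClosed.splits M.charpoly).eq_prod_roots_of_monic (Matrix.charpoly_monic M)
    rw [hroots] at this
    simpa using this
  have hmin1 : minpoly ℂ M ∣ (Polynomial.X - Polynomial.C α) ^ d := by
    rw [← hchar]; exact minpoly.dvd _ _ (Matrix.aeval_self_charpoly M)
  have hmin2 : minpoly ℂ M ∣ Polynomial.X ^ m - 1 := by
    apply minpoly.dvd; simp [hM]
  have hsq : Squarefree (minpoly ℂ M) := by
    refine Squarefree.squarefree_of_dvd hmin2 (Polynomial.Separable.squarefree ?_)
    exact Polynomial.separable_X_pow_sub_C (1 : ℂ) (by exact_mod_cast hm.ne') one_ne_zero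
  have hmin3 : minpoly ℂ M ∣ Polynomial.X - Polynomial.C α :=
    (hsq.dvd_pow_iff_dvd hd.ne').1 hmin1
  have h := Polynomial.aeval_eq_zero_of_dvd_aeval_eq_zero hmin3 (minpoly.aeval ℂ M)
  simp only [map_sub, Polynomial.aeval_X, Polynomial.aeval_C] at h
  rw [sub_eq_zero.1 h]; rfl

-- The trace of left multiplication by `a` on the group algebra, computed in the basis of group
-- elements and in the basis of matrix units.
open MonoidAlgebra in
theorem sum_dim_mul_trace {G : Type*} [Group G] [Fintype G] {n : ℕ} {d : Fin n → ℕ}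
    (e : MonoidAlgebra ℂ G ≃ₐ[ℂ] ((i : Fin n) → Matrix (Fin (d i)) (Fin (d i)) ℂ))
    (a : MonoidAlgebra ℂ G) :
    ∑ i, (d i : ℂ) * (e a i).trace = Fintype.card G * a.coeff 1 := by
  classical
  have h1 : LinearMap.trace ℂ _ (LinearMap.mulLeft ℂ a) = Fintype.card G * a.coeff 1 := by
    rw [LinearMap.trace_eq_matrix_trace ℂ (MonoidAlgebra.basis G ℂ), Matrix.trace]
    have : ∀ g : G, (LinearMap.toMatrix (MonoidAlgebra.basis G ℂ) (MonoidAlgebra.basis G ℂ)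
        (LinearMap.mulLeft ℂ a)).diag g = a.coeff 1 := fun g => by
      rw [Matrix.diag_apply, LinearMap.toMatrix_apply]
      simp [MonoidAlgebra.basis]
    rw [Finset.sum_congr rfl fun g _ => this g]
    simp
  have h2 : LinearMap.trace ℂ _ (LinearMap.mulLeft ℂ (e a)) = ∑ i, (d i : ℂ) * (e a i).trace := by
    rw [LinearMap.trace_eq_matrix_trace ℂ (Pi.basis fun i => Matrix.stdBasis ℂ (Fin (d i)) (Fin (d i))),
      Matrix.trace, Fintype.sum_sigma]
    refine Finset.sum_congr rfl fun i _ => ?_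
    rw [Fintype.sum_prod_type, Matrix.trace, Finset.mul_sum]
    have : ∀ x y, (LinearMap.toMatrix (Pi.basis fun i => Matrix.stdBasis ℂ (Fin (d i)) (Fin (d i)))
        (Pi.basis fun i => Matrix.stdBasis ℂ (Fin (d i)) (Fin (d i)))
        (LinearMap.mulLeft ℂ (e a))).diag ⟨i, x, y⟩ = e a i x x := fun x y => by
      rw [Matrix.diag_apply, LinearMap.toMatrix_apply, Pi.basis_repr, Pi.basis_apply]
      rw [Matrix.stdBasis_eq_single]
      simp [Matrix.stdBasis]
    refine Finset.sum_congr rfl fun x _ => ?_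
    rw [Finset.sum_congr rfl fun y _ => this x y]
    simp
  rw [← h1, ← h2, ← LinearMap.trace_conj' (LinearMap.mulLeft ℂ a) e.toLinearEquiv]
  congr 1
  ext x
  simp [LinearEquiv.conj_apply]

section Components

variable {G : Type*} [Group G] {n : ℕ} {d : Fin n → ℕ}
  (e : MonoidAlgebra ℂ G ≃ₐ[ℂ] ((i : Fin n) → Matrix (Fin (d i)) (Fin (d i)) ℂ))

/-- The representation of `G` on the `i`-th simple component of its group algebra. -/
noncomputable def componentRep (i : Fin n) : G →* Matrix (Fin (d i)) (Fin (d i)) ℂ where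
  toFun g := e (MonoidAlgebra.of ℂ G g) i
  map_one' := by rw [map_one, map_one, Pi.one_apply]
  map_mul' g h := by rw [map_mul, map_mul, Pi.mul_apply]

theorem componentRep_apply (i : Fin n) (g : G) :
    componentRep e i g = e (MonoidAlgebra.of ℂ G g) i := rfl

theorem exists_scalar_of_central {x : MonoidAlgebra ℂ G}
    (hx : ∀ g, MonoidAlgebra.of ℂ G g * x = x * MonoidAlgebra.of ℂ G g) (i : Fin n) :
    ∃ c, e x i = Matrix.scalar (Fin (d i)) c := by
  classical
  have hx' : ∀ y, y * x = x * y := fun y => by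
    induction y using MonoidAlgebra.induction_linear with
    | zero => simp
    | add a b ha hb => rw [add_mul, ha, hb, mul_add]
    | single g c =>
      have : MonoidAlgebra.single g c = c • MonoidAlgebra.of ℂ G g := by simp
      rw [this, smul_mul_assoc, hx, mul_smul_comm]
  have : e x i ∈ Set.center (Matrix (Fin (d i)) (Fin (d i)) ℂ) := by
    rw [Semigroup.mem_center_iff]
    intro M
    have h := congrArg (fun y => e y i) (hx' (e.symm (Pi.single i M)))
    simpa using h
  rw [Matrix.center_eq_range] at this
  obtain ⟨c, hc⟩ := this
  exact ⟨c, hc.symm⟩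

variable [Fintype G]

theorem isIntegral_trace_componentRep (i : Fin n) (g : G) :
    IsIntegral ℤ (componentRep e i g).trace := by
  rw [Matrix.trace_eq_sum_roots_charpoly]
  refine IsIntegral.multiset_sum fun μ hμ => ?_
  refine IsIntegral.of_pow Fintype.card_pos (n := Fintype.card G) ?_
  rw [Matrix.roots_charpoly_pow_eq_one (componentRep e i g) (by rw [← map_pow, pow_card_eq_one, map_one]) hμ]
  exact isIntegral_one

/-- The class sum is central, so it acts on the component by a scalar, and taking traces identifies
that scalar with the number in question. It is integral because the class sum lies in $\mathbb
Z[G]$, which is finite over $\mathbb Z$. -/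
theorem isIntegral_card_mul_trace_div [∀ i, NeZero (d i)] (i : Fin n) (g : G)
    (C : Finset G) (hC : ∀ h, h ∈ C ↔ IsConj g h) :
    IsIntegral ℤ (C.card * ((componentRep e i g).trace / d i)) := by
  classical
  have hd : (d i : ℂ) ≠ 0 := by exact_mod_cast (NeZero.ne (d i))
  obtain ⟨ω, hω⟩ := exists_scalar_of_central e (x := ∑ h ∈ C, MonoidAlgebra.of ℂ G h) (by
    intro y
    rw [Finset.mul_sum, Finset.sum_mul]
    refine Finset.sum_bij' (fun h _ => y * h * y⁻¹) (fun h _ => y⁻¹ * h * y) ?_ ?_ ?_ ?_ ?_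
    · intro h hh
      rw [hC] at hh ⊢
      exact hh.trans (isConj_iff.2 ⟨y, rfl⟩)
    · intro h hh
      rw [hC] at hh ⊢
      exact hh.trans (isConj_iff.2 ⟨y⁻¹, by simp⟩)
    · intro h _; group
    · intro h _; group
    · intro h _
      rw [← map_mul, ← map_mul]; congr 1; group) i
  have hω' : ∑ h ∈ C, componentRep e i h = Matrix.scalar (Fin (d i)) ω := by
    rw [← hω, map_sum, Finset.sum_apply]; rfl
  have htr : (C.card : ℂ) * (componentRep e i g).trace = d i * ω := by
    have h := congrArg Matrix.trace hω'
    rw [Matrix.trace_sum] at h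
    have h2 : ∀ h ∈ C, (componentRep e i h).trace = (componentRep e i g).trace := by
      intro h hh
      obtain ⟨y, rfl⟩ := isConj_iff.1 ((hC h).1 hh)
      rw [map_mul, Matrix.trace_mul_comm, ← map_mul]; congr 2; group
    rw [Finset.sum_congr rfl h2] at h
    simpa using h
  have : (C.card : ℂ) * ((componentRep e i g).trace / d i) = ω := by
    rw [← mul_div_assoc, htr]; field_simp
  rw [this]
  have hint : IsIntegral ℤ (Matrix.scalar (Fin (d i)) ω) := by
    rw [← hω']
    have h := (IsIntegral.of_finite ℤ (∑ h ∈ C, MonoidAlgebra.of ℤ G h)).map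
      (MonoidAlgebra.lift ℤ (Matrix (Fin (d i)) (Fin (d i)) ℂ) G (componentRep e i))
    simpa using h
  exact (isIntegral_algebraMap_iff (A := ℂ) (B := Matrix (Fin (d i)) (Fin (d i)) ℂ)
    (algebraMap ℂ (Matrix (Fin (d i)) (Fin (d i)) ℂ)).injective).1 hint

-- Apply `sum_dim_mul_trace` to the sum of all group elements: it acts as $|G|$ on components with
-- trivial action and as zero on the others.
open Classical in
theorem sum_sq_dim_trivial :
    ∑ i with ∀ g, componentRep e i g = 1, (d i : ℂ) * d i = 1 := by
  have hcard : (Fintype.card G : ℂ) ≠ 0 := by exact_mod_cast Fintype.card_pos.ne'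
  set N : MonoidAlgebra ℂ G := ∑ h, MonoidAlgebra.of ℂ G h with hN
  have hgN : ∀ g, MonoidAlgebra.of ℂ G g * N = N := fun g => by
    rw [hN, Finset.mul_sum]
    exact Fintype.sum_equiv (Equiv.mulLeft g) _ _ fun h => by simp
  have hNg : ∀ g, N * MonoidAlgebra.of ℂ G g = N := fun g => by
    rw [hN, Finset.sum_mul]
    exact Fintype.sum_equiv (Equiv.mulRight g) _ _ fun h => by simp
  have h := sum_dim_mul_trace e N
  have hN1 : N.coeff 1 = 1 := by
    simp [hN, MonoidAlgebra.coeff_sum, MonoidAlgebra.of_apply, Finsupp.single_apply]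
  rw [hN1, mul_one] at h
  have hi : ∀ i, (d i : ℂ) * (e N i).trace =
      if ∀ g, componentRep e i g = 1 then Fintype.card G * ((d i : ℂ) * d i) else 0 := by
    intro i
    split_ifs with ht
    · have : e N i = (Fintype.card G : ℂ) • 1 := by
        rw [hN, map_sum, Finset.sum_apply]
        simp_rw [← componentRep_apply, ht]
        simp [Algebra.smul_def]
      rw [this]; simp; ring
    · push Not at ht
      obtain ⟨g, hg⟩ := ht
      obtain ⟨c, hc⟩ := exists_scalar_of_central e (x := N) (fun g => by rw [hgN, hNg]) i
      have h2 : componentRep e i g * e N i = e N i := by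
        rw [componentRep_apply, ← Pi.mul_apply, ← map_mul, hgN]
      have hc' : e N i = c • 1 := by rw [hc, Matrix.smul_one_eq_diagonal]; rfl
      have h3 : c • (componentRep e i g - 1) = 0 := by
        rw [hc', mul_smul_comm, mul_one] at h2
        rw [smul_sub, h2, sub_self]
      rcases smul_eq_zero.1 h3 with h4 | h4
      · rw [hc', h4]; simp
      · exact absurd (sub_eq_zero.1 h4) hg
  rw [Finset.sum_congr rfl fun i _ => hi i, ← Finset.sum_filter, ← Finset.mul_sum] at h
  exact mul_left_cancel₀ hcard (h.trans (mul_one _).symm)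

/-- Otherwise each nontrivial component has $p\mid d_i$ or $\chi_i(g)=0$. Since $\sum_i
d_i\chi_i(g)=0$ and the trivial part contributes 1, the number $-1/p$ would be an algebraic integer.
-/
theorem exists_component_scalar [∀ i, NeZero (d i)] {p k : ℕ} (hp : p.Prime) {g : G} (hg : g ≠ 1)
    (C : Finset G) (hC : ∀ h, h ∈ C ↔ IsConj g h) (hCp : C.card = p ^ k) :
    ∃ i, (∃ h, componentRep e i h ≠ 1) ∧ ∃ c, componentRep e i g = Matrix.scalar _ c := by
  classical
  by_contra hcon
  push Not at hcon
  have hsum := sum_dim_mul_trace e (MonoidAlgebra.of ℂ G g)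
  rw [show (MonoidAlgebra.of ℂ G g).coeff 1 = 0 by
    simp [MonoidAlgebra.of_apply, hg], mul_zero] at hsum
  have hkey : ∀ i, (∃ h, componentRep e i h ≠ 1) →
      ∃ β : ℂ, IsIntegral ℤ β ∧ (d i : ℂ) * (componentRep e i g).trace = p * β := by
    intro i hi
    have hd : (d i : ℂ) ≠ 0 := by exact_mod_cast (NeZero.ne (d i))
    have hχ := isIntegral_trace_componentRep e i g
    by_cases hpd : p ∣ d i
    · obtain ⟨m, hm⟩ := hpd
      refine ⟨m * (componentRep e i g).trace, (isIntegral_natCast m).mul hχ, ?_⟩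
      have hm' : (d i : ℂ) = p * m := by rw [hm]; push_cast; rfl
      rw [hm']; ring
    · refine ⟨0, isIntegral_zero, ?_⟩
      by_contra hne
      have htr0 : (componentRep e i g).trace ≠ 0 := by
        intro h0; apply hne; rw [h0]; simp
      have hω := isIntegral_card_mul_trace_div e i g C hC
      -- A Bézout relation between $|C|=p^k$ and $d_i$ writes $\chi_i(g)/d_i$ as an integral
      -- combination of the integers $|C|\chi_i(g)/d_i$ and $\chi_i(g)$.
      have hcop : IsCoprime ((p ^ k : ℕ) : ℤ) (d i : ℤ) :=
        Nat.isCoprime_iff_coprime.2 (Nat.Coprime.pow_left _ ((Nat.Prime.coprime_iff_not_dvd hp).2 hpd))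
      obtain ⟨u, v, huv⟩ := hcop
      have hα : IsIntegral ℤ ((componentRep e i g).trace / d i) := by
        have : (componentRep e i g).trace / d i = u * (C.card * ((componentRep e i g).trace / d i)) +
            v * (componentRep e i g).trace := by
          have h2 : ((u * (p ^ k : ℕ) + v * d i : ℤ) : ℂ) = 1 := by rw [huv]; simp
          rw [hCp]
          push_cast at h2 ⊢
          calc _ = (1 : ℂ) * ((componentRep e i g).trace / d i) := (one_mul _).symm
            _ = _ := by rw [← h2]; field_simp
        rw [this]
        exact ((isIntegral_intCast u).mul hω).add ((isIntegral_intCast v).mul hχ)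
      exact (hcon i hi) _ (Matrix.exists_scalar_of_integral_trace (NeZero.pos (d i))
        (Fintype.card_pos (α := G)) _ (by rw [← map_pow, pow_card_eq_one, map_one])
        (by field_simp) hα (div_ne_zero htr0 hd))
  choose! β hβ hβ' using hkey
  have h1 := sum_sq_dim_trivial e
  have hs : ∑ i, (d i : ℂ) * (componentRep e i g).trace = 1 + p * ∑ i with ¬ ∀ g, componentRep e i g = 1, β i := by
    rw [← Finset.sum_filter_add_sum_filter_not _ (fun i => ∀ g, componentRep e i g = 1), ← h1,
      Finset.mul_sum]
    congr 1
    · refine Finset.sum_congr rfl fun i hi => ?_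
      rw [(Finset.mem_filter.1 hi).2 g]; simp
    · refine Finset.sum_congr rfl fun i hi => ?_
      have := (Finset.mem_filter.1 hi).2
      push Not at this
      exact hβ' i this
  have h0 : 1 + p * ∑ i with ¬ ∀ g, componentRep e i g = 1, β i = 0 := hs.symm.trans hsum
  have hint : IsIntegral ℤ (∑ i with ¬ ∀ g, componentRep e i g = 1, β i) := by
    refine IsIntegral.sum _ fun i hi => ?_
    have := (Finset.mem_filter.1 hi).2
    push Not at this
    exact hβ i this
  have hp0 : (p : ℂ) ≠ 0 := by exact_mod_cast hp.ne_zero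
  have hq : IsIntegral ℤ (algebraMap ℚ ℂ (-1 / p)) := by
    have : algebraMap ℚ ℂ (-1 / p) = ∑ i with ¬ ∀ g, componentRep e i g = 1, β i := by
      simp only [eq_ratCast]
      push_cast
      field_simp
      linear_combination -h0
    rw [this]; exact hint
  rw [isIntegral_algebraMap_iff (algebraMap ℚ ℂ).injective, IsIntegrallyClosed.isIntegral_iff] at hq
  obtain ⟨z, hz⟩ := hq
  have hpq : (p : ℚ) ≠ 0 := by exact_mod_cast hp.ne_zero
  simp only [eq_intCast] at hz
  field_simp at hz
  have hz' : z * p = -1 := by exact_mod_cast hz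
  have : (p : ℤ) ∣ 1 := ⟨-z, by linarith⟩
  exact hp.one_lt.ne' (by exact_mod_cast Int.eq_one_of_dvd_one (by positivity) this)

end Components

/-- **Burnside**: a finite simple group with a nontrivial conjugacy class of prime power size is
commutative. -/
theorem IsSimpleGroup.commute_of_card_conj_eq_prime_pow {G : Type*} [Group G] [Finite G]
    [IsSimpleGroup G] {p k : ℕ} (hp : p.Prime) {g : G} (hg : g ≠ 1)
    (hc : Nat.card {h // IsConj g h} = p ^ k) (x y : G) : x * y = y * x := by
  classical
  have := Fintype.ofFinite G
  obtain ⟨n, d, hd, ⟨e⟩⟩ :=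
    IsSemisimpleRing.exists_algEquiv_pi_matrix_of_isAlgClosed ℂ (MonoidAlgebra ℂ G)
  obtain ⟨i, ⟨h, hh⟩, c, hgc⟩ := exists_component_scalar e hp hg (Finset.univ.filter (IsConj g))
    (by simp) (by rw [← hc, Nat.card_eq_fintype_card, Fintype.card_subtype])
  -- The elements acting centrally in the chosen component. This normal subgroup contains `g`, hence
  -- is everything by simplicity, while the representation is faithful; so the group is commutative.
  let Z : Subgroup G :=
    { carrier := {x | ∀ M, M * componentRep e i x = componentRep e i x * M}
      mul_mem' := fun {a b} ha hb M => by
        rw [map_mul, ← mul_assoc, ha, mul_assoc, hb, mul_assoc]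
      one_mem' := fun M => by rw [map_one, one_mul, mul_one]
      inv_mem' := fun {a} ha M => by
        have h1 : componentRep e i a * componentRep e i a⁻¹ = 1 := by
          rw [← map_mul, mul_inv_cancel, map_one]
        have h2 : componentRep e i a⁻¹ * componentRep e i a = 1 := by
          rw [← map_mul, inv_mul_cancel, map_one]
        calc M * componentRep e i a⁻¹
            = componentRep e i a⁻¹ * (componentRep e i a * M) * componentRep e i a⁻¹ := by
              rw [← mul_assoc, h2, one_mul]
          _ = componentRep e i a⁻¹ * M := by
              rw [← ha M, mul_assoc, mul_assoc, h1, mul_one] }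
  have hZn : Z.Normal := ⟨fun a ha b M => by
    rw [map_mul, map_mul, ha, mul_assoc, ← map_mul, mul_inv_cancel, map_one, mul_one]
    exact ha M⟩
  have hgZ : g ∈ Z := fun M => by
    rw [hgc]; exact ((Matrix.scalar_commute c (fun _ => Commute.all _ _) M).eq).symm
  have hZ : Z = ⊤ := (hZn.eq_bot_or_eq_top).resolve_left fun hb => hg (by
    rw [hb] at hgZ; exact hgZ)
  have hK : (componentRep e i).ker = ⊥ :=
    ((componentRep e i).normal_ker.eq_bot_or_eq_top).resolve_right fun ht => hh (by
      have : h ∈ (componentRep e i).ker := by rw [ht]; trivial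
      exact this)
  have hx : x ∈ Z := by rw [hZ]; trivial
  apply (MonoidHom.ker_eq_bot_iff _).1 hK
  rw [map_mul, map_mul, hx]

end Burnside

/-! ### Solvability: the theorems of Burnside and Hall, and fixed points of Sylow generators -/

section Solvability

theorem nat_card_isConj_eq_index_centralizer {G : Type*} [Group G] (g : G) :
    Nat.card {h // IsConj g h} = (Subgroup.centralizer {g}).index := by
  have h1 : (MulAction.stabilizer (ConjAct G) g).index = (Subgroup.centralizer {g}).index := by
    rw [Subgroup.centralizer_eq_comap_stabilizer]
    exact (Subgroup.index_comap_of_surjective (MulAction.stabilizer (ConjAct G) g)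
      (f := (ConjAct.toConjAct (G := G)).toMonoidHom) (ConjAct.toConjAct (G := G)).surjective).symm
  rw [← h1, MulAction.index_stabilizer, ← Nat.card_coe_set_eq]
  refine Nat.card_congr (Equiv.subtypeEquivRight fun h => ?_)
  rw [ConjAct.mem_orbit_conjAct, isConj_comm]

theorem Nat.eq_prime_pow_of_primeFactors_subset {m r : ℕ} (hm : m ≠ 0) (h : m.primeFactors ⊆ {r}) :
    m = r ^ m.factorization r := by
  conv_lhs => rw [← Nat.prod_factorization_pow_eq_self hm]
  rw [Finsupp.prod_of_support_subset (s := {r}) _ h _ (by simp)]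
  simp

/-- **Burnside's `p^a q^b` theorem**. -/
theorem isSolvable_of_card_primeFactors_subset {p q : ℕ} (hp : p.Prime) (hq : q.Prime) (N : ℕ) :
    ∀ (G : Type*) [Group G] [Finite G], Nat.card G = N → (Nat.card G).primeFactors ⊆ {p, q} →
      Group.IsSolvable G := by
  induction N using Nat.strong_induction_on with
  | _ N ih =>
  intro G _ _ hN hpq
  rcases subsingleton_or_nontrivial G with hs | hnt
  · infer_instance
  by_cases hsimple : IsSimpleGroup G
  · have key : ∀ r s : ℕ, r.Prime → s.Prime → r ∣ Nat.card G →
        (Nat.card G).primeFactors ⊆ {r, s} → Group.IsSolvable G := by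
      intro r s hr hs hrG hrs
      have := Fact.mk hr
      obtain ⟨R⟩ : Nonempty (Sylow r G) := inferInstance
      have hRnt : Nontrivial R := by
        rw [Subgroup.nontrivial_iff_ne_bot]
        exact R.ne_bot_of_dvd_card hrG
      have hc := R.isPGroup'.center_nontrivial
      obtain ⟨⟨z, hz⟩, hz1⟩ := exists_ne (1 : Subgroup.center R)
      have hz1' : (z : G) ≠ 1 := by
        intro h; apply hz1; apply Subtype.ext; apply Subtype.ext; exact h
      -- An element central in a Sylow `r`-subgroup has class size dividing the index of that
      -- subgroup, hence a power of the other prime `s`.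
      have hRC : (R : Subgroup G) ≤ Subgroup.centralizer {(z : G)} := by
        intro x hx
        rw [Subgroup.mem_centralizer_singleton_iff]
        have := (Subgroup.mem_center_iff.1 hz) ⟨x, hx⟩
        exact congrArg Subtype.val this
      have hidx : (Subgroup.centralizer {(z : G)}).index ∣ (R : Subgroup G).index :=
        Subgroup.index_dvd_of_le hRC
      have hsub : (Subgroup.centralizer {(z : G)}).index.primeFactors ⊆ {s} := by
        intro t ht
        have htp := Nat.prime_of_mem_primeFactors ht
        have htd := (Nat.dvd_of_mem_primeFactors ht).trans hidx
        have htG : t ∈ (Nat.card G).primeFactors :=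
          Nat.mem_primeFactors.2 ⟨htp, htd.trans (Subgroup.index_dvd_card _), Nat.card_pos.ne'⟩
        have := hrs htG
        simp only [Finset.mem_insert, Finset.mem_singleton] at this ⊢
        rcases this with rfl | h
        · exact absurd htd (R.not_dvd_index)
        · exact h
      refine Group.isSolvable_of_comm
        (IsSimpleGroup.commute_of_card_conj_eq_prime_pow hs hz1'
          ((nat_card_isConj_eq_index_centralizer _).trans
            (Nat.eq_prime_pow_of_primeFactors_subset Subgroup.FiniteIndex.index_ne_zero hsub)))
    obtain ⟨r, hr, hrG⟩ := Nat.exists_prime_and_dvd (Finite.one_lt_card (α := G)).ne'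
    have hr' := hpq (Nat.mem_primeFactors.2 ⟨hr, hrG, Nat.card_pos.ne'⟩)
    simp only [Finset.mem_insert, Finset.mem_singleton] at hr'
    rcases hr' with rfl | rfl
    · exact key r q hr hq hrG hpq
    · exact key r p hr hp hrG (by rwa [Finset.pair_comm])
  · have : ∃ M : Subgroup G, M.Normal ∧ M ≠ ⊥ ∧ M ≠ ⊤ := by
      by_contra hcon
      push Not at hcon
      exact hsimple ⟨fun M hM => or_iff_not_imp_left.2 (hcon M hM)⟩
    obtain ⟨M, hM, hMb, hMt⟩ := this
    have h1 := Subgroup.card_mul_index M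
    have hi : 1 < M.index := M.one_lt_index_of_ne_top hMt
    have hc : 1 < Nat.card M := (Subgroup.one_lt_card_iff_ne_bot M).2 hMb
    have hdv : ∀ m, m ∣ Nat.card G → m.primeFactors ⊆ {p, q} := fun m hm =>
      (Nat.primeFactors_mono hm Nat.card_pos.ne').trans hpq
    rw [Group.isSolvable_iff_subgroup_quotient M]
    refine ⟨ih (Nat.card M) ?_ M rfl (hdv _ M.card_subgroup_dvd_card),
      ih (Nat.card (G ⧸ M)) ?_ _ rfl (hdv _ M.card_quotient_dvd_card)⟩
    · rw [← hN]; nlinarith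
    · rw [← hN, ← Subgroup.index_eq_card]; nlinarith

section Index

variable {G : Type*} [Group G] [Finite G] {H K : Subgroup G}

/-- Both indices divide $[G:H\cap K]$, so by coprimality so does their product, which is also an
upper bound. -/
theorem Subgroup.relIndex_eq_index_of_coprime (h : H.index.Coprime K.index) :
    H.relIndex K = H.index := by
  have h1 : H.relIndex K * K.index = (H ⊓ K).index := by
    rw [← Subgroup.inf_relIndex_right, Subgroup.relIndex_mul_index inf_le_right]
  have h2 : H.index ∣ H.relIndex K := by
    refine h.dvd_of_dvd_mul_right ?_
    rw [h1]; exact Subgroup.index_dvd_of_le inf_le_left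
  have h3 : H.relIndex K ≤ H.index := by
    have := Subgroup.index_inf_le (H := H) (K := K)
    rw [← h1] at this
    exact Nat.le_of_mul_le_mul_right this (Nat.pos_of_ne_zero Subgroup.FiniteIndex.index_ne_zero)
  have h4 : 0 < H.relIndex K := Nat.pos_of_ne_zero fun h0 =>
    Subgroup.FiniteIndex.index_ne_zero (Subgroup.index_eq_zero_of_relIndex_eq_zero h0)
  exact le_antisymm h3 (Nat.le_of_dvd h4 h2)

/-- By the index computation the `K`-orbit of the base point of `G ⧸ H` has full size, so `K` is
transitive on the cosets. -/
theorem Subgroup.exists_mul_of_coprime_index (h : H.index.Coprime K.index) (g : G) :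
    ∃ k ∈ K, ∃ x ∈ H, g = k * x := by
  have hst : MulAction.stabilizer K ((1 : G) : G ⧸ H) = H.subgroupOf K := by
    ext k
    rw [MulAction.mem_stabilizer_iff, Subgroup.mem_subgroupOf]
    change ((((k : G) * 1 : G)) : G ⧸ H) = _ ↔ _
    rw [mul_one, eq_comm, QuotientGroup.eq]; simp
  have h1 : (MulAction.orbit K ((1 : G) : G ⧸ H)).ncard = Nat.card (G ⧸ H) := by
    rw [← MulAction.index_stabilizer, hst, ← Subgroup.index_eq_card]
    exact Subgroup.relIndex_eq_index_of_coprime h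
  have h2 : MulAction.orbit K ((1 : G) : G ⧸ H) = Set.univ := by
    refine Set.eq_of_subset_of_ncard_le (Set.subset_univ _) ?_
    rw [Set.ncard_univ, h1]
  have h3 : (g : G ⧸ H) ∈ MulAction.orbit K ((1 : G) : G ⧸ H) := by rw [h2]; trivial
  obtain ⟨k, hk⟩ := h3
  refine ⟨k, k.2, (k : G)⁻¹ * g, ?_, by simp⟩
  have hk' : ((((k : G) * 1 : G)) : G ⧸ H) = g := hk
  rw [mul_one, QuotientGroup.eq] at hk'
  exact hk'

end Index

/-- A nontrivial finite solvable group has a nontrivial normal `p`-subgroup for some prime `p`. -/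
theorem exists_normal_isPGroup (G : Type*) [Group G] [Finite G] [Nontrivial G]
    [hG : Group.IsSolvable G] :
    ∃ (p : ℕ) (N : Subgroup G), p.Prime ∧ N.Normal ∧ N ≠ ⊥ ∧ IsPGroup p N := by
  classical
  have hex : ∃ n, derivedSeries G n = ⊥ := hG.solvable
  obtain ⟨m, hm⟩ : ∃ m, Nat.find hex = m + 1 := by
    refine Nat.exists_eq_succ_of_ne_zero fun h0 => ?_
    have := Nat.find_spec hex
    rw [h0, derivedSeries_zero] at this
    exact bot_ne_top this.symm
  have hAb : derivedSeries G m ≠ ⊥ := Nat.find_min hex (by omega)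
  have hcomm : ⁅derivedSeries G m, derivedSeries G m⁆ = ⊥ := by
    rw [← derivedSeries_succ, ← hm]; exact Nat.find_spec hex
  set A := derivedSeries G m with hA
  have hAn : A.Normal := derivedSeries_normal G m
  have hAc : ∀ a ∈ A, ∀ b ∈ A, a * b = b * a := by
    intro a ha b hb
    have := (Subgroup.commutator_eq_bot_iff_le_centralizer.1 hcomm) ha
    exact ((Subgroup.mem_centralizer_iff.1 this) b hb).symm
  obtain ⟨p, hp, hpA⟩ := Nat.exists_prime_and_dvd ((Subgroup.one_lt_card_iff_ne_bot A).2 hAb).ne'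
  have := Fact.mk hp
  -- The elements of `p`-power order in the last nontrivial derived subgroup `A`. They form a
  -- subgroup because `A` is abelian, and a normal one because both conditions are invariant under
  -- conjugation.
  let N : Subgroup G :=
    { carrier := {a | a ∈ A ∧ ∃ k, a ^ p ^ k = 1}
      one_mem' := ⟨A.one_mem, 0, by simp⟩
      mul_mem' := by
        rintro a b ⟨ha, k, hk⟩ ⟨hb, l, hl⟩
        refine ⟨A.mul_mem ha hb, k + l, ?_⟩
        rw [(show Commute a b from hAc a ha b hb).mul_pow, pow_add, pow_mul, hk, one_pow, one_mul,
          mul_comm, pow_mul, hl, one_pow]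
      inv_mem' := by
        rintro a ⟨ha, k, hk⟩
        exact ⟨A.inv_mem ha, k, by rw [inv_pow, hk, inv_one]⟩ }
  refine ⟨p, N, hp, ⟨?_⟩, ?_, ?_⟩
  · rintro a ⟨ha, k, hk⟩ g
    exact ⟨hAn.conj_mem a ha g, k, by rw [conj_pow, hk]; simp⟩
  · obtain ⟨x, hx⟩ := exists_prime_orderOf_dvd_card' p hpA
    intro hb
    have hxN : (x : G) ∈ N := ⟨x.2, 1, by
      rw [pow_one, ← Subgroup.coe_pow, ← hx, pow_orderOf_eq_one]; rfl⟩
    rw [hb, Subgroup.mem_bot] at hxN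
    have : x = 1 := Subtype.ext hxN
    rw [this, orderOf_one] at hx
    exact hp.one_lt.ne hx
  · rintro ⟨a, ha, k, hk⟩
    exact ⟨k, Subtype.ext hk⟩

/-- `G` has a Hall subgroup of index a power of `p` and order prime to `p`, for every prime `p`. -/
def HasPComplements (G : Type*) [Group G] : Prop :=
  ∀ p : ℕ, p.Prime → ∃ H : Subgroup G, (∃ k, H.index = p ^ k) ∧ ¬ p ∣ Nat.card H

theorem HasPComplements.quotient {G : Type*} [Group G] [Finite G] (h : HasPComplements G)
    (N : Subgroup G) [N.Normal] : HasPComplements (G ⧸ N) := by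
  intro p hp
  obtain ⟨H, ⟨k, hk⟩, hH⟩ := h p hp
  refine ⟨H.map (QuotientGroup.mk' N), ?_, fun hd => hH (hd.trans (Subgroup.card_map_dvd H _))⟩
  have := Subgroup.index_map_dvd H (QuotientGroup.mk'_surjective N)
  rw [hk, Nat.dvd_prime_pow hp] at this
  obtain ⟨m, -, hm⟩ := this
  exact ⟨m, hm⟩

theorem HasPComplements.subgroup {G : Type*} [Group G] [Finite G] (h : HasPComplements G)
    {p k : ℕ} (hp : p.Prime) (H : Subgroup G) (hHk : H.index = p ^ k) (hH : ¬ p ∣ Nat.card H) :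
    HasPComplements H := by
  intro q hq
  by_cases hqp : q = p
  · subst hqp
    refine ⟨⊤, ⟨0, by simp⟩, ?_⟩
    rwa [Subgroup.card_top]
  · obtain ⟨K, ⟨l, hl⟩, hK⟩ := h q hq
    refine ⟨K.subgroupOf H, ⟨l, ?_⟩, fun hd => hK (hd.trans ?_)⟩
    · change K.relIndex H = _
      rw [Subgroup.relIndex_eq_index_of_coprime, hl]
      rw [hl, hHk]
      exact Nat.Coprime.pow _ _ ((Nat.coprime_primes hq hp).2 hqp)
    · have h1 : Nat.card (K.subgroupOf H) = Nat.card ((K.subgroupOf H).map H.subtype) :=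
        (Subgroup.card_map_of_injective H.subtype_injective).symm
      rw [h1, Subgroup.subgroupOf_map_subtype]
      exact Subgroup.card_dvd_of_le inf_le_left

/-- Since the index of `K` is prime to `t`, a Sylow `t`-subgroup of `K` is one of `G`, and Sylow
subgroups are conjugate. -/
theorem Subgroup.exists_conj_le_of_isPGroup {G : Type*} [Group G] [Finite G] {t q k : ℕ}
    (ht : t.Prime) (hq : q.Prime) (htq : t ≠ q) {N K : Subgroup G} (hN : IsPGroup t N)
    (hK : K.index = q ^ k) : ∃ φ : G ≃* G, N ≤ K.map φ.toMonoidHom := by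
  have := Fact.mk ht
  obtain ⟨S⟩ : Nonempty (Sylow t K) := inferInstance
  have hS : IsPGroup t (S.map K.subtype) := S.isPGroup'.map K.subtype
  have hidx : ¬ t ∣ ((S : Subgroup K).map K.subtype).index := by
    rw [Subgroup.index_map_subtype, hK]
    intro hd
    rcases (ht.dvd_mul).1 hd with h | h
    · exact S.not_dvd_index h
    · exact htq ((Nat.prime_dvd_prime_iff_eq ht hq).1 (ht.dvd_of_dvd_pow h))
  let S' : Sylow t G := hS.toSylow hidx
  obtain ⟨P, hP⟩ := hN.exists_le_sylow
  obtain ⟨g, hg⟩ := MulAction.exists_smul_eq G P S'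
  refine ⟨MulAut.conj g⁻¹, fun n hn => ?_⟩
  have h1 : g * n * g⁻¹ ∈ (g • P : Sylow t G) :=
    Subgroup.smul_mem_pointwise_smul n (MulAut.conj g) _ (hP hn)
  rw [hg] at h1
  have h2 : g * n * g⁻¹ ∈ (S : Subgroup K).map K.subtype := h1
  obtain ⟨y, -, hy⟩ := h2
  refine ⟨g * n * g⁻¹, ?_, ?_⟩
  · rw [← hy]; exact y.2
  · simp [mul_assoc]

/-- **Hall**: a finite group with `p`-complements for all primes `p` is solvable. -/
theorem isSolvable_of_hasPComplements (M : ℕ) :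
    ∀ (G : Type*) [Group G] [Finite G], Nat.card G = M → HasPComplements G →
      Group.IsSolvable G := by
  induction M using Nat.strong_induction_on with
  | _ M ih =>
  intro G _ _ hM hG
  by_cases hfew : ∃ p q : ℕ, p.Prime ∧ q.Prime ∧ (Nat.card G).primeFactors ⊆ {p, q}
  · obtain ⟨p, q, hp, hq, hpq⟩ := hfew
    exact isSolvable_of_card_primeFactors_subset hp hq _ G rfl hpq
  have hcard : 2 < (Nat.card G).primeFactors.card := by
    by_contra hle
    apply hfew
    interval_cases h : (Nat.card G).primeFactors.card
    · exact ⟨2, 2, Nat.prime_two, Nat.prime_two, by rw [Finset.card_eq_zero.1 h]; simp⟩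
    · obtain ⟨p, hp⟩ := Finset.card_eq_one.1 h
      have hp' : p.Prime := Nat.prime_of_mem_primeFactors (by rw [hp]; simp)
      exact ⟨p, p, hp', hp', by rw [hp]; simp⟩
    · obtain ⟨p, q, -, hpq⟩ := Finset.card_eq_two.1 h
      exact ⟨p, q, Nat.prime_of_mem_primeFactors (by rw [hpq]; simp),
        Nat.prime_of_mem_primeFactors (by rw [hpq]; simp), hpq.subset⟩
  obtain ⟨p, q, r, hp, hq, hr, hpq, hpr, hqr⟩ := Finset.two_lt_card_iff.1 hcard
  rw [Nat.mem_primeFactors] at hp hq hr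
  have hsub : ∀ s : ℕ, s.Prime → s ∣ Nat.card G → ∃ H : Subgroup G, (∃ k, H.index = s ^ k) ∧
      Group.IsSolvable H := by
    intro s hs hsG
    obtain ⟨H, ⟨k, hk⟩, hH⟩ := hG s hs
    refine ⟨H, ⟨k, hk⟩, ih (Nat.card H) ?_ H rfl (hG.subgroup hs H hk hH)⟩
    rw [← hM]
    refine lt_of_le_of_ne (Nat.le_of_dvd Nat.card_pos H.card_subgroup_dvd_card) fun he => ?_
    rw [he] at hH; exact hH hsG
  obtain ⟨H, ⟨k, hk⟩, hHs⟩ := hsub p hp.1 hp.2.1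
  have hHnt : Nontrivial H := by
    rw [Subgroup.nontrivial_iff_ne_bot]
    rintro rfl
    rw [Subgroup.index_bot] at hk
    have := hq.2.1
    rw [hk] at this
    exact hpq ((Nat.prime_dvd_prime_iff_eq hq.1 hp.1).1 (hq.1.dvd_of_dvd_pow this)).symm
  obtain ⟨t, N, ht, hNn, hNb, hNt⟩ := exists_normal_isPGroup H
  -- This is where three primes are needed: `s` must avoid `p`, so that the two complements have
  -- coprime indices, and `t`, so that `N` fits into a conjugate of the `s`-complement.
  obtain ⟨s, hs, hsG, hst, hsp⟩ : ∃ s : ℕ, s.Prime ∧ s ∣ Nat.card G ∧ t ≠ s ∧ s ≠ p := by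
    by_cases htq : t = q
    · exact ⟨r, hr.1, hr.2.1, by rw [htq]; exact hqr, hpr.symm⟩
    · exact ⟨q, hq.1, hq.2.1, htq, hpq.symm⟩
  obtain ⟨K, ⟨l, hl⟩, hKs⟩ := hsub s hs hsG
  have hN' : IsPGroup t (N.map H.subtype) := hNt.map _
  obtain ⟨φ, hφ⟩ := Subgroup.exists_conj_le_of_isPGroup ht hs hst hN' hl
  have hcop : H.index.Coprime (K.map φ.toMonoidHom).index := by
    rw [Subgroup.index_map_of_bijective φ.bijective, hk, hl]
    exact Nat.Coprime.pow _ _ ((Nat.coprime_primes hp.1 hs).2 hsp.symm)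
  set L := Subgroup.normalClosure ((N.map H.subtype : Subgroup G) : Set G) with hL
  -- With $K'$ the conjugate of $K$, one has $G=K'H$ and $H$ normalizes $N$. Thus every conjugate of
  -- $N$ is a $K'$-conjugate, and the normal closure stays in the solvable group $K'$.
  have hLK : L ≤ K.map φ.toMonoidHom := by
    rw [hL, Subgroup.normalClosure, Subgroup.closure_le]
    intro y hy
    obtain ⟨n, hn, hny⟩ := Group.mem_conjugatesOfSet_iff.1 hy
    obtain ⟨c, rfl⟩ := isConj_iff.1 hny
    obtain ⟨x, hx, h, hh, rfl⟩ := Subgroup.exists_mul_of_coprime_index hcop c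
    obtain ⟨n, hn, rfl⟩ := hn
    have h1 : h * n * h⁻¹ ∈ K.map φ.toMonoidHom :=
      hφ ⟨⟨h, hh⟩ * n * ⟨h, hh⟩⁻¹, hNn.conj_mem n hn _, rfl⟩
    have h2 : x * h * n * (x * h)⁻¹ = x * (h * n * h⁻¹) * x⁻¹ := by group
    change x * h * n * (x * h)⁻¹ ∈ _
    rw [h2]
    exact mul_mem (mul_mem hx h1) (inv_mem hx)
  have hKφ : Group.IsSolvable (K.map φ.toMonoidHom) :=
    Group.isSolvable_of_surjective (φ.toMonoidHom.subgroupMap_surjective K)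
  have hLs : Group.IsSolvable L :=
    Group.isSolvable_of_isSolvable_injective (Subgroup.inclusion_injective hLK)
  have hLb : L ≠ ⊥ := by
    intro hb
    apply hNb
    rw [Subgroup.eq_bot_iff_forall]
    intro x hx
    have : (x : G) ∈ L := Subgroup.subset_normalClosure (Subgroup.mem_map_of_mem H.subtype hx)
    rw [hb, Subgroup.mem_bot] at this
    exact Subtype.ext this
  rw [Group.isSolvable_iff_subgroup_quotient L]
  refine ⟨hLs, ih (Nat.card (G ⧸ L)) ?_ _ rfl (hG.quotient L)⟩
  have h1 := Subgroup.card_mul_index L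
  have hc : 1 < Nat.card L := (Subgroup.one_lt_card_iff_ne_bot L).2 hLb
  have hi : 0 < L.index := Nat.pos_of_ne_zero Subgroup.FiniteIndex.index_ne_zero
  rw [← hM, ← Subgroup.index_eq_card]; nlinarith

/-- In a finite `p`-group, a subgroup whose conjugates generate is everything. -/
theorem IsPGroup.eq_top_of_conj_generate {P : Type*} [Group P] [Finite P] {p : ℕ} [Fact p.Prime]
    (hP : IsPGroup p P) {L : Subgroup P} {s : Set P} (hs : ∀ g ∈ s, ∃ x : P, x⁻¹ * g * x ∈ L)
    (hgen : Subgroup.closure s = ⊤) : L = ⊤ := by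
  by_contra hL
  obtain ⟨M, hM, hLM⟩ := (eq_top_or_exists_le_coatom L).resolve_left hL
  -- A maximal subgroup of a nilpotent group is normal, so one that contains a conjugate of each
  -- generator contains the generators themselves.
  have hnil := hP.isNilpotent
  have hMn : M.Normal :=
    Subgroup.NormalizerCondition.normal_of_coatom M Group.normalizerCondition_of_isNilpotent hM
  apply hM.1
  rw [eq_top_iff, ← hgen, Subgroup.closure_le]
  intro g hg
  obtain ⟨x, hx⟩ := hs g hg
  have := hMn.conj_mem _ (hLM hx) x
  have h2 : x * (x⁻¹ * g * x) * x⁻¹ = g := by group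
  rw [h2] at this
  exact this

/-- A finite solvable group each of whose Sylow subgroups is generated by elements with a fixed
point in the transitive `G`-set `G ⧸ K` has only the trivial such `G`-set. -/
theorem eq_top_of_sylow_generated_by_conj (M : ℕ) :
    ∀ (G : Type*) [Group G] [Finite G] [Group.IsSolvable G] (K : Subgroup G), Nat.card G = M →
      (∀ p : ℕ, p.Prime → ∃ P : Sylow p G,
        (P : Subgroup G) ≤ Subgroup.closure {g | g ∈ P ∧ ∃ x, x⁻¹ * g * x ∈ K}) → K = ⊤ := by
  induction M using Nat.strong_induction_on with
  | _ M ih =>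
  intro G _ _ _ K hM hK
  rcases subsingleton_or_nontrivial G with hs | hnt
  · exact Subsingleton.elim _ _
  obtain ⟨p, N, hp, hN, hNb, hNp⟩ := exists_normal_isPGroup G
  have := Fact.mk hp
  -- The hypothesis passes to the quotient by `N`, so induction gives $G=NK$; it remains to prove
  -- $N\le K$.
  have hquot : K.map (QuotientGroup.mk' N) = ⊤ := by
    refine ih (Nat.card (G ⧸ N)) ?_ (G ⧸ N) _ rfl ?_
    · have h1 := Subgroup.card_mul_index N
      have hc : 1 < Nat.card N := (Subgroup.one_lt_card_iff_ne_bot N).2 hNb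
      have hi : 0 < N.index := Nat.pos_of_ne_zero Subgroup.FiniteIndex.index_ne_zero
      rw [← hM, ← Subgroup.index_eq_card]; nlinarith
    · intro q hq
      have := Fact.mk hq
      obtain ⟨Q, hQ⟩ := hK q hq
      refine ⟨Q.mapSurjective (QuotientGroup.mk'_surjective N), ?_⟩
      rw [Sylow.coe_mapSurjective]
      refine (Subgroup.map_mono hQ).trans ?_
      rw [MonoidHom.map_closure]
      refine Subgroup.closure_mono ?_
      rintro _ ⟨g, ⟨hg, x, hx⟩, rfl⟩
      exact ⟨Subgroup.mem_map_of_mem _ hg, QuotientGroup.mk' N x, _, hx, by simp⟩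
  have hKN : ∀ g : G, ∃ n ∈ N, ∃ k ∈ K, g = n * k := by
    intro g
    have hg : QuotientGroup.mk' N g ∈ K.map (QuotientGroup.mk' N) := by rw [hquot]; trivial
    obtain ⟨k, hk, hkg⟩ := hg
    have h1 : k⁻¹ * g ∈ N := QuotientGroup.eq.1 hkg
    have h2 := hN.conj_mem _ h1 k
    refine ⟨_, h2, k, hk, by group⟩
  obtain ⟨P, hP⟩ := hK p hp
  have hNP : N ≤ P := IsPGroup.le_sylow_of_normal hNp P
  -- A generator of `P` is conjugated into `K` by some $x=nk$, hence already by $n\in N\le P$. So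
  -- the conjugations take place inside the `p`-group `P`.
  have hPK : K.subgroupOf P = ⊤ := by
    refine IsPGroup.eq_top_of_conj_generate P.isPGroup'
      (s := {g | ∃ x, x⁻¹ * (g : G) * x ∈ K}) ?_ ?_
    · rintro g ⟨x, hx⟩
      obtain ⟨n, hn, k, hk, rfl⟩ := hKN x
      refine ⟨⟨n, hNP hn⟩, ?_⟩
      rw [Subgroup.mem_subgroupOf]
      have h2 := K.mul_mem (K.mul_mem hk hx) (K.inv_mem hk)
      have h3 : k * ((n * k)⁻¹ * g * (n * k)) * k⁻¹ = n⁻¹ * g * n := by group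
      rw [h3] at h2
      exact h2
    · rw [eq_top_iff]
      rintro ⟨g, hg⟩ -
      have h1 := hP hg
      have h2 : {g | g ∈ P ∧ ∃ x, x⁻¹ * g * x ∈ K} =
          (P : Subgroup G).subtype '' {g | ∃ x, x⁻¹ * (g : G) * x ∈ K} := by
        ext y
        constructor
        · rintro ⟨hy, hx⟩; exact ⟨⟨y, hy⟩, hx, rfl⟩
        · rintro ⟨⟨z, hz⟩, hx, rfl⟩; exact ⟨hz, hx⟩
      rw [h2, ← MonoidHom.map_closure] at h1
      obtain ⟨y, hy, hyg⟩ := h1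
      have : y = ⟨g, hg⟩ := Subtype.ext hyg
      rw [← this]; exact hy
  rw [Subgroup.subgroupOf_eq_top] at hPK
  rw [eq_top_iff]
  intro g _
  obtain ⟨n, hn, k, hk, rfl⟩ := hKN g
  exact K.mul_mem (hPK (hNP hn)) hk

end Solvability

/-! ### Bijective-cocycle arguments for a finite group acting on $\mathbb N^X$ -/

section Cocycle

/-- All fibres of `f` are in bijection with the fibre over 1: for a section `s`, the fibre over `g`
consists of the elements `s g + act g b` with `f b = 1`. -/
theorem Nat.card_dvd_card_of_cocycle {A G : Type*} [AddCommGroup A] [Finite A] [Group G]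
    (act : G → A ≃+ A) (f : A → G) (hf : ∀ a b, f (a + act (f a) b) = f a * f b)
    (hsurj : Function.Surjective f) : Nat.card G ∣ Nat.card A := by
  obtain ⟨s, hs⟩ := hsurj.hasRightInverse
  have e : A ≃ G × {b : A // f b = 1} :=
    { toFun := fun a => (f a, ⟨(act (f a)).symm (a - s (f a)), by
        have h := hf (s (f a)) ((act (f a)).symm (a - s (f a)))
        rw [hs, AddEquiv.apply_symm_apply, add_sub_cancel] at h
        exact _root_.mul_eq_left.1 h.symm⟩)
      invFun := fun q => s q.1 + act q.1 q.2
      left_inv := fun a => by simp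
      right_inv := fun q => by
        obtain ⟨g, b, hb⟩ := q
        have h : f (s g + act g b) = g := by
          have := hf (s g) b
          rwa [hs, hb, mul_one] at this
        simp [h] }
  rw [Nat.card_congr e, Nat.card_prod]
  exact dvd_mul_right _ _

theorem Subgroup.index_dvd_card_of_forall_mul {G : Type*} [Group G] {P H : Subgroup G}
    (h : ∀ g : G, ∃ x ∈ P, ∃ y ∈ H, g = x * y) : H.index ∣ Nat.card P := by
  have h2 : MulAction.orbit P ((1 : G) : G ⧸ H) = Set.univ := by
    rw [Set.eq_univ_iff_forall]
    intro q
    induction q using QuotientGroup.induction_on with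
    | H g =>
    obtain ⟨x, hx, y, hy, rfl⟩ := h g
    refine ⟨⟨x, hx⟩, ?_⟩
    change (((x * 1 : G)) : G ⧸ H) = _
    rw [mul_one, QuotientGroup.eq]; simpa using hy
  have h3 := MulAction.index_stabilizer (G := P) ((1 : G) : G ⧸ H)
  rw [h2, Set.ncard_univ, ← Subgroup.index_eq_card] at h3
  rw [← h3]; exact Subgroup.index_dvd_card _

variable {G X : Type*} [Group G] [Finite G] [MulAction G X]
  {f : (X → ℕ) → G}

/-- The subgroup of values on multiples of `k` of a cocycle-like map. -/
def multiplesSubgroup (f : (X → ℕ) → G)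
    (hf : ∀ a b, f (a + fun x => b ((f a)⁻¹ • x)) = f a * f b) (k : ℕ) : Subgroup G where
  carrier := Set.range fun a : X → ℕ => f (k • a)
  one_mem' := ⟨0, by
    have := hf 0 0
    simp only [Pi.zero_apply] at this
    have h0 : f (0 + fun _ => 0) = f 0 := by congr 1
    rw [h0] at this
    simpa using (mul_eq_left.1 this.symm)⟩
  mul_mem' := by
    rintro _ _ ⟨a, rfl⟩ ⟨b, rfl⟩
    refine ⟨a + fun x => b ((f (k • a))⁻¹ • x), ?_⟩
    simp only
    rw [← hf]; congr 1; ext x; simp [mul_add]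
  inv_mem' := by
    rintro _ ⟨a, rfl⟩
    -- There are no negatives in $\mathbb N^X$, so the inverse is produced as a positive power,
    -- using that the group is finite.
    have hmul : ∀ N : ℕ, ∃ b, f (k • b) = f (k • a) ^ (N + 1) := by
      intro N
      induction N with
      | zero => exact ⟨a, by simp⟩
      | succ N ih =>
        obtain ⟨b, hb⟩ := ih
        refine ⟨b + fun x => a ((f (k • b))⁻¹ • x), ?_⟩
        rw [pow_succ, ← hb, ← hf]; congr 1; ext x; simp [mul_add]
    have hN : 0 < orderOf (f (k • a)) := orderOf_pos _
    rcases Nat.lt_or_ge 1 (orderOf (f (k • a))) with h1 | h1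
    · obtain ⟨b, hb⟩ := hmul (orderOf (f (k • a)) - 2)
      refine ⟨b, ?_⟩
      simp only
      rw [hb, eq_inv_iff_mul_eq_one, ← pow_succ,
        show orderOf (f (k • a)) - 2 + 1 + 1 = orderOf (f (k • a)) by omega, pow_orderOf_eq_one]
    · have h2 : f (k • a) = 1 := by rw [← orderOf_eq_one_iff]; omega
      exact ⟨a, by simp only; rw [h2, inv_one]⟩

theorem eq_of_modEq {G X : Type*} {f : (X → ℕ) → G} {d : ℕ} (hd : ∀ a b, f (a + d • b) = f a) {a a' : X → ℕ}
    (h : ∀ x, a x ≡ a' x [MOD d]) : f a = f a' := by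
  have key : ∀ a : X → ℕ, f a = f fun x => a x % d := by
    intro a
    conv_lhs => rw [show a = (fun x => a x % d) + d • fun x => a x / d by
      ext x; simp [Nat.mod_add_div]]
    rw [hd]
  rw [key a, key a']
  congr 1; ext x; exact h x

/-- On multiples of `k` the value depends only on the multiplier modulo `l`, so `f` descends to a
surjective cocycle on $(\mathbb Z/l)^X$. -/
theorem card_multiplesSubgroup_dvd [Fintype X]
    (hf : ∀ a b, f (a + fun x => b ((f a)⁻¹ • x)) = f a * f b)
    {d k l : ℕ} (hl : 0 < l) (hkl : k * l = d) (hd : ∀ a b, f (a + d • b) = f a) :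
    Nat.card (multiplesSubgroup f hf k) ∣ l ^ Fintype.card X := by
  classical
  have : NeZero l := ⟨hl.ne'⟩
  have hcard : l ^ Fintype.card X = Nat.card (X → ZMod l) := by
    rw [Nat.card_eq_fintype_card, Fintype.card_fun, ZMod.card]
  rw [hcard]
  let act : multiplesSubgroup f hf k → (X → ZMod l) ≃+ (X → ZMod l) := fun g =>
    { toFun := fun a x => a ((g : G)⁻¹ • x)
      invFun := fun a x => a ((g : G) • x)
      left_inv := fun a => by ext x; simp
      right_inv := fun a => by ext x; simp
      map_add' := fun a b => rfl }
  refine Nat.card_dvd_card_of_cocycle act (fun a => ⟨f (k • fun x => (a x).val), _, rfl⟩) ?_ ?_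
  · intro a b
    apply Subtype.ext
    change f _ = f _ * f _
    rw [← hf]
    refine eq_of_modEq hd fun x => ?_
    simp only [Pi.smul_apply, Pi.add_apply, smul_eq_mul, act]
    rw [ZMod.val_add, ← mul_add, ← hkl]
    exact Nat.ModEq.mul_left' k (Nat.mod_modEq _ _)
  · rintro ⟨_, a, rfl⟩
    refine ⟨fun x => a x, Subtype.ext ?_⟩
    refine eq_of_modEq hd fun x => ?_
    simp only [Pi.smul_apply, smul_eq_mul, ZMod.val_natCast]
    rw [← hkl]
    exact Nat.ModEq.mul_left' k (Nat.mod_modEq _ _)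

/-- By the Chinese remainder theorem $a\equiv ku'a+lv'a$ modulo $d$. Twisting the second summand by
the value at the first turns this sum into a product. -/
theorem multiplesSubgroup_mul (hf : ∀ a b, f (a + fun x => b ((f a)⁻¹ • x)) = f a * f b)
    (hsurj : Function.Surjective f) {d k l : ℕ} (hkl : k * l = d) (hcop : k.Coprime l)
    (hd : ∀ a b, f (a + d • b) = f a) (g : G) :
    ∃ x ∈ multiplesSubgroup f hf k, ∃ y ∈ multiplesSubgroup f hf l, g = x * y := by
  obtain ⟨a, rfl⟩ := hsurj g
  obtain ⟨u, hu1, hu2⟩ := Nat.chineseRemainder hcop 0 1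
  obtain ⟨v, hv1, hv2⟩ := Nat.chineseRemainder hcop 1 0
  obtain ⟨u', rfl⟩ := (Nat.modEq_zero_iff_dvd).1 hu1
  obtain ⟨v', rfl⟩ := (Nat.modEq_zero_iff_dvd).1 hv2
  have h1 : k * u' + l * v' ≡ 1 [MOD d] := by
    rw [← hkl]
    exact (Nat.modEq_and_modEq_iff_modEq_mul hcop).1
      ⟨by simpa using hu1.add hv1, by simpa using hu2.add hv2⟩
  refine ⟨f (k • (u' • a)), ⟨_, rfl⟩,
    f (l • fun x => (v' • a) (f (k • (u' • a)) • x)), ⟨_, rfl⟩, ?_⟩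
  rw [← hf]
  refine eq_of_modEq hd fun x => ?_
  simp only [Pi.smul_apply, Pi.add_apply, smul_eq_mul, smul_inv_smul]
  have := (h1.mul_right (a x)).symm
  rw [one_mul] at this
  convert this using 1
  ring

/-- Peel off one unit vector at a time; the cocycle rule makes the last factor the value at `k`
times a permuted unit vector. -/
theorem multiplesSubgroup_le_closure [Fintype X] [DecidableEq X]
    (hf : ∀ a b, f (a + fun x => b ((f a)⁻¹ • x)) = f a * f b)
    (k : ℕ) : multiplesSubgroup f hf k ≤ Subgroup.closure (Set.range fun y => f (Pi.single y k)) := by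
  rintro _ ⟨a, rfl⟩
  simp only
  induction h : ∑ x, a x generalizing a with
  | zero =>
    have : a = 0 := by
      ext x
      have := (Finset.sum_eq_zero_iff.1 h) x (Finset.mem_univ x)
      simpa using this
    rw [this, smul_zero]
    have h1 : f 0 ∈ multiplesSubgroup f hf 0 := ⟨0, by simp⟩
    have h2 : f 0 = 1 := by
      have := hf 0 0
      have h0 : f (0 + fun x => (0 : X → ℕ) ((f 0)⁻¹ • x)) = f 0 := by congr 1
      rw [h0] at this
      exact mul_eq_left.1 this.symm
    rw [h2]; exact one_mem _
  | succ N ih =>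
    obtain ⟨y, -, hy⟩ : ∃ y ∈ Finset.univ, a y ≠ 0 := by
      by_contra hcon
      push Not at hcon
      rw [Finset.sum_eq_zero hcon] at h
      omega
    obtain ⟨b, rfl⟩ : ∃ b : X → ℕ, a = b + Pi.single y 1 := by
      refine ⟨fun x => a x - (Pi.single y 1 : X → ℕ) x, ?_⟩
      funext x
      rw [Pi.add_apply]
      by_cases hx : x = y
      · subst hx; rw [Pi.single_eq_same]; omega
      · rw [Pi.single_eq_of_ne hx]; rfl
    have hb : ∑ x, b x = N := by
      simp [Finset.sum_add_distrib, Finset.sum_pi_single'] at h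
      exact h
    have h1 : f (k • (b + Pi.single y 1)) =
        f (k • b) * f (Pi.single ((f (k • b))⁻¹ • y) k) := by
      rw [← hf]; congr 1; ext x
      by_cases hx : x = y
      · subst hx; simp [mul_add]
      · simp [hx]
    rw [h1]
    exact mul_mem (ih b hb) (Subgroup.subset_closure ⟨_, rfl⟩)

/-- Write $d=p^sm$ with $p\nmid m$. The values on multiples of $p^s$ form a $p$-complement, so $G$
is solvable. The values on multiples of $m$ form a Sylow $p$-subgroup, generated by elements $f(m
e_y)$ that fix the point $y$. -/
theorem subsingleton_of_cocycle [Fintype X] [DecidableEq X] [MulAction.IsPretransitive G X]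
    (hf : ∀ a b, f (a + fun x => b ((f a)⁻¹ • x)) = f a * f b)
    (hsurj : Function.Surjective f) {d : ℕ} (hd0 : 0 < d) (hd : ∀ a b, f (a + d • b) = f a)
    (hfix : ∀ k y, f (Pi.single y k) • y = y) : Subsingleton X := by
  rcases isEmpty_or_nonempty X with hX | ⟨⟨x₀⟩⟩
  · infer_instance
  have hdec : ∀ p : ℕ, p.Prime → ∃ s m, p ^ s * m = d ∧ 0 < m ∧ ¬ p ∣ m := by
    intro p hp
    obtain ⟨s, m, hm, hdm⟩ := Nat.exists_eq_pow_mul_and_not_dvd hd0.ne' p hp.ne_one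
    refine ⟨s, m, hdm.symm, Nat.pos_of_ne_zero ?_, hm⟩
    rintro rfl; exact hm (dvd_zero p)
  have hcompl : ∀ p s m : ℕ, p.Prime → p ^ s * m = d → 0 < m → ¬ p ∣ m →
      Nat.card (multiplesSubgroup f hf m) ∣ p ^ (s * Fintype.card X) ∧
      ¬ p ∣ Nat.card (multiplesSubgroup f hf (p ^ s)) ∧
      (multiplesSubgroup f hf (p ^ s)).index ∣ Nat.card (multiplesSubgroup f hf m) ∧
      (multiplesSubgroup f hf m).index ∣ Nat.card (multiplesSubgroup f hf (p ^ s)) := by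
    intro p s m hp hdm hm hpm
    have hcop : (p ^ s).Coprime m := Nat.Coprime.pow_left _ ((hp.coprime_iff_not_dvd).2 hpm)
    refine ⟨?_, fun hdvd => hpm ?_, ?_, ?_⟩
    · rw [pow_mul]
      exact card_multiplesSubgroup_dvd hf (pow_pos hp.pos _) (by rw [mul_comm, hdm]) hd
    · exact hp.dvd_of_dvd_pow (hdvd.trans (card_multiplesSubgroup_dvd hf hm hdm hd))
    · exact Subgroup.index_dvd_card_of_forall_mul
        (multiplesSubgroup_mul hf hsurj (by rw [mul_comm, hdm]) hcop.symm hd)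
    · exact Subgroup.index_dvd_card_of_forall_mul (multiplesSubgroup_mul hf hsurj hdm hcop hd)
  have hsol : Group.IsSolvable G := by
    refine isSolvable_of_hasPComplements _ G rfl fun p hp => ?_
    obtain ⟨s, m, hdm, hm, hpm⟩ := hdec p hp
    obtain ⟨h1, h2, h3, -⟩ := hcompl p s m hp hdm hm hpm
    refine ⟨multiplesSubgroup f hf (p ^ s), ?_, h2⟩
    obtain ⟨j, -, hj⟩ := (Nat.dvd_prime_pow hp).1 (h3.trans h1)
    exact ⟨j, hj⟩
  have hst : MulAction.stabilizer G x₀ = ⊤ := by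
    refine eq_top_of_sylow_generated_by_conj _ G _ rfl fun p hp => ?_
    have := Fact.mk hp
    obtain ⟨s, m, hdm, hm, hpm⟩ := hdec p hp
    obtain ⟨h1, h2, -, h4⟩ := hcompl p s m hp hdm hm hpm
    have hP : IsPGroup p (multiplesSubgroup f hf m) := IsPGroup.of_card_dvd_pow h1
    refine ⟨hP.toSylow fun h => h2 (h.trans h4), ?_⟩
    refine (multiplesSubgroup_le_closure hf m).trans (Subgroup.closure_mono ?_)
    rintro _ ⟨y, rfl⟩
    refine ⟨⟨Pi.single y 1, by simp [← Pi.single_smul]⟩, ?_⟩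
    obtain ⟨x, hx⟩ := MulAction.exists_smul_eq G x₀ y
    refine ⟨x, ?_⟩
    rw [MulAction.mem_stabilizer_iff, mul_smul, mul_smul, hx, hfix, ← hx, inv_smul_smul]
  refine ⟨fun x y => ?_⟩
  have : ∀ z, z = x₀ := fun z => by
    obtain ⟨g, rfl⟩ := MulAction.exists_smul_eq G x₀ z
    have : g ∈ MulAction.stabilizer G x₀ := by rw [hst]; trivial
    exact this
  rw [this x, this y]

end Cocycle

/-! ### Square-free solutions: the cocycle on multisets, Rump's theorem, enumeration -/

section SquareFree

variable {X : Type*} (l : X → Equiv.Perm X)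

/-- The product of the permutations along a word. -/
def wordPerm : List X → Equiv.Perm X
  | [] => 1
  | x :: w => l x * wordPerm w

/-- The additive value of a word under the cocycle extending `l`. -/
def wordVal : List X → Multiset X
  | [] => 0
  | x :: w => x ::ₘ (wordVal w).map (l x)

theorem card_wordVal (w : List X) : (wordVal l w).card = w.length := by
  induction w with
  | nil => rfl
  | cons x w ih => simp [wordVal, ih]

/-- Remove `x` and undo `l x` on the rest. The freedom to start with any element of `v` is what the
comparison of two words below needs. -/
theorem exists_wordVal_cons (v : Multiset X) : ∀ x ∈ v, ∃ w, wordVal l (x :: w) = v := by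
  induction h : v.card generalizing v with
  | zero =>
    intro x hx
    rw [Multiset.card_eq_zero.1 h] at hx
    exact absurd hx (Multiset.notMem_zero x)
  | succ N ih =>
    intro x hx
    obtain ⟨v', rfl⟩ := Multiset.exists_cons_of_mem hx
    have hc : (v'.map (l x).symm).card = N := by simpa using h
    have hv : ((v'.map (l x).symm).map (l x)) = v' := by simp
    rcases Multiset.empty_or_exists_mem v' with rfl | ⟨y, hy⟩
    · exact ⟨[], rfl⟩
    · obtain ⟨w, hw⟩ := ih _ hc ((l x).symm y) (Multiset.mem_map_of_mem _ hy)
      exact ⟨(l x).symm y :: w, by rw [wordVal, hw, hv]⟩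

theorem exists_wordVal (v : Multiset X) : ∃ w, wordVal l w = v := by
  rcases Multiset.empty_or_exists_mem v with rfl | ⟨y, hy⟩
  · exact ⟨[], rfl⟩
  · obtain ⟨w, hw⟩ := exists_wordVal_cons l v y hy
    exact ⟨_, hw⟩

variable {l}

/-- For words with different first letters $x$ and $x'$, interpolate words starting with $x\cdot
l_x^{-1}x'$ and $x'\cdot l_{x'}^{-1}x$ and a common tail. By `hl` these two have the same value and
the same permutation, and the other comparisons share a first letter, so induction applies. -/
theorem wordPerm_eq_of_wordVal_eq
    (hl : ∀ x y, l x * l ((l x)⁻¹ y) = l y * l ((l y)⁻¹ x)) (N : ℕ) :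
    ∀ w w' : List X, w.length = N → wordVal l w = wordVal l w' → wordPerm l w = wordPerm l w' := by
  induction N with
  | zero =>
    intro w w' hw h
    have h' := card_wordVal l w'
    rw [← h, card_wordVal, hw] at h'
    rw [List.length_eq_zero_iff.1 hw, List.length_eq_zero_iff.1 h'.symm]
  | succ N ih =>
    intro w w' hw h
    have h' := card_wordVal l w'
    rw [← h, card_wordVal] at h'
    match w, w', hw, h, h' with
    | x :: u, [], _, _, h' => simp at h'
    | x :: u, x' :: u', hw, h, h' =>
      have hu : u.length = N := by simpa using hw
      have hu' : u'.length = N := by simp at h'; omega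
      by_cases hx : x = x'
      · subst hx
        rw [wordPerm, wordPerm, ih u u' hu]
        simp only [wordVal] at h
        exact Multiset.map_injective (l x).injective ((Multiset.cons_inj_right x).1 h)
      · have hmem : x' ∈ (wordVal l u).map (l x) := by
          have : x' ∈ wordVal l (x :: u) := by rw [h, wordVal]; exact Multiset.mem_cons_self _ _
          rw [wordVal, Multiset.mem_cons] at this
          exact this.resolve_left (Ne.symm hx)
        obtain ⟨y, hy, hyx⟩ := Multiset.mem_map.1 hmem
        obtain ⟨t, ht⟩ := exists_wordVal_cons l _ y hy
        have hyx' : y = (l x)⁻¹ x' := by rw [← hyx]; simp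
        have hxy : l x * l y = l x' * l ((l x')⁻¹ x) := by rw [hyx', hl]
        have hP : wordPerm l u = l y * wordPerm l t := ih u (y :: t) hu ht.symm
        have hlen : t.length + 1 = N := by
          have := card_wordVal l (y :: t)
          rw [ht, card_wordVal, hu] at this
          simpa using this.symm
        have hV : wordVal l (((l x')⁻¹ x) :: t) = wordVal l u' := by
          have h1 : wordVal l (x :: u) = wordVal l (x' :: ((l x')⁻¹ x) :: t) := by
            rw [wordVal, ← ht]
            simp only [wordVal, Multiset.map_cons, Multiset.map_map]
            rw [Multiset.cons_swap, hyx]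
            have h2 : (wordVal l t).map (l x ∘ l y) =
                (wordVal l t).map (l x' ∘ l ((l x')⁻¹ x)) :=
              Multiset.map_congr rfl fun z _ => congrArg (fun σ : Equiv.Perm X => σ z) hxy
            rw [h2, show l x' ((l x')⁻¹ x) = x by simp]
          rw [h, wordVal, wordVal] at h1
          exact (Multiset.map_injective (l x').injective ((Multiset.cons_inj_right x').1 h1)).symm
        have hP' := ih _ _ (by simpa using hlen) hV
        rw [wordPerm, wordPerm, hP, ← hP', wordPerm, ← mul_assoc, hxy, mul_assoc]

/-- The `I`-structure of a set-theoretic solution. -/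
theorem exists_multiset_cocycle (hl : ∀ x y, l x * l ((l x)⁻¹ y) = l y * l ((l y)⁻¹ x)) :
    ∃ F : Multiset X → Equiv.Perm X,
      (∀ v u, F (v + u.map (F v)) = F v * F u) ∧ ∀ x, F {x} = l x := by
  -- `F v` is the product along any word of value `v`; the choice is immaterial by
  -- `wordPerm_eq_of_wordVal_eq`.
  choose s hs using exists_wordVal l
  have hF : ∀ w, wordPerm l (s (wordVal l w)) = wordPerm l w := fun w =>
    (wordPerm_eq_of_wordVal_eq hl _ _ _ rfl (hs _).symm).symm
  have key : ∀ w w', wordPerm l (s (wordVal l w + (wordVal l w').map (wordPerm l w))) =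
      wordPerm l w * wordPerm l w' := by
    intro w
    induction w with
    | nil => intro w'; simp [wordVal, wordPerm, hF]
    | cons x w ih =>
      intro w'
      obtain ⟨t, ht⟩ := exists_wordVal l (wordVal l w + (wordVal l w').map (wordPerm l w))
      have h1 := ih w'
      rw [← ht, hF] at h1
      have h2 : wordVal l (x :: w) + (wordVal l w').map (wordPerm l (x :: w)) =
          wordVal l (x :: t) := by
        rw [wordVal, wordVal, ht]
        simp [wordPerm, Multiset.map_map]
      rw [h2, hF, wordPerm, h1, wordPerm, mul_assoc]
  refine ⟨fun v => wordPerm l (s v), fun v u => ?_, fun x => ?_⟩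
  · obtain ⟨w, rfl⟩ := exists_wordVal l v
    obtain ⟨w', rfl⟩ := exists_wordVal l u
    simp only [hF]
    exact key w w'
  · have : ({x} : Multiset X) = wordVal l [x] := by simp [wordVal]
    simp only
    rw [this, hF]; simp [wordPerm]

/-- **Rump**: a finite square-free solution with transitive permutation group is trivial. -/
theorem subsingleton_of_squareFree_of_isPretransitive [Finite X] (hx : ∀ x, l x x = x)
    (hl : ∀ x y, l x * l ((l x)⁻¹ y) = l y * l ((l y)⁻¹ x))
    [MulAction.IsPretransitive (Subgroup.closure (Set.range l)) X] : Subsingleton X := by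
  classical
  have := Fintype.ofFinite X
  obtain ⟨F, hF, hFx⟩ := exists_multiset_cocycle hl
  have hF0 : F 0 = 1 := by
    have := hF 0 0
    rw [Multiset.map_zero, add_zero] at this
    exact mul_eq_left.1 this.symm
  have hcons : ∀ x v, F ({x} + v) = l x * F (v.map (l x).symm) := fun x v => by
    rw [← hFx, ← hF, hFx, Multiset.map_map]; simp
  have hmem : ∀ v, F v ∈ Subgroup.closure (Set.range l) := by
    intro v
    induction h : v.card generalizing v with
    | zero => rw [Multiset.card_eq_zero.1 h, hF0]; exact one_mem _
    | succ N ih =>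
      obtain ⟨x, v', rfl⟩ := Multiset.card_pos_iff_exists_mem.1 (by omega : 0 < v.card) |>.imp
        fun x hx => Multiset.exists_cons_of_mem hx
      rw [← Multiset.singleton_add, hcons]
      exact mul_mem (Subgroup.subset_closure ⟨x, rfl⟩) (ih _ (by simpa using h))
  have hrange : ∀ g ∈ Subgroup.closure (Set.range l), ∃ v, F v = g := by
    intro g hg
    induction hg using Subgroup.closure_induction with
    | mem g hg => obtain ⟨x, rfl⟩ := hg; exact ⟨_, hFx x⟩
    | one => exact ⟨0, hF0⟩
    | mul g h _ _ hg hh =>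
      obtain ⟨v, rfl⟩ := hg
      obtain ⟨u, rfl⟩ := hh
      exact ⟨_, hF v u⟩
    | inv g _ hg =>
      obtain ⟨v, rfl⟩ := hg
      have hpow : ∀ n : ℕ, ∃ u, F u = F v ^ n := by
        intro n
        induction n with
        | zero => exact ⟨0, by simpa using hF0⟩
        | succ n ih =>
          obtain ⟨u, hu⟩ := ih
          exact ⟨_, by rw [hF u v, hu, pow_succ]⟩
      obtain ⟨u, hu⟩ := hpow (orderOf (F v) - 1)
      refine ⟨u, ?_⟩
      rw [hu, eq_inv_iff_mul_eq_one, ← pow_succ, Nat.sub_add_cancel (orderOf_pos _),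
        pow_orderOf_eq_one]
  -- Square-freeness enters here: `l x` fixes `x`, so the cocycle is multiplicative on multiples of
  -- `x`, and these values fix `x`.
  have hnsmul : ∀ (n : ℕ) x, F (n • {x}) = l x ^ n := by
    intro n x
    induction n with
    | zero => simpa using hF0
    | succ n ih =>
      have h1 : ((n • ({x} : Multiset X)).map (l x).symm) = n • {x} := by
        rw [Multiset.map_nsmul, Multiset.map_singleton, (Equiv.symm_apply_eq (l x)).2 (hx x).symm]
      rw [succ_nsmul', hcons, h1, ih, pow_succ']
  -- Any common exponent of the permutations serves as a period of the cocycle.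
  let d := Fintype.card (Equiv.Perm X)
  have hdn : ∀ v : Multiset X, F (d • v) = 1 := by
    intro v
    induction h : v.card generalizing v with
    | zero => rw [Multiset.card_eq_zero.1 h, nsmul_zero, hF0]
    | succ N ih =>
      obtain ⟨x, v', rfl⟩ := Multiset.card_pos_iff_exists_mem.1 (by omega : 0 < v.card) |>.imp
        fun x hx => Multiset.exists_cons_of_mem hx
      have h1 : F (d • {x}) = 1 := by rw [hnsmul]; exact pow_card_eq_one
      have h2 := hF (d • {x}) (d • v')
      rw [h1, ih v' (by simpa using h)] at h2
      rw [← Multiset.singleton_add, nsmul_add]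
      simpa using h2
  let ms : (X → ℕ) → Multiset X := fun a => ∑ x, a x • {x}
  have hms_add : ∀ a b, ms (a + b) = ms a + ms b := fun a b => by
    simp [ms, add_nsmul, Finset.sum_add_distrib]
  have hms_map : ∀ (σ : Equiv.Perm X) b, ms (fun x => b (σ⁻¹ x)) = (ms b).map σ := fun σ b => by
    have h1 : (ms b).map σ = ∑ x, b x • {σ x} := by
      rw [← Multiset.coe_mapAddMonoidHom, map_sum]
      simp [Multiset.map_nsmul]
    rw [h1]
    exact Fintype.sum_equiv σ⁻¹ _ _ fun x => by simp
  have hms_single : ∀ y k, ms (Pi.single y k) = k • {y} := fun y k => by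
    simp only [ms]
    rw [Finset.sum_eq_single y]
    · simp
    · intro z _ hz; simp [hz]
    · simp
  have hms_nsmul : ∀ (k : ℕ) b, ms (k • b) = k • ms b := fun k b => by
    simp [ms, Finset.smul_sum, mul_nsmul']
  have hms_surj : ∀ v, ∃ a, ms a = v := fun v => by
    refine ⟨fun x => v.count x, ?_⟩
    ext y
    simp [ms, Multiset.count_sum', Multiset.count_singleton]
  refine subsingleton_of_cocycle (G := Subgroup.closure (Set.range l)) (d := d)
    (f := fun a => ⟨F (ms a), hmem _⟩) ?_ ?_ Fintype.card_pos ?_ ?_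
  · intro a b
    apply Subtype.ext
    change F _ = F _ * F _
    rw [← hF, ← hms_map, ← hms_add]
    rfl
  · rintro ⟨g, hg⟩
    obtain ⟨v, rfl⟩ := hrange g hg
    obtain ⟨a, rfl⟩ := hms_surj v
    exact ⟨a, rfl⟩
  · intro a b
    apply Subtype.ext
    simp only
    have h1 := hF (ms a) (d • (ms b).map (F (ms a)).symm)
    rw [hdn, mul_one, Multiset.map_nsmul, Multiset.map_map] at h1
    rw [hms_add, hms_nsmul]
    simpa using h1
  · intro k y
    change F (ms (Pi.single y k)) y = y
    rw [hms_single, hnsmul]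
    induction k with
    | zero => rfl
    | succ k ih => rw [pow_succ, Equiv.Perm.mul_apply, hx, ih]

/-- A finite square-free solution can be enumerated compatibly with the action. -/
theorem exists_rank_of_squareFree (N : ℕ) : ∀ (X : Type*) [Finite X] (l : X → Equiv.Perm X),
    Nat.card X = N → (∀ x, l x x = x) → (∀ x y, l x * l ((l x)⁻¹ y) = l y * l ((l y)⁻¹ x)) →
    ∃ r : X → ℕ, Function.Injective r ∧ ∀ x y, r y < r x ↔ r (l x y) < r x := by
  classical
  induction N using Nat.strong_induction_on with
  | _ N ih =>
  intro X _ l hN hx hl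
  rcases subsingleton_or_nontrivial X with hs | hnt
  · exact ⟨fun _ => 0, fun _ _ _ => Subsingleton.elim _ _, by simp⟩
  have hnot : ¬ MulAction.IsPretransitive (Subgroup.closure (Set.range l)) X := fun h =>
    not_subsingleton X (subsingleton_of_squareFree_of_isPretransitive hx hl)
  have hex : ∃ x₀ x₁ : X, x₁ ∉ MulAction.orbit (Subgroup.closure (Set.range l)) x₀ := by
    by_contra hcon
    push Not at hcon
    exact hnot ⟨fun x y => hcon x y⟩
  obtain ⟨x₀, x₁, hx₁⟩ := hex
  -- The orbit and its complement are both invariant and proper, and the solution restricts to each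
  -- of them.
  set p : X → Prop := fun y => y ∈ MulAction.orbit (Subgroup.closure (Set.range l)) x₀ with hp
  have hpl : ∀ x y, p (l x y) ↔ p y := fun x y => by
    have : l x y = (⟨l x, Subgroup.subset_closure ⟨x, rfl⟩⟩ : Subgroup.closure (Set.range l)) • y :=
      rfl
    simp only [hp]
    rw [this, ← MulAction.orbit_eq_iff, ← MulAction.orbit_eq_iff, MulAction.orbit_smul]
  have key : ∀ q : X → Prop, (hq : ∀ x y, q (l x y) ↔ q y) → (∃ x, ¬ q x) →
      ∃ r : {x // q x} → ℕ, Function.Injective r ∧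
        ∀ x y, r y < r x ↔ r ⟨l x y, (hq x y).2 y.2⟩ < r x := by
    intro q hq hqn
    have hlt : Nat.card {x // q x} < N := by
      rw [← hN]
      exact Finite.card_subtype_lt hqn.choose_spec
    refine ih _ hlt {x // q x} (fun x => (l x).subtypePerm fun y => hq x y) rfl
      (fun x => Subtype.ext (hx x)) fun x y => ?_
    ext z
    exact congrArg (fun σ : Equiv.Perm X => σ z) (hl x y)
  obtain ⟨r₁, hr₁, h₁⟩ := key p hpl ⟨x₁, hx₁⟩
  obtain ⟨r₂, hr₂, h₂⟩ := key (fun x => ¬ p x) (fun x y => not_congr (hpl x y))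
    ⟨x₀, fun h => h (MulAction.mem_orbit_self x₀)⟩
  obtain ⟨B, hB⟩ : ∃ B, ∀ x, r₁ x < B := by
    obtain ⟨B, hB⟩ := (Set.finite_range r₁).bddAbove
    exact ⟨B + 1, fun x => Nat.lt_succ_of_le (hB ⟨x, rfl⟩)⟩
  -- One part is placed entirely below the other. The condition is then automatic for `x` and `y` in
  -- different parts, because `l x y` lies in the same part as `y`.
  let r : X → ℕ := fun x => if h : p x then r₁ ⟨x, h⟩ else B + r₂ ⟨x, h⟩
  have hrp : ∀ x (h : p x), r x = r₁ ⟨x, h⟩ := fun x h => dif_pos h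
  have hrn : ∀ x (h : ¬ p x), r x = B + r₂ ⟨x, h⟩ := fun x h => dif_neg h
  refine ⟨r, fun x y hxy => ?_, fun x y => ?_⟩
  · by_cases hpx : p x <;> by_cases hpy : p y
    · rw [hrp x hpx, hrp y hpy] at hxy
      exact congrArg Subtype.val (hr₁ hxy)
    · rw [hrp x hpx, hrn y hpy] at hxy
      have := hB ⟨x, hpx⟩; omega
    · rw [hrn x hpx, hrp y hpy] at hxy
      have := hB ⟨y, hpy⟩; omega
    · rw [hrn x hpx, hrn y hpy] at hxy
      exact congrArg Subtype.val (hr₂ (Nat.add_left_cancel hxy))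
  · by_cases hpx : p x <;> by_cases hpy : p y
    · rw [hrp x hpx, hrp y hpy, hrp _ ((hpl x y).2 hpy)]
      exact h₁ ⟨x, hpx⟩ ⟨y, hpy⟩
    · rw [hrp x hpx, hrn y hpy, hrn _ (fun h => hpy ((hpl x y).1 h))]
      have := hB ⟨x, hpx⟩; omega
    · rw [hrn x hpx, hrp y hpy, hrp _ ((hpl x y).2 hpy)]
      have := hB ⟨y, hpy⟩
      have := hB ⟨l x y, (hpl x y).2 hpy⟩
      omega
    · rw [hrn x hpx, hrn y hpy, hrn _ (fun h => hpy ((hpl x y).1 h))]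
      have := h₂ ⟨x, hpx⟩ ⟨y, hpy⟩
      simp only at this
      omega

end SquareFree

noncomputable section

namespace QuantumBinomial

/-! ### The associated map and coefficients; functionals vanishing on the ideal -/

section Basics

variable {k X : Type*} [Field k] {S : Set (FreeAlg k X)}

/-- The coefficient `c` in the rule `p = c q` of the set `S`. -/
def assocCoef (S : Set (FreeAlg k X)) (p : X × X) : k := (partner S p).2

theorem Linked.symm {p q : X × X} {c : k} (h : Linked S p q c) : Linked S q p c⁻¹ := by
  obtain ⟨hc, hpq, h⟩ := h
  refine ⟨inv_ne_zero hc, hpq.symm, ?_⟩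
  rw [inv_inv]; exact h.symm

theorem linked_or (S : Set (FreeAlg k X)) (p : X × X) :
    Linked S p (assocMap S p) (assocCoef S p) ∨
      (assocMap S p = p ∧ assocCoef S p = 1 ∧ ¬ ∃ qc : (X × X) × k, Linked S p qc.1 qc.2) := by
  by_cases h : ∃ qc : (X × X) × k, Linked S p qc.1 qc.2
  · left
    unfold assocMap assocCoef partner
    rw [dif_pos h]; exact h.choose_spec
  · right
    unfold assocMap assocCoef partner
    rw [dif_neg h]; exact ⟨rfl, rfl, h⟩

theorem assocCoef_ne_zero (S : Set (FreeAlg k X)) (p : X × X) : assocCoef S p ≠ 0 := by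
  rcases linked_or S p with h | ⟨-, h, -⟩
  · exact h.1
  · rw [h]; exact one_ne_zero

theorem assocCoef_eq_one {p : X × X} (h : assocMap S p = p) : assocCoef S p = 1 := by
  rcases linked_or S p with h' | ⟨-, h', -⟩
  · exact absurd h.symm h'.2.1
  · exact h'

theorem IsQuantumBinomial.assocMap_assocMap (hS : IsQuantumBinomial S) (p : X × X) :
    assocMap S (assocMap S p) = p := by
  rcases linked_or S p with h | ⟨h1, -, -⟩
  · exact congrArg Prod.fst (partner_eq hS h.symm)
  · rw [h1, h1]

theorem IsQuantumBinomial.assocCoef_mul (hS : IsQuantumBinomial S) (p : X × X) :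
    assocCoef S p * assocCoef S (assocMap S p) = 1 := by
  rcases linked_or S p with h | ⟨h1, h2, -⟩
  · have : assocCoef S (assocMap S p) = (assocCoef S p)⁻¹ :=
      congrArg Prod.snd (partner_eq hS h.symm)
    rw [this, mul_inv_cancel₀ (assocCoef_ne_zero S p)]
  · rw [h1, h2, one_mul]

theorem occurs_of_linked {p q : X × X} {c : k} (h : Linked S p q c) :
    ∃ f ∈ S, Occurs (FreeMonoid.of p.1 * FreeMonoid.of p.2) f := by
  obtain ⟨hc, hpq, h | h⟩ := h
  · exact ⟨_, h, by simp [Occurs, coeff_mon, hpq.symm]⟩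
  · exact ⟨_, h, by simp [Occurs, coeff_mon, hpq.symm, hc]⟩

theorem IsQuantumBinomial.assocMap_diag (hS : IsQuantumBinomial S) (x : X) :
    assocMap S (x, x) = (x, x) := by
  rcases linked_or S (x, x) with h | ⟨h1, -, -⟩
  · obtain ⟨f, hf, hfo⟩ := occurs_of_linked h
    exact absurd hfo (hS.square_free f hf x)
  · exact h1

/-- Since ${}^xx=x$, injectivity of $y\mapsto{}^xy$ leaves only $y=x$. With its mirror image this is
how nondegeneracy makes orbits long. -/
theorem IsQuantumBinomial.eq_of_fst_eq (hS : IsQuantumBinomial S) {x y : X}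
    (h : (assocMap S (x, y)).1 = x) : x = y := by
  refine ((hS.nondegenerate.1 x).1 ?_).symm
  simp only [hS.assocMap_diag, h]

theorem IsQuantumBinomial.eq_of_snd_eq (hS : IsQuantumBinomial S) {x y : X}
    (h : (assocMap S (x, y)).2 = y) : x = y := by
  refine (hS.nondegenerate.2 y).1 ?_
  simp only [hS.assocMap_diag, h]

theorem IsQuantumBinomial.fst_ne_snd_of_mem (hS : IsQuantumBinomial S) {p q : X × X} {c : k}
    (hpq : p ≠ q) (h : mon k p - c • mon k q ∈ S) : p.1 ≠ p.2 := by
  intro he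
  refine hS.square_free _ h p.1 ?_
  have hp : (p.1, p.1) = p := Prod.ext rfl he
  have := coeff_mon (k := k) p (p.1, p.1)
  have h2 := coeff_mon (k := k) q (p.1, p.1)
  rw [if_pos hp.symm] at this
  rw [if_neg fun h => hpq (hp ▸ h.symm)] at h2
  simp [Occurs, this, h2]

theorem IsQuantumBinomial.exists_eq_of_mem (hS : IsQuantumBinomial S) {f : FreeAlg k X}
    (hf : f ∈ S) : ∃ p : X × X, p.1 ≠ p.2 ∧ f = mon k p - assocCoef S p • mon k (assocMap S p) := by
  obtain ⟨p, q, c, hpq, hc, rfl⟩ := hS.binomial f hf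
  have h := partner_eq hS (⟨hc, hpq, Or.inl hf⟩ : Linked S p q c)
  refine ⟨p, hS.fst_ne_snd_of_mem hpq hf, ?_⟩
  rw [assocMap, assocCoef, h]

theorem relation_mem_span (S : Set (FreeAlg k X)) (p : X × X) :
    mon k p - assocCoef S p • mon k (assocMap S p) ∈ TwoSidedIdeal.span S := by
  rcases linked_or S p with ⟨hc, hpq, h | h⟩ | ⟨h1, h2, -⟩
  · exact TwoSidedIdeal.subset_span h
  · have h3 := (TwoSidedIdeal.span S).mul_mem_left
      (MonoidAlgebra.single 1 (-assocCoef S p)) _ (TwoSidedIdeal.subset_span h)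
    have h4 : (MonoidAlgebra.single 1 (-assocCoef S p) : FreeAlg k X) =
        algebraMap k _ (-assocCoef S p) := by simp
    rw [h4, ← Algebra.smul_def, smul_sub, smul_smul] at h3
    convert h3 using 1
    rw [neg_mul, mul_inv_cancel₀ hc, neg_one_smul, neg_smul]; abel
  · rw [h1, h2, one_smul, sub_self]; exact zero_mem _

/-- The word with letters `l` as an element of the free algebra. -/
def word (k : Type*) {X : Type*} [Field k] (l : List X) : FreeAlg k X :=
  MonoidAlgebra.single (FreeMonoid.ofList l) 1

theorem word_mul (l l' : List X) : word k l * word k l' = word k (l ++ l') := by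
  simp [word, MonoidAlgebra.single_mul_single]

theorem mon_eq_word (p : X × X) : mon k p = word k [p.1, p.2] := rfl

/-- A linear map on the free algebra given by its values on words. -/
def ofWords {M : Type*} [AddCommGroup M] [Module k M] (φ : List X → M) : FreeAlg k X →ₗ[k] M :=
  (MonoidAlgebra.basis (FreeMonoid X) k).constr k fun w => φ w.toList

theorem ofWords_word {M : Type*} [AddCommGroup M] [Module k M] (φ : List X → M) (l : List X) :
    ofWords (k := k) φ (word k l) = φ l :=
  (MonoidAlgebra.basis (FreeMonoid X) k).constr_basis k _ (FreeMonoid.ofList l)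

theorem ofWords_eq_sum {M : Type*} [AddCommGroup M] [Module k M] (φ : List X → M)
    (f : FreeAlg k X) : ofWords φ f = f.coeff.sum fun w c => c • φ w.toList :=
  (MonoidAlgebra.basis (FreeMonoid X) k).constr_apply k _ f

theorem induction_word {motive : FreeAlg k X → Prop} (f : FreeAlg k X)
    (hadd : ∀ f g, motive f → motive g → motive (f + g))
    (hword : ∀ (c : k) l, motive (c • word k l)) : motive f := by
  induction f using MonoidAlgebra.induction_linear with
  | zero => simpa using hword 0 []
  | add f g hf hg => exact hadd f g hf hg
  | single w c =>
    have : MonoidAlgebra.single w c = c • word k (X := X) w.toList := by simp [word]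
    rw [this]; exact hword _ _

/-- A linear map vanishing on all `u g v`, with `u`, `v` words and `g` in a generating set, vanishes
on the generated ideal. -/
theorem eq_zero_of_mem_span {M : Type*} [AddCommGroup M] [Module k M] (Φ : FreeAlg k X →ₗ[k] M)
    (h : ∀ u v, ∀ g ∈ S, Φ (word k u * g * word k v) = 0) {f : FreeAlg k X}
    (hf : f ∈ TwoSidedIdeal.span S) : Φ f = 0 := by
  have key : ∀ a b, Φ (a * f * b) = 0 := by
    induction hf using TwoSidedIdeal.span_induction with
    | mem g hg =>
      intro a b
      induction a using induction_word with
      | hadd a a' ha ha' => rw [add_mul, add_mul, map_add, ha, ha', add_zero]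
      | hword c u =>
        induction b using induction_word with
        | hadd b b' hb hb' => rw [mul_add, map_add, hb, hb', add_zero]
        | hword d v =>
          rw [smul_mul_assoc, smul_mul_assoc, mul_smul_comm, map_smul, map_smul, h u v g hg,
            smul_zero, smul_zero]
    | zero => intro a b; simp
    | add x y _ _ hx hy => intro a b; rw [mul_add, add_mul, map_add, hx, hy, add_zero]
    | neg x _ hx => intro a b; rw [mul_neg, neg_mul, map_neg, hx, neg_zero]
    | left_absorb c x _ hx => intro a b; rw [← mul_assoc, hx]
    | right_absorb c x _ hx =>
      intro a b
      rw [← mul_assoc, mul_assoc (a * x), hx]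
  simpa using key 1 1

/-- To define a functional on the quotient algebra it is enough to give values on words that respect
each relation in every context. -/
theorem IsQuantumBinomial.ofWords_eq_zero {M : Type*} [AddCommGroup M] [Module k M]
    (hS : IsQuantumBinomial S) (φ : List X → M)
    (h : ∀ u v x y, x ≠ y → φ (u ++ [x, y] ++ v) =
      assocCoef S (x, y) • φ (u ++ [(assocMap S (x, y)).1, (assocMap S (x, y)).2] ++ v))
    {f : FreeAlg k X} (hf : f ∈ TwoSidedIdeal.span S) : ofWords φ f = 0 := by
  refine eq_zero_of_mem_span _ (fun u v g hg => ?_) hf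
  obtain ⟨p, hp, rfl⟩ := hS.exists_eq_of_mem hg
  rw [mon_eq_word, mon_eq_word, mul_sub, sub_mul, mul_smul_comm, smul_mul_assoc, word_mul, word_mul,
    word_mul, word_mul, map_sub, map_smul, ofWords_word, ofWords_word, h u v p.1 p.2 hp, sub_self]

end Basics

/-! ### The dual of the component of degree three -/

section DegreeThree

variable {k X : Type*} [Field k] (S : Set (FreeAlg k X))

/-- The map `r × id` on `X × X × X`. -/
def map12 (t : X × X × X) : X × X × X :=
  ((assocMap S (t.1, t.2.1)).1, (assocMap S (t.1, t.2.1)).2, t.2.2)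

/-- The map `id × r` on `X × X × X`. -/
def map23 (t : X × X × X) : X × X × X := (t.1, assocMap S t.2)

/-- The coefficient accompanying `map12`. -/
def coef12 (t : X × X × X) : k := assocCoef S (t.1, t.2.1)

/-- The coefficient accompanying `map23`. -/
def coef23 (t : X × X × X) : k := assocCoef S t.2

/-- The braid relation for the weighted maps `map12` and `map23`. -/
def IsBraidedOnTriples : Prop :=
  ∀ t : X × X × X, map12 S (map23 S (map12 S t)) = map23 S (map12 S (map23 S t)) ∧
    coef12 S t * coef23 S (map12 S t) * coef12 S (map23 S (map12 S t)) =
      coef23 S t * coef12 S (map23 S t) * coef23 S (map12 S (map23 S t))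

/-- The functions on `X × X × X` which are compatible with the relations in degree three. -/
def cubicFunctionals : Submodule k (X × X × X → k) where
  carrier := {F | ∀ t, F t = coef12 S t * F (map12 S t) ∧ F t = coef23 S t * F (map23 S t)}
  add_mem' := by
    intro F G hF hG t
    rw [Pi.add_apply, Pi.add_apply, Pi.add_apply, mul_add, mul_add, ← (hF t).1, ← (hF t).2,
      ← (hG t).1, ← (hG t).2]
    exact ⟨rfl, rfl⟩
  zero_mem' := by intro t; simp
  smul_mem' := by
    intro c F hF t
    rw [Pi.smul_apply, Pi.smul_apply, Pi.smul_apply, smul_eq_mul, smul_eq_mul, smul_eq_mul,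
      mul_left_comm, ← (hF t).1, mul_left_comm, ← (hF t).2]
    exact ⟨rfl, rfl⟩

/-- The letters of a triple. -/
def letters (t : X × X × X) : List X := [t.1, t.2.1, t.2.2]

/-- The projection onto the quotient algebra. -/
def proj : FreeAlg k X →ₐ[k] QuotAlg S := (TwoSidedIdeal.span S).ringCon.mkₐ (α := k)

variable {S}

theorem proj_surjective : Function.Surjective (proj S) :=
  RingCon.mkₐ_surjective (TwoSidedIdeal.span S).ringCon

theorem proj_eq_zero_iff {f : FreeAlg k X} : proj S f = 0 ↔ f ∈ TwoSidedIdeal.span S := by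
  rw [TwoSidedIdeal.mem_iff, ← map_zero (proj S)]
  exact RingCon.eq _

theorem component_three : component S 3 =
    Submodule.span k (Set.range fun t : X × X × X => proj S (word k (letters t))) := by
  unfold component
  congr 1
  ext a
  constructor
  · rintro ⟨w, hw, rfl⟩
    obtain ⟨x, y, z, h⟩ := List.length_eq_three.1 (show w.toList.length = 3 from hw)
    refine ⟨(x, y, z), ?_⟩
    have : w = FreeMonoid.ofList [x, y, z] := by rw [← h]; rfl
    rw [this]; rfl
  · rintro ⟨t, rfl⟩
    exact ⟨FreeMonoid.ofList (letters t), rfl, rfl⟩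

theorem proj_word_map12 (t : X × X × X) :
    proj S (word k (letters t)) = coef12 S t • proj S (word k (letters (map12 S t))) := by
  rw [← sub_eq_zero, ← map_smul, ← map_sub, proj_eq_zero_iff]
  have := (TwoSidedIdeal.span S).mul_mem_right _ (word k [t.2.2])
    (relation_mem_span S (t.1, t.2.1))
  rw [mon_eq_word, mon_eq_word, sub_mul, smul_mul_assoc, word_mul, word_mul] at this
  exact this

theorem proj_word_map23 (t : X × X × X) :
    proj S (word k (letters t)) = coef23 S t • proj S (word k (letters (map23 S t))) := by
  rw [← sub_eq_zero, ← map_smul, ← map_sub, proj_eq_zero_iff]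
  have := (TwoSidedIdeal.span S).mul_mem_left (word k [t.1]) _ (relation_mem_span S t.2)
  rw [mon_eq_word, mon_eq_word, mul_sub, mul_smul_comm, word_mul, word_mul] at this
  exact this

/-- The value on words of the functional on the free algebra given by a function of triples. -/
def cubicWord (F : X × X × X → k) : List X → k
  | [x, y, z] => F (x, y, z)
  | _ => 0

theorem IsQuantumBinomial.ofWords_cubicWord_eq_zero (hS : IsQuantumBinomial S)
    {F : X × X × X → k} (hF : F ∈ cubicFunctionals S) {f : FreeAlg k X}
    (hf : f ∈ TwoSidedIdeal.span S) : ofWords (cubicWord F) f = 0 := by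
  refine hS.ofWords_eq_zero _ (fun u v x y _ => ?_) hf
  match u, v with
  | [], [] => simp [cubicWord]
  | [], [z] => exact (hF (x, y, z)).1
  | [], z :: z' :: v => simp [cubicWord]
  | [z], [] => exact (hF (z, x, y)).2
  | [z], z' :: v => simp [cubicWord]
  | z :: z' :: u, v =>
    have : ∀ a b : X, cubicWord F (z :: z' :: u ++ [a, b] ++ v) = 0 := fun a b => by
      rcases u with _ | ⟨c, u⟩ <;> simp [cubicWord]
    rw [this, this, smul_zero]

/-- The dual of the component of degree three. -/
def IsQuantumBinomial.dualComponentEquiv (hS : IsQuantumBinomial S) :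
    Module.Dual k (component S 3) ≃ₗ[k] cubicFunctionals S := by
  have hmem : ∀ t : X × X × X, proj S (word k (letters t)) ∈ component S 3 := fun t => by
    rw [component_three]; exact Submodule.subset_span ⟨t, rfl⟩
  let e : Module.Dual k (component S 3) →ₗ[k] cubicFunctionals S :=
    { toFun := fun φ => ⟨fun t => φ ⟨_, hmem t⟩, fun t => by
        constructor
        · rw [← smul_eq_mul, ← map_smul]
          exact congrArg φ (Subtype.ext (proj_word_map12 t))
        · rw [← smul_eq_mul, ← map_smul]
          exact congrArg φ (Subtype.ext (proj_word_map23 t))⟩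
      map_add' := fun φ ψ => rfl
      map_smul' := fun c φ => rfl }
  refine LinearEquiv.ofBijective e ⟨?_, ?_⟩
  · rw [← LinearMap.ker_eq_bot, LinearMap.ker_eq_bot']
    intro φ hφ
    ext ⟨a, ha⟩
    have hz : ∀ t, φ ⟨_, hmem t⟩ = 0 := fun t => congrFun (congrArg Subtype.val hφ) t
    have ha' := ha
    rw [component_three] at ha'
    have hall : ∀ ha, φ ⟨a, ha⟩ = 0 := by
      clear ha
      induction ha' using Submodule.span_induction with
      | mem x hx => obtain ⟨t, rfl⟩ := hx; intro _; exact hz t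
      | zero => intro ha; exact map_zero φ
      | add x y hx hy hx' hy' =>
        intro ha
        rw [← component_three] at hx hy
        have : (⟨x + y, ha⟩ : component S 3) = ⟨x, hx⟩ + ⟨y, hy⟩ := rfl
        rw [this, map_add, hx' hx, hy' hy, add_zero]
      | smul c x hx hx' =>
        intro ha
        rw [← component_three] at hx
        have : (⟨c • x, ha⟩ : component S 3) = c • ⟨x, hx⟩ := rfl
        rw [this, map_smul, hx' hx, smul_zero]
    exact hall ha
  · rintro ⟨F, hF⟩
    -- For surjectivity, extend `F` by zero to words of other lengths; the result kills the ideal,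
    -- descends to the algebra and restricts to the component.
    let P : FreeAlg k X →ₗ[k] QuotAlg S := (proj S).toLinearMap
    have hP : Function.Surjective P := proj_surjective
    have hker : LinearMap.ker P ≤ LinearMap.ker (ofWords (cubicWord F)) := fun f hf =>
      hS.ofWords_cubicWord_eq_zero hF (proj_eq_zero_iff.1 hf)
    let Φ : QuotAlg S →ₗ[k] k :=
      (LinearMap.ker P).liftQ _ hker ∘ₗ (P.quotKerEquivOfSurjective hP).symm.toLinearMap
    have hΦ : ∀ f, Φ (P f) = ofWords (cubicWord F) f := fun f => by
      simp only [Φ, LinearMap.comp_apply, LinearEquiv.coe_coe]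
      rw [LinearMap.quotKerEquivOfSurjective_symm_apply]
      rfl
    refine ⟨Φ ∘ₗ (component S 3).subtype, Subtype.ext (funext fun t => ?_)⟩
    exact (hΦ _).trans (ofWords_word _ _)

theorem IsQuantumBinomial.finrank_component_three (hS : IsQuantumBinomial S) :
    Module.finrank k (component S 3) = Module.finrank k (cubicFunctionals S) := by
  rw [← Subspace.dual_finrank_eq, hS.dualComponentEquiv.finrank_eq]

end DegreeThree

/-! ### The Yang–Baxter equation on basis vectors -/

section YangBaxter

variable {k X : Type*} [Field k] {S : Set (FreeAlg k X)}

theorem assocLin_single (x y : X) :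
    assocLin S (Finsupp.single x (1 : k) ⊗ₜ[k] Finsupp.single y (1 : k)) =
      assocCoef S (x, y) • (Finsupp.single (assocMap S (x, y)).1 (1 : k) ⊗ₜ[k]
        Finsupp.single (assocMap S (x, y)).2 (1 : k)) := by
  have := ((Finsupp.basisSingleOne (R := k) (ι := X)).tensorProduct
    (Finsupp.basisSingleOne (R := k) (ι := X))).constr_basis k (fun p : X × X =>
      (partner S p).2 • (Finsupp.single (partner S p).1.1 (1 : k) ⊗ₜ[k]
        Finsupp.single (partner S p).1.2 (1 : k))) (x, y)
  rw [Module.Basis.tensorProduct_apply] at this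
  simp only [Finsupp.coe_basisSingleOne] at this
  exact this

/-- The basis of `V ⊗ V ⊗ V` given by triples. -/
def tripleBasis (k X : Type*) [Field k] :
    Module.Basis (X × X × X) k (V k X ⊗[k] (V k X ⊗[k] V k X)) :=
  (Finsupp.basisSingleOne (R := k) (ι := X)).tensorProduct
    ((Finsupp.basisSingleOne (R := k) (ι := X)).tensorProduct
      (Finsupp.basisSingleOne (R := k) (ι := X)))

theorem tripleBasis_apply (t : X × X × X) : tripleBasis k X t =
    Finsupp.single t.1 (1 : k) ⊗ₜ[k] (Finsupp.single t.2.1 (1 : k) ⊗ₜ[k]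
      Finsupp.single t.2.2 (1 : k)) := by
  obtain ⟨x, y, z⟩ := t
  simp [tripleBasis, Module.Basis.tensorProduct_apply]

theorem act23_tripleBasis (t : X × X × X) : act23 (assocLin S) (tripleBasis k X t) =
    coef23 S t • tripleBasis k X (map23 S t) := by
  rw [tripleBasis_apply, tripleBasis_apply, act23, LinearMap.lTensor_tmul, assocLin_single,
    TensorProduct.tmul_smul]
  rfl

theorem act12_tripleBasis (t : X × X × X) : act12 (assocLin S) (tripleBasis k X t) =
    coef12 S t • tripleBasis k X (map12 S t) := by
  rw [tripleBasis_apply, tripleBasis_apply, act12]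
  simp only [LinearMap.comp_apply, LinearEquiv.coe_coe, TensorProduct.assoc_symm_tmul,
    LinearMap.rTensor_tmul]
  rw [assocLin_single, ← TensorProduct.smul_tmul', map_smul, TensorProduct.assoc_tmul]
  rfl

/-- Bijectivity is automatic since the linear map is an involution. Both sides of the equation send
a basis triple to a nonzero multiple of a basis triple, so equality amounts to equality of triples
and of coefficients. -/
theorem IsQuantumBinomial.isYangBaxterSolution_iff (hS : IsQuantumBinomial S) :
    IsYangBaxterSolution (assocLin S) ↔ IsBraidedOnTriples S := by
  have hbij : Function.Bijective (assocLin S) := by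
    have hinv : assocLin S ∘ₗ assocLin S = LinearMap.id := by
      refine ((Finsupp.basisSingleOne (R := k) (ι := X)).tensorProduct
        (Finsupp.basisSingleOne (R := k) (ι := X))).ext fun p => ?_
      obtain ⟨x, y⟩ := p
      simp only [Module.Basis.tensorProduct_apply, Finsupp.coe_basisSingleOne,
        LinearMap.comp_apply, LinearMap.id_apply]
      rw [assocLin_single, map_smul, assocLin_single, Prod.mk.eta, hS.assocMap_assocMap, smul_smul,
        hS.assocCoef_mul, one_smul]
    have : Function.Involutive (assocLin S) := fun v => LinearMap.congr_fun hinv v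
    exact this.bijective
  have hl : ∀ t, (act12 (assocLin S) ∘ₗ act23 (assocLin S) ∘ₗ act12 (assocLin S))
      (tripleBasis k X t) =
      (coef12 S t * coef23 S (map12 S t) * coef12 S (map23 S (map12 S t))) •
        tripleBasis k X (map12 S (map23 S (map12 S t))) := fun t => by
    simp only [LinearMap.comp_apply, act12_tripleBasis, act23_tripleBasis, map_smul, smul_smul]
  have hr : ∀ t, (act23 (assocLin S) ∘ₗ act12 (assocLin S) ∘ₗ act23 (assocLin S))
      (tripleBasis k X t) =
      (coef23 S t * coef12 S (map23 S t) * coef23 S (map12 S (map23 S t))) •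
        tripleBasis k X (map23 S (map12 S (map23 S t))) := fun t => by
    simp only [LinearMap.comp_apply, act12_tripleBasis, act23_tripleBasis, map_smul, smul_smul]
  constructor
  · rintro ⟨-, h⟩ t
    have h1 := LinearMap.congr_fun h (tripleBasis k X t)
    rw [hl, hr] at h1
    have h2 := congrArg (tripleBasis k X).repr h1
    rw [map_smul, map_smul, Module.Basis.repr_self, Module.Basis.repr_self, Finsupp.smul_single,
      Finsupp.smul_single, Finsupp.single_eq_single_iff] at h2
    rcases h2 with ⟨h3, h4⟩ | ⟨h3, -⟩
    · exact ⟨h3, by simpa using h4⟩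
    · exfalso
      rw [smul_eq_mul, mul_one] at h3
      exact mul_ne_zero (mul_ne_zero (assocCoef_ne_zero S _) (assocCoef_ne_zero S _))
        (assocCoef_ne_zero S _) h3
  · intro h
    refine ⟨hbij, (tripleBasis k X).ext fun t => ?_⟩
    rw [hl, hr, (h t).1, (h t).2]

end YangBaxter

end QuantumBinomial

end

noncomputable section

/-! ### Counting orbits of two involutions by weights -/

section DihedralOrbits

variable {T : Type*}

/-- Two involutions whose orbits have at least three elements when they are paths with more than
one vertex, and at least six elements when they are cycles. -/
structure IsLongOrbitPair (a b : Equiv.Perm T) : Prop where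
  left_invol : ∀ t, a (a t) = t
  right_invol : ∀ t, b (b t) = t
  fixed_of_eq : ∀ t, a t = b t → a t = t
  fixed_of_comm : ∀ t, a (b t) = b (a t) → a t = t ∨ b t = t
  left_fixed : ∀ t, a t = t → a (b t) = b t → b t = t
  right_fixed : ∀ t, b t = t → b (a t) = a t → a t = t

variable {a b : Equiv.Perm T}

theorem IsLongOrbitPair.symm (h : IsLongOrbitPair a b) : IsLongOrbitPair b a where
  left_invol := h.right_invol
  right_invol := h.left_invol
  fixed_of_eq t ht := by rw [ht]; exact h.fixed_of_eq t ht.symm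
  fixed_of_comm t ht := (h.fixed_of_comm t ht.symm).symm
  left_fixed := h.right_fixed
  right_fixed := h.left_fixed

open Classical in
/-- A weight whose sum over an orbit is at least twelve. -/
def orbitWeight (a b : Equiv.Perm T) (t : T) : ℕ :=
  -- The constants give exactly 12 in the three extremal cases: a common fixed point ($2+3+3+4$), a
  -- path of three points ($5+2+5$) and a hexagon ($6\cdot 2$).
  2 + (if a t = t then 3 else 0) + (if b t = t then 3 else 0) + (if a t = t ∧ b t = t then 4 else 0)

theorem orbitWeight_comm (a b : Equiv.Perm T) (t : T) : orbitWeight a b t = orbitWeight b a t := by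
  unfold orbitWeight
  by_cases h1 : a t = t <;> by_cases h2 : b t = t <;> simp [h1, h2]

theorem two_le_orbitWeight (a b : Equiv.Perm T) (t : T) : 2 ≤ orbitWeight a b t := by
  unfold orbitWeight; omega

open Classical in
theorem card_mod_two_of_involutive (ha : ∀ t, a (a t) = t) {O : Finset T} (hO : ∀ t ∈ O, a t ∈ O) :
    (O.filter fun t => a t = t).card % 2 = O.card % 2 := by
  have h0 : ∑ t ∈ O.filter fun t => ¬ a t = t, (1 : ZMod 2) = 0 := by
    refine Finset.sum_involution (fun t _ => a t) ?_ ?_ ?_ ?_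
    · intro t _; decide
    · intro t ht _; exact (Finset.mem_filter.1 ht).2
    · intro t ht
      rw [Finset.mem_filter] at ht ⊢
      refine ⟨hO t ht.1, fun h => ht.2 (a.injective h)⟩
    · intro t _; exact ha t
  have h1 := Finset.card_filter_add_card_filter_not (s := O) (fun t => a t = t)
  rw [Finset.sum_const, nsmul_eq_mul, mul_one, ZMod.natCast_eq_zero_iff] at h0
  omega

open Classical in
theorem sum_orbitWeight_of_no_common (O : Finset T) (h : ∀ t ∈ O, ¬ (a t = t ∧ b t = t)) :
    ∑ t ∈ O, orbitWeight a b t =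
      2 * O.card + 3 * (O.filter fun t => a t = t).card + 3 * (O.filter fun t => b t = t).card := by
  have h1 : ∀ t ∈ O, orbitWeight a b t =
      2 + (if a t = t then 3 else 0) + (if b t = t then 3 else 0) := fun t ht => by
    unfold orbitWeight; rw [if_neg (h t ht), add_zero]
  rw [Finset.sum_congr rfl h1, Finset.sum_add_distrib, Finset.sum_add_distrib, ← Finset.sum_filter,
    ← Finset.sum_filter]
  simp only [Finset.sum_const, smul_eq_mul]
  ring

section Closed

variable {O : Finset T}

/-- The points `u`, `b u`, `a (b u)` are distinct. If there are no others, parity forces a fixed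
point of each involution and the weight is at least $6+3+3$; otherwise parity and the size still
push it above 12. -/
theorem IsLongOrbitPair.weight_of_left_fixed (h : IsLongOrbitPair a b) (ha : ∀ t ∈ O, a t ∈ O)
    (hb : ∀ t ∈ O, b t ∈ O) (hno : ∀ t ∈ O, ¬ (a t = t ∧ b t = t)) {u : T} (hu : u ∈ O)
    (hau : a u = u) : 12 ≤ ∑ t ∈ O, orbitWeight a b t ∧
      (∑ t ∈ O, orbitWeight a b t = 12 → ∀ t ∈ O, a (b (a t)) = b (a (b t))) := by
  classical
  have hbu : b u ≠ u := fun h1 => hno u hu ⟨hau, h1⟩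
  have habu : a (b u) ≠ b u := fun h1 => hbu (h.left_fixed u hau h1)
  have habu' : a (b u) ≠ u := fun h1 => hbu (by
    have := congrArg a h1
    rwa [h.left_invol, hau] at this)
  have hsub : {u, b u, a (b u)} ⊆ O := by
    intro t ht
    simp only [Finset.mem_insert, Finset.mem_singleton] at ht
    rcases ht with rfl | rfl | rfl
    · exact hu
    · exact hb _ hu
    · exact ha _ (hb _ hu)
  have hcard : ({u, b u, a (b u)} : Finset T).card = 3 := by
    rw [Finset.card_eq_three]
    exact ⟨u, b u, a (b u), hbu.symm, habu'.symm, habu.symm, rfl⟩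
  have h3 : 3 ≤ O.card := by rw [← hcard]; exact Finset.card_le_card hsub
  have hp1 := card_mod_two_of_involutive h.left_invol ha
  have hp2 := card_mod_two_of_involutive h.right_invol hb
  have hpos : 0 < (O.filter fun t => a t = t).card :=
    Finset.card_pos.2 ⟨u, Finset.mem_filter.2 ⟨hu, hau⟩⟩
  rw [sum_orbitWeight_of_no_common O hno]
  refine ⟨by omega, fun heq => ?_⟩
  have hO : ({u, b u, a (b u)} : Finset T) = O :=
    Finset.eq_of_subset_of_card_le hsub (by omega)
  have hend : b (a (b u)) = a (b u) := by
    have := hb _ (ha _ (hb _ hu))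
    rw [← hO] at this
    simp only [Finset.mem_insert, Finset.mem_singleton] at this
    rcases this with h1 | h1 | h1
    · exact absurd (by rw [← h.right_invol (a (b u)), h1]) habu
    · exact absurd (b.injective h1) habu'
    · exact h1
  intro t ht
  rw [← hO] at ht
  simp only [Finset.mem_insert, Finset.mem_singleton] at ht
  rcases ht with rfl | rfl | rfl
  · rw [hau, hend]
  · rw [hend, h.left_invol, h.right_invol, hau]
  · rw [h.left_invol, h.right_invol, hau, hend, h.left_invol, h.right_invol]

theorem IsLongOrbitPair.weight_of_closed (h : IsLongOrbitPair a b) (ha : ∀ t ∈ O, a t ∈ O)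
    (hb : ∀ t ∈ O, b t ∈ O) (hne : O.Nonempty) : 12 ≤ ∑ t ∈ O, orbitWeight a b t ∧
      (∑ t ∈ O, orbitWeight a b t = 12 → ∀ t ∈ O, a (b (a t)) = b (a (b t))) := by
  classical
  by_cases hcommon : ∃ u ∈ O, a u = u ∧ b u = u
  · obtain ⟨u, hu, hau, hbu⟩ := hcommon
    have hw : orbitWeight a b u = 12 := by simp [orbitWeight, hau, hbu]
    have hle : orbitWeight a b u + ∑ t ∈ O.erase u, orbitWeight a b t =
      ∑ t ∈ O, orbitWeight a b t := Finset.add_sum_erase O _ hu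
    refine ⟨by omega, fun heq t ht => ?_⟩
    have htu : t = u := by
      by_contra hne
      have h1 : orbitWeight a b t ≤ ∑ t ∈ O.erase u, orbitWeight a b t :=
        Finset.single_le_sum (fun _ _ => Nat.zero_le _) (Finset.mem_erase.2 ⟨hne, ht⟩)
      have := two_le_orbitWeight a b t
      omega
    subst htu
    rw [hau, hbu, hau]; exact hbu.symm
  push Not at hcommon
  have hno : ∀ t ∈ O, ¬ (a t = t ∧ b t = t) := fun t ht h1 => hcommon t ht h1.1 h1.2
  by_cases hfa : ∃ u ∈ O, a u = u
  · obtain ⟨u, hu, hau⟩ := hfa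
    exact h.weight_of_left_fixed ha hb hno hu hau
  by_cases hfb : ∃ u ∈ O, b u = u
  · obtain ⟨u, hu, hbu⟩ := hfb
    have := h.symm.weight_of_left_fixed hb ha (fun t ht h1 => hno t ht h1.symm) hu hbu
    simp only [orbitWeight_comm b a] at this
    exact ⟨this.1, fun heq t ht => (this.2 heq t ht).symm⟩
  push Not at hfa hfb
  -- Without fixed points these six are distinct, so there are at least six points; with exactly
  -- six, `b (a (b t))` can only be `a (b (a t))`.
  have key : ∀ t ∈ O, ({t, a t, b t, a (b t), b (a t), a (b (a t))} : Finset T).card = 6 ∧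
      ({t, a t, b t, a (b t), b (a t), a (b (a t))} : Finset T) ⊆ O := by
    intro t ht
    have hat := ha t ht
    have hbt := hb t ht
    have h1 : a t ≠ t := hfa t ht
    have h2 : b t ≠ t := hfb t ht
    have h3 : a t ≠ b t := fun e => h1 (h.fixed_of_eq t e)
    have h4 : a (b t) ≠ b (a t) := fun e => (h.fixed_of_comm t e).elim h1 h2
    have h5 : a (b t) ≠ t := fun e => h3 (by rw [← h.left_invol (b t), e])
    have h6 : a (b t) ≠ b t := hfa _ hbt
    have h7 : a (b t) ≠ a t := fun e => h2 (a.injective e)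
    have h8 : b (a t) ≠ t := fun e => h3 (by rw [← h.right_invol (a t), e])
    have h9 : b (a t) ≠ a t := hfb _ hat
    have h10 : b (a t) ≠ b t := fun e => h1 (b.injective e)
    have h11 : a (b (a t)) ≠ t := fun e => h9 (by rw [← h.left_invol (b (a t)), e])
    have h12 : a (b (a t)) ≠ a t := fun e => h8 (a.injective e)
    have h13 : a (b (a t)) ≠ b t := fun e => h4 (by rw [← e, h.left_invol])
    have h14 : a (b (a t)) ≠ a (b t) := fun e => h10 (a.injective e)
    have h15 : a (b (a t)) ≠ b (a t) := hfa _ (hb _ hat)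
    refine ⟨?_, ?_⟩
    · rw [Finset.card_insert_of_notMem, Finset.card_insert_of_notMem, Finset.card_insert_of_notMem,
        Finset.card_insert_of_notMem, Finset.card_insert_of_notMem, Finset.card_singleton]
      all_goals simp only [Finset.mem_insert, Finset.mem_singleton, not_or]
      · exact h15.symm
      · exact ⟨h4, h14.symm⟩
      · exact ⟨h6.symm, h10.symm, h13.symm⟩
      · exact ⟨h3, h7.symm, h9.symm, h12.symm⟩
      · exact ⟨h1.symm, h2.symm, h5.symm, h8.symm, h11.symm⟩
    · intro s hs
      simp only [Finset.mem_insert, Finset.mem_singleton] at hs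
      rcases hs with rfl | rfl | rfl | rfl | rfl | rfl
      · exact ht
      · exact hat
      · exact hbt
      · exact ha _ hbt
      · exact hb _ hat
      · exact ha _ (hb _ hat)
  have h6 : 6 ≤ O.card := by
    obtain ⟨t, ht⟩ := hne
    rw [← (key t ht).1]; exact Finset.card_le_card (key t ht).2
  rw [sum_orbitWeight_of_no_common O hno]
  refine ⟨by omega, fun heq t ht => ?_⟩
  have hO := Finset.eq_of_subset_of_card_le (key t ht).2 (by rw [(key t ht).1]; omega)
  have hmem := hb _ (ha _ (hb _ ht))
  rw [← hO] at hmem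
  simp only [Finset.mem_insert, Finset.mem_singleton] at hmem
  have hat := ha t ht
  have hbt := hb t ht
  have e3 : a t ≠ b t := fun e => hfa t ht (h.fixed_of_eq t e)
  have e4 : a (b t) ≠ b (a t) := fun e => (h.fixed_of_comm t e).elim (hfa t ht) (hfb t ht)
  rcases hmem with e | e | e | e | e | e
  · exact absurd (by rw [← h.right_invol (a (b t)), e]) (hfa _ hbt)
  · exact absurd (by rw [← e, h.right_invol]) e4
  · exact absurd (b.injective e) fun e' => e3 (by rw [← h.left_invol (b t), e'])
  · exact absurd e (hfb _ (ha _ hbt))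
  · exact absurd (b.injective e) fun e' => hfb t ht (a.injective e')
  · exact e.symm

end Closed

/-- The orbits of two involutions. -/
abbrev DihedralOrbit (a b : Equiv.Perm T) : Type _ :=
  MulAction.orbitRel.Quotient (Subgroup.closure {a, b}) T

/-- The orbit of a point under two permutations. -/
def toOrbit (a b : Equiv.Perm T) (t : T) : DihedralOrbit a b := Quotient.mk'' t

theorem toOrbit_eq_of_mem {g : Equiv.Perm T} (hg : g ∈ Subgroup.closure {a, b}) (t : T) :
    toOrbit a b (g t) = toOrbit a b t :=
  Quotient.sound' ⟨⟨g, hg⟩, rfl⟩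

theorem toOrbit_left (t : T) : toOrbit a b (a t) = toOrbit a b t :=
  toOrbit_eq_of_mem (Subgroup.subset_closure (by simp)) t

theorem toOrbit_right (t : T) : toOrbit a b (b t) = toOrbit a b t :=
  toOrbit_eq_of_mem (Subgroup.subset_closure (by simp)) t

theorem IsLongOrbitPair.orbit_induction (h : IsLongOrbitPair a b) {P : T → Prop} {u t : T}
    (hu : P u) (ha : ∀ t, P t → P (a t)) (hb : ∀ t, P t → P (b t))
    (ht : toOrbit a b t = toOrbit a b u) : P t := by
  obtain ⟨⟨g, hg⟩, rfl⟩ := Quotient.exact' ht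
  clear ht
  change P (g u)
  suffices key : ∀ u, P u → P (g u) from key u hu
  clear hu u
  induction hg using Subgroup.closure_induction'' with
  | mem x hx =>
    simp only [Set.mem_insert_iff, Set.mem_singleton_iff] at hx
    rcases hx with rfl | rfl
    · exact ha
    · exact hb
  | inv_mem x hx =>
    simp only [Set.mem_insert_iff, Set.mem_singleton_iff] at hx
    intro u hu
    rcases hx with rfl | rfl
    · have : x⁻¹ u = x u := by rw [Equiv.Perm.inv_eq_iff_eq, h.left_invol]
      rw [this]; exact ha u hu
    · have : x⁻¹ u = x u := by rw [Equiv.Perm.inv_eq_iff_eq, h.right_invol]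
      rw [this]; exact hb u hu
  | one => exact fun u hu => hu
  | mul x y _ _ hx hy => exact fun u hu => hx _ (hy _ hu)

variable [Fintype T]

instance : Finite (DihedralOrbit a b) := Quotient.finite _

open Classical in
instance : Fintype (DihedralOrbit a b) := Fintype.ofFinite _

open Classical in
theorem sum_orbitWeight_eq (a b : Equiv.Perm T) : ∑ t, orbitWeight a b t =
    ∑ ω : DihedralOrbit a b, ∑ t with toOrbit a b t = ω, orbitWeight a b t :=
  (Finset.sum_fiberwise _ _ _).symm

open Classical in
theorem IsLongOrbitPair.weight_of_orbit (h : IsLongOrbitPair a b) (ω : DihedralOrbit a b) :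
    12 ≤ ∑ t with toOrbit a b t = ω, orbitWeight a b t ∧
      (∑ t with toOrbit a b t = ω, orbitWeight a b t = 12 →
        ∀ t, toOrbit a b t = ω → a (b (a t)) = b (a (b t))) := by
  have := h.weight_of_closed (O := Finset.univ.filter fun t => toOrbit a b t = ω)
    (by simp [toOrbit_left]) (by simp [toOrbit_right]) (by
      induction ω using Quotient.inductionOn' with
      | h t => exact ⟨t, Finset.mem_filter.2 ⟨Finset.mem_univ _, rfl⟩⟩)
  refine ⟨this.1, fun heq t ht => this.2 heq t (by simpa using ht)⟩

theorem IsLongOrbitPair.card_orbits_le (h : IsLongOrbitPair a b) :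
    12 * Fintype.card (DihedralOrbit a b) ≤ ∑ t, orbitWeight a b t := by
  rw [sum_orbitWeight_eq, mul_comm, ← smul_eq_mul, ← Finset.card_univ, ← Finset.sum_const]
  exact Finset.sum_le_sum fun ω _ => (h.weight_of_orbit ω).1

theorem IsLongOrbitPair.braid_of_card_eq (h : IsLongOrbitPair a b)
    (heq : 12 * Fintype.card (DihedralOrbit a b) = ∑ t, orbitWeight a b t) (t : T) :
    a (b (a t)) = b (a (b t)) := by
  rw [sum_orbitWeight_eq, mul_comm, ← smul_eq_mul, ← Finset.card_univ, ← Finset.sum_const] at heq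
  have := (Finset.sum_eq_sum_iff_of_le fun ω _ => (h.weight_of_orbit ω).1).1 heq
    (toOrbit a b t) (Finset.mem_univ _)
  exact (h.weight_of_orbit _).2 this.symm t rfl

open Classical in
theorem IsLongOrbitPair.weight_le_of_left_fixed (h : IsLongOrbitPair a b)
    (hbr : ∀ t, a (b (a t)) = b (a (b t))) (u : T) (hau : a u = u) :
    ∑ t with toOrbit a b t = toOrbit a b u, orbitWeight a b t ≤ 12 := by
  by_cases hbu : b u = u
  · have hO : (Finset.univ.filter fun t => toOrbit a b t = toOrbit a b u) = {u} := by
      ext t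
      simp only [Finset.mem_filter, Finset.mem_univ, true_and, Finset.mem_singleton]
      constructor
      · intro ht
        refine h.orbit_induction (P := fun t => t = u) rfl ?_ ?_ ht
        · rintro _ rfl; exact hau
        · rintro _ rfl; exact hbu
      · rintro rfl; rfl
    rw [hO, Finset.sum_singleton]
    simp [orbitWeight, hau, hbu]
  · have hsub : (Finset.univ.filter fun t => toOrbit a b t = toOrbit a b u) ⊆
        {u, b u, a (b u)} := by
      intro t ht
      simp only [Finset.mem_filter, Finset.mem_univ, true_and] at ht
      refine h.orbit_induction (P := fun t => t ∈ ({u, b u, a (b u)} : Finset T))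
        (by simp) ?_ ?_ ht
      · intro t ht
        simp only [Finset.mem_insert, Finset.mem_singleton] at ht ⊢
        rcases ht with rfl | rfl | rfl
        · exact Or.inl hau
        · exact Or.inr (Or.inr rfl)
        · exact Or.inr (Or.inl (h.left_invol _))
      · intro t ht
        simp only [Finset.mem_insert, Finset.mem_singleton] at ht ⊢
        rcases ht with rfl | rfl | rfl
        · exact Or.inr (Or.inl rfl)
        · exact Or.inl (h.right_invol _)
        · exact Or.inr (Or.inr (by rw [← hbr, hau]))
    have habu : a (b u) ≠ b u := fun h1 => hbu (h.left_fixed u hau h1)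
    have habu' : a (b u) ≠ u := fun h1 => hbu (by
      have := congrArg a h1
      rwa [h.left_invol, hau] at this)
    refine (Finset.sum_le_sum_of_subset hsub).trans ?_
    rw [Finset.sum_insert (by simp [Ne.symm hbu, habu'.symm]), Finset.sum_insert (by simpa using habu.symm),
      Finset.sum_singleton]
    have w1 : orbitWeight a b u = 5 := by simp [orbitWeight, hau, hbu]
    have w2 : orbitWeight a b (b u) = 2 := by
      simp [orbitWeight, habu, h.right_invol, Ne.symm hbu]
    have w3 : orbitWeight a b (a (b u)) = 5 := by
      simp [orbitWeight, h.left_invol, habu.symm, show b (a (b u)) = a (b u) by rw [← hbr, hau]]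
    omega

/-- The braid relation makes an orbit a quotient of $S_3$: it has at most six points, and at most
three if there is a fixed point. So no orbit weighs more than 12. -/
theorem IsLongOrbitPair.card_orbits_of_braid (h : IsLongOrbitPair a b)
    (hbr : ∀ t, a (b (a t)) = b (a (b t))) :
    12 * Fintype.card (DihedralOrbit a b) = ∑ t, orbitWeight a b t := by
  classical
  refine le_antisymm h.card_orbits_le ?_
  rw [sum_orbitWeight_eq, mul_comm, ← smul_eq_mul, ← Finset.card_univ, ← Finset.sum_const]
  refine Finset.sum_le_sum fun ω _ => ?_
  induction ω using Quotient.inductionOn' with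
  | h u =>
  change ∑ t with toOrbit a b t = toOrbit a b u, orbitWeight a b t ≤ 12
  by_cases hfa : ∃ v, toOrbit a b v = toOrbit a b u ∧ a v = v
  · obtain ⟨v, hv, hav⟩ := hfa
    rw [← hv]; exact h.weight_le_of_left_fixed hbr v hav
  by_cases hfb : ∃ v, toOrbit a b v = toOrbit a b u ∧ b v = v
  · obtain ⟨v, hv, hbv⟩ := hfb
    -- If `b` fixes `v`, the braid relation makes `a` fix `b (a v)`.
    exact absurd ⟨b (a v), by rw [toOrbit_right, toOrbit_left, hv], by rw [hbr, hbv]⟩ hfa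
  push Not at hfa hfb
  have hw : ∀ t ∈ Finset.univ.filter fun t => toOrbit a b t = toOrbit a b u,
      orbitWeight a b t = 2 := by
    intro t ht
    have ht' := (Finset.mem_filter.1 ht).2
    simp [orbitWeight, hfa t ht', hfb t ht']
  rw [Finset.sum_congr rfl hw, Finset.sum_const, smul_eq_mul]
  have hsub : (Finset.univ.filter fun t => toOrbit a b t = toOrbit a b u) ⊆
      {u, a u, b u, a (b u), b (a u), a (b (a u))} := by
    intro t ht
    simp only [Finset.mem_filter, Finset.mem_univ, true_and] at ht
    refine h.orbit_induction
      (P := fun t => t ∈ ({u, a u, b u, a (b u), b (a u), a (b (a u))} : Finset T))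
      (by simp) ?_ ?_ ht
    · intro t ht
      simp only [Finset.mem_insert, Finset.mem_singleton] at ht ⊢
      rcases ht with rfl | rfl | rfl | rfl | rfl | rfl <;> simp [h.left_invol]
    · intro t ht
      simp only [Finset.mem_insert, Finset.mem_singleton] at ht ⊢
      rcases ht with rfl | rfl | rfl | rfl | rfl | rfl
      · simp
      · simp
      · simp [h.right_invol]
      · simp [← hbr]
      · simp [h.right_invol]
      · simp [hbr, h.right_invol]
  have := (Finset.card_le_card hsub).trans Finset.card_le_six
  omega

end DihedralOrbits

end

noncomputable section

/-! ### Invariant functions for a weighted action of $S_3$ -/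

section WeightedBraid

variable {T k : Type*} [Field k]

/-- Two involutions satisfying the braid relation, together with compatible weights. -/
structure IsWeightedBraidPair (a b : Equiv.Perm T) (α β : T → k) : Prop
    extends IsLongOrbitPair a b where
  braid : ∀ t, a (b (a t)) = b (a (b t))
  left_weight : ∀ t, α t * α (a t) = 1
  right_weight : ∀ t, β t * β (b t) = 1
  left_weight_fixed : ∀ t, a t = t → α t = 1
  right_weight_fixed : ∀ t, b t = t → β t = 1
  braid_weight : ∀ t, α t * β (a t) * α (b (a t)) = β t * α (b t) * β (a (b t))

variable {a b : Equiv.Perm T} {α β : T → k}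

theorem IsWeightedBraidPair.symm (h : IsWeightedBraidPair a b α β) :
    IsWeightedBraidPair b a β α where
  toIsLongOrbitPair := h.toIsLongOrbitPair.symm
  braid t := (h.braid t).symm
  left_weight := h.right_weight
  right_weight := h.left_weight
  left_weight_fixed := h.right_weight_fixed
  right_weight_fixed := h.left_weight_fixed
  braid_weight t := (h.braid_weight t).symm

/-- The weighted action of a permutation on functions. -/
def weightedAct (a : Equiv.Perm T) (α : T → k) (F : T → k) : T → k := fun t => α t * F (a t)

theorem weightedAct_add (F G : T → k) :
    weightedAct a α (F + G) = weightedAct a α F + weightedAct a α G := by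
  ext t; simp [weightedAct, mul_add]

theorem IsWeightedBraidPair.left_left (h : IsWeightedBraidPair a b α β) (F : T → k) :
    weightedAct a α (weightedAct a α F) = F := by
  ext t
  simp only [weightedAct]
  rw [← mul_assoc, h.left_weight, h.left_invol, one_mul]

theorem IsWeightedBraidPair.right_right (h : IsWeightedBraidPair a b α β) (F : T → k) :
    weightedAct b β (weightedAct b β F) = F := h.symm.left_left F

theorem IsWeightedBraidPair.weightedAct_braid (h : IsWeightedBraidPair a b α β) (F : T → k) :
    weightedAct b β (weightedAct a α (weightedAct b β F)) =
      weightedAct a α (weightedAct b β (weightedAct a α F)) := by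
  ext t
  simp only [weightedAct, ← mul_assoc]
  rw [h.braid_weight, h.braid]

/-- A function with values zero outside an orbit. -/
def SupportedOn (a b : Equiv.Perm T) (u : T) (F : T → k) : Prop :=
  ∀ t, toOrbit a b t ≠ toOrbit a b u → F t = 0

theorem SupportedOn.left {u : T} {F : T → k} (hF : SupportedOn a b u F) :
    SupportedOn a b u (weightedAct a α F) := fun t ht => by
  rw [weightedAct, hF _ (by rwa [toOrbit_left]), mul_zero]

theorem SupportedOn.right {u : T} {F : T → k} (hF : SupportedOn a b u F) :
    SupportedOn a b u (weightedAct b β F) := fun t ht => by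
  rw [weightedAct, hF _ (by rwa [toOrbit_right]), mul_zero]

theorem SupportedOn.add {u : T} {F G : T → k} (hF : SupportedOn a b u F)
    (hG : SupportedOn a b u G) : SupportedOn a b u (F + G) := fun t ht => by
  rw [Pi.add_apply, hF t ht, hG t ht, add_zero]

open Classical in
theorem supportedOn_single (u : T) : SupportedOn a b u (Pi.single u (1 : k)) := fun t ht => by
  rw [Pi.single_apply, if_neg]
  rintro rfl; exact ht rfl

open Classical in
theorem IsWeightedBraidPair.weightedAct_single (h : IsWeightedBraidPair a b α β) {u : T}
    (hu : a u = u) : weightedAct a α (Pi.single u (1 : k)) = Pi.single u 1 := by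
  ext t
  simp only [weightedAct, Pi.single_apply]
  by_cases ht : t = u
  · subst ht; simp [hu, h.left_weight_fixed _ hu]
  · rw [if_neg ht, if_neg fun h1 => ht (by rw [← h.left_invol t, h1, hu]), mul_zero]

/-- There is an invariant function, supported on the orbit of `u`, which does not vanish at `u`. -/
def HasInvariant (a b : Equiv.Perm T) (α β : T → k) (u : T) : Prop :=
  ∃ F : T → k, weightedAct a α F = F ∧ weightedAct b β F = F ∧ SupportedOn a b u F ∧ F u ≠ 0

theorem IsWeightedBraidPair.hasInvariant_of_left_fixed (h : IsWeightedBraidPair a b α β) {u : T}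
    (hu : a u = u) : HasInvariant a b α β u := by
  classical
  set D : T → k := Pi.single u 1
  have hA : weightedAct a α D = D := h.weightedAct_single hu
  by_cases hbu : b u = u
  · exact ⟨D, hA, h.symm.weightedAct_single hbu, supportedOn_single u, by simp [D]⟩
  -- `D` is already invariant under the first involution, so only coset representatives are summed.
  -- The value at `u` is then 1 in every characteristic, whereas the full sum over $S_3$ would
  -- double it.
  refine ⟨D + weightedAct b β D + weightedAct a α (weightedAct b β D), ?_, ?_, ?_, ?_⟩
  · rw [weightedAct_add, weightedAct_add, h.left_left, hA]; abel
  · rw [weightedAct_add, weightedAct_add, h.right_right, h.weightedAct_braid, hA]; abel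
  · exact ((supportedOn_single u).add (supportedOn_single u).right).add
      (supportedOn_single u).right.left
  · simp [weightedAct, hu, D, hbu]

theorem HasInvariant.symm {u : T} (h : HasInvariant a b α β u) : HasInvariant b a β α u := by
  obtain ⟨F, h1, h2, h3, h4⟩ := h
  refine ⟨F, h2, h1, fun t ht => h3 t fun h => ht ?_, h4⟩
  unfold toOrbit DihedralOrbit at *
  rwa [Set.pair_comm b a]

theorem HasInvariant.congr (h : IsWeightedBraidPair a b α β) {u v : T}
    (hu : HasInvariant a b α β u) (huv : toOrbit a b v = toOrbit a b u) :
    HasInvariant a b α β v := by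
  obtain ⟨F, h1, h2, h3, h4⟩ := hu
  refine ⟨F, h1, h2, fun t ht => h3 t (by rwa [← huv]), ?_⟩
  refine h.toIsLongOrbitPair.orbit_induction (P := fun t => F t ≠ 0) h4 ?_ ?_ huv
  · intro t ht h0
    rw [← h1] at ht
    exact ht (by rw [weightedAct, h0, mul_zero])
  · intro t ht h0
    rw [← h2] at ht
    exact ht (by rw [weightedAct, h0, mul_zero])

theorem IsWeightedBraidPair.hasInvariant (h : IsWeightedBraidPair a b α β) (u : T) :
    HasInvariant a b α β u := by
  classical
  by_cases hfa : ∃ v, toOrbit a b u = toOrbit a b v ∧ a v = v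
  · obtain ⟨v, hv, hav⟩ := hfa
    exact (h.hasInvariant_of_left_fixed hav).congr h hv
  by_cases hfb : ∃ v, toOrbit a b u = toOrbit a b v ∧ b v = v
  · obtain ⟨v, hv, hbv⟩ := hfb
    exact (h.symm.hasInvariant_of_left_fixed hbv).symm.congr h hv
  push Not at hfa hfb
  have h1 : a u ≠ u := hfa u rfl
  have h2 : b u ≠ u := hfb u rfl
  have h3 : a u ≠ b u := fun e => h1 (h.fixed_of_eq u e)
  have h4 : a (b u) ≠ u := fun e => h3 (by rw [← h.left_invol (b u), e])
  have h5 : b (a u) ≠ u := fun e => h3 (by rw [← h.right_invol (a u), e])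
  have h6 : a (b (a u)) ≠ u := fun e =>
    hfb (a u) (by rw [toOrbit_left]) (by rw [← h.left_invol (b (a u)), e])
  set D : T → k := Pi.single u 1
  -- The sum over all of $S_3$. No nontrivial element fixes `u`, so only the term `D` contributes at
  -- `u`.
  refine ⟨D + weightedAct a α D + weightedAct b β D + weightedAct a α (weightedAct b β D) +
    weightedAct b β (weightedAct a α D) +
    weightedAct a α (weightedAct b β (weightedAct a α D)), ?_, ?_, ?_, ?_⟩
  · simp only [weightedAct_add, h.left_left]; abel
  · rw [← h.weightedAct_braid D]
    simp only [weightedAct_add, h.right_right]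
    rw [h.weightedAct_braid]; abel
  · have h0 : SupportedOn a b u D := supportedOn_single u
    exact ((((h0.add h0.left).add h0.right).add h0.right.left).add h0.left.right).add
      h0.left.right.left
  · simp [weightedAct, D, h1, h2, h4, h5, h6]

end WeightedBraid

/-! ### Orbits on triples and the dimension in degree three -/

namespace QuantumBinomial

variable {k X : Type*} [Field k] {S : Set (FreeAlg k X)}

theorem IsQuantumBinomial.map12_map12 (hS : IsQuantumBinomial S) (t : X × X × X) :
    map12 S (map12 S t) = t := by
  simp only [map12, Prod.mk.eta, hS.assocMap_assocMap]

theorem IsQuantumBinomial.map23_map23 (hS : IsQuantumBinomial S) (t : X × X × X) :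
    map23 S (map23 S t) = t := by
  simp only [map23, hS.assocMap_assocMap]

/-- The permutation `r × id` of `X × X × X`. -/
def IsQuantumBinomial.perm12 (hS : IsQuantumBinomial S) : Equiv.Perm (X × X × X) :=
  ⟨map12 S, map12 S, hS.map12_map12, hS.map12_map12⟩

/-- The permutation `id × r` of `X × X × X`. -/
def IsQuantumBinomial.perm23 (hS : IsQuantumBinomial S) : Equiv.Perm (X × X × X) :=
  ⟨map23 S, map23 S, hS.map23_map23, hS.map23_map23⟩

theorem IsQuantumBinomial.perm12_apply (hS : IsQuantumBinomial S) (t : X × X × X) :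
    hS.perm12 t = map12 S t := rfl

theorem IsQuantumBinomial.perm23_apply (hS : IsQuantumBinomial S) (t : X × X × X) :
    hS.perm23 t = map23 S t := rfl

theorem IsQuantumBinomial.map12_eq_self_iff (hS : IsQuantumBinomial S) (t : X × X × X) :
    map12 S t = t ↔ t.1 = t.2.1 := by
  constructor
  · intro h; exact hS.eq_of_fst_eq (congrArg Prod.fst h)
  · obtain ⟨x, y, z⟩ := t
    intro h
    obtain rfl : x = y := h
    simp [map12, hS.assocMap_diag]

theorem IsQuantumBinomial.map23_eq_self_iff (hS : IsQuantumBinomial S) (t : X × X × X) :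
    map23 S t = t ↔ t.2.1 = t.2.2 := by
  constructor
  · intro h; exact hS.eq_of_fst_eq (congrArg (fun t => t.2.1) h)
  · obtain ⟨x, y, z⟩ := t
    intro h
    obtain rfl : y = z := h
    simp [map23, hS.assocMap_diag]

/-- Comparing one coordinate in each coincidence reduces it to ${}^xy=x$ or $x^y=y$, hence to $x=y$.
For commuting maps one also cancels the bijection $y\mapsto{}^xy$. -/
theorem IsQuantumBinomial.isLongOrbitPair (hS : IsQuantumBinomial S) :
    IsLongOrbitPair hS.perm12 hS.perm23 where
  left_invol := hS.map12_map12
  right_invol := hS.map23_map23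
  fixed_of_eq t ht := (hS.map12_eq_self_iff t).2 (hS.eq_of_fst_eq (congrArg Prod.fst ht))
  fixed_of_comm t ht := by
    right
    refine (hS.map23_eq_self_iff t).2 (hS.eq_of_fst_eq ?_)
    have h1 : (assocMap S (t.1, (assocMap S (t.2.1, t.2.2)).1)).1 = (assocMap S (t.1, t.2.1)).1 :=
      congrArg (fun t : X × X × X => t.1) ht
    exact (hS.nondegenerate.1 t.1).1 h1
  left_fixed t ht h := by
    refine (hS.map23_eq_self_iff t).2 (hS.eq_of_fst_eq ?_)
    rw [perm12_apply, map12_eq_self_iff hS] at ht h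
    exact h.symm.trans ht
  right_fixed t ht h := by
    refine (hS.map12_eq_self_iff t).2 (hS.eq_of_snd_eq ?_)
    rw [perm23_apply, map23_eq_self_iff hS] at ht h
    exact h.trans ht.symm

/-- The involutions fix the triples whose first two, respectively last two, letters agree: $n^2$
each and $n$ in common. Hence the total $2n^3+6n^2+4n$. -/
theorem IsQuantumBinomial.sum_orbitWeight [Fintype X] (hS : IsQuantumBinomial S) :
    ∑ t, orbitWeight hS.perm12 hS.perm23 t = 12 * (Fintype.card X + 2).choose 3 := by
  classical
  have h1 : ∀ x y z : X, orbitWeight hS.perm12 hS.perm23 (x, y, z) = 2 + (if x = y then 3 else 0) +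
      (if y = z then 3 else 0) + (if x = y then (if y = z then 4 else 0) else 0) := by
    intro x y z
    simp only [orbitWeight, perm12_apply, perm23_apply, map12_eq_self_iff hS,
      map23_eq_self_iff hS, ite_and]
  have h2 := Nat.descFactorial_eq_factorial_mul_choose (Fintype.card X + 2) 3
  have h3 : (Fintype.card X + 2).descFactorial 3 =
      Fintype.card X * (Fintype.card X + 1) * (Fintype.card X + 2) := by
    simp [Nat.descFactorial]; ring
  rw [h3, show Nat.factorial 3 = 6 from rfl] at h2
  rw [show 12 = 2 * 6 from rfl, mul_assoc, ← h2]
  simp only [Fintype.sum_prod_type, h1, Finset.sum_add_distrib]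
  have h4 : ∀ x : X, ∑ y : X, ∑ z : X, (if x = y then (if y = z then 4 else 0) else 0) = 4 := by
    intro x
    rw [Finset.sum_eq_single x]
    · simp
    · intro y _ hy
      simp [Ne.symm hy]
    · simp
  have h5 : ∀ x : X, ∑ y : X, ∑ _z : X, (if x = y then 3 else 0) = Fintype.card X * 3 := by
    intro x
    simp only [Finset.sum_const, smul_eq_mul, Finset.card_univ, ← Finset.mul_sum,
      Finset.sum_ite_eq, Finset.mem_univ, if_true]
  simp only [h4, h5, Finset.sum_const, smul_eq_mul, Finset.card_univ, Finset.sum_ite_eq,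
    Finset.mem_univ, if_true]
  ring

theorem IsQuantumBinomial.toOrbit_out (hS : IsQuantumBinomial S) (t : X × X × X) :
    toOrbit hS.perm12 hS.perm23 t =
      toOrbit hS.perm12 hS.perm23 (toOrbit hS.perm12 hS.perm23 t).out :=
  (Quotient.out_eq' (toOrbit hS.perm12 hS.perm23 t)).symm

theorem IsQuantumBinomial.apply_eq_zero_of_toOrbit_eq (hS : IsQuantumBinomial S)
    {F : X × X × X → k} (hF : F ∈ cubicFunctionals S) {t u : X × X × X}
    (htu : toOrbit hS.perm12 hS.perm23 t = toOrbit hS.perm12 hS.perm23 u) (hu : F u = 0) :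
    F t = 0 := by
  refine hS.isLongOrbitPair.orbit_induction (P := fun t => F t = 0) hu ?_ ?_ htu
  · intro t ht
    rw [(hF t).1] at ht
    exact (mul_eq_zero.1 ht).resolve_left (assocCoef_ne_zero S _)
  · intro t ht
    rw [(hF t).2] at ht
    exact (mul_eq_zero.1 ht).resolve_left (assocCoef_ne_zero S _)

theorem IsQuantumBinomial.isWeightedBraidPair (hS : IsQuantumBinomial S)
    (h : IsBraidedOnTriples S) :
    IsWeightedBraidPair hS.perm12 hS.perm23 (coef12 S) (coef23 S) where
  toIsLongOrbitPair := hS.isLongOrbitPair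
  braid t := (h t).1
  left_weight t := hS.assocCoef_mul (t.1, t.2.1)
  right_weight t := hS.assocCoef_mul t.2
  left_weight_fixed _ ht := assocCoef_eq_one (Prod.ext (congrArg (fun t => t.1) ht)
    (congrArg (fun t => t.2.1) ht))
  right_weight_fixed _ ht := assocCoef_eq_one (congrArg (fun t => t.2) ht)
  braid_weight t := (h t).2

/-- The evaluation of the functionals at representatives of the orbits. -/
def IsQuantumBinomial.evalOrbits (hS : IsQuantumBinomial S) :
    cubicFunctionals S →ₗ[k] (DihedralOrbit hS.perm12 hS.perm23 → k) where
  toFun F ω := F.1 ω.out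
  map_add' _ _ := rfl
  map_smul' _ _ := rfl

theorem IsQuantumBinomial.evalOrbits_injective (hS : IsQuantumBinomial S) :
    Function.Injective hS.evalOrbits := by
  rw [← LinearMap.ker_eq_bot, LinearMap.ker_eq_bot']
  rintro ⟨F, hF⟩ h0
  refine Subtype.ext (funext fun t => ?_)
  exact hS.apply_eq_zero_of_toOrbit_eq hF (hS.toOrbit_out t)
    (congrFun h0 (toOrbit hS.perm12 hS.perm23 t))

variable [Fintype X]

theorem IsQuantumBinomial.finrank_cubicFunctionals_le (hS : IsQuantumBinomial S) :
    Module.finrank k (cubicFunctionals S) ≤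
      Fintype.card (DihedralOrbit hS.perm12 hS.perm23) := by
  have := LinearMap.finrank_le_finrank_of_injective hS.evalOrbits_injective
  rwa [Module.finrank_fintype_fun_eq_card] at this

theorem IsQuantumBinomial.card_orbits_le_choose (hS : IsQuantumBinomial S) :
    Fintype.card (DihedralOrbit hS.perm12 hS.perm23) ≤ (Fintype.card X + 2).choose 3 := by
  have := hS.isLongOrbitPair.card_orbits_le
  rw [hS.sum_orbitWeight] at this
  omega

theorem IsQuantumBinomial.isBraidedOnTriples_of_finrank_eq (hS : IsQuantumBinomial S)
    (h : Module.finrank k (cubicFunctionals S) = (Fintype.card X + 2).choose 3) :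
    IsBraidedOnTriples S := by
  have h1 := hS.finrank_cubicFunctionals_le
  have h2 := hS.card_orbits_le_choose
  have hbr := hS.isLongOrbitPair.braid_of_card_eq (by rw [hS.sum_orbitWeight]; omega)
  have hsurj := (LinearMap.injective_iff_surjective_of_finrank_eq_finrank (by
    rw [Module.finrank_fintype_fun_eq_card]; omega)).1 hS.evalOrbits_injective
  -- Equality of dimensions makes evaluation at representatives surjective, so some compatible
  -- function vanishes nowhere. Transporting it along both sides of the braid relation and
  -- cancelling gives the relation for the coefficients.
  obtain ⟨⟨F, hF⟩, hF1⟩ := hsurj fun _ => 1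
  have hne : ∀ t, F t ≠ 0 := fun t h0 => by
    have h3 := hS.apply_eq_zero_of_toOrbit_eq hF (hS.toOrbit_out t).symm h0
    have h4 : F (toOrbit hS.perm12 hS.perm23 t).out = 1 := congrFun hF1 _
    exact one_ne_zero (h4.symm.trans h3)
  intro t
  have hbt : map12 S (map23 S (map12 S t)) = map23 S (map12 S (map23 S t)) := hbr t
  refine ⟨hbt, ?_⟩
  have h5 : F t = coef12 S t * coef23 S (map12 S t) * coef12 S (map23 S (map12 S t)) *
      F (map12 S (map23 S (map12 S t))) := by
    rw [mul_assoc, mul_assoc, ← (hF _).1, ← (hF _).2, ← (hF _).1]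
  have h6 : F t = coef23 S t * coef12 S (map23 S t) * coef23 S (map12 S (map23 S t)) *
      F (map23 S (map12 S (map23 S t))) := by
    rw [mul_assoc, mul_assoc, ← (hF _).2, ← (hF _).1, ← (hF _).2]
  rw [← hbt] at h6
  exact mul_right_cancel₀ (hne _) (h5.symm.trans h6)

/-- There are exactly $\binom{n+2}{3}$ orbits, and each carries an invariant function supported on
it and nonzero at its representative. -/
theorem IsQuantumBinomial.finrank_eq_of_isBraidedOnTriples (hS : IsQuantumBinomial S)
    (h : IsBraidedOnTriples S) :
    Module.finrank k (cubicFunctionals S) = (Fintype.card X + 2).choose 3 := by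
  classical
  have hcard := hS.isLongOrbitPair.card_orbits_of_braid fun t => (h t).1
  rw [hS.sum_orbitWeight] at hcard
  have hcard' : Fintype.card (DihedralOrbit hS.perm12 hS.perm23) =
    (Fintype.card X + 2).choose 3 := by omega
  rw [← hcard', ← Module.finrank_fintype_fun_eq_card k]
  refine (LinearEquiv.ofBijective hS.evalOrbits ⟨hS.evalOrbits_injective, ?_⟩).finrank_eq
  have hinv := fun ω : DihedralOrbit hS.perm12 hS.perm23 =>
    (hS.isWeightedBraidPair h).hasInvariant ω.out
  choose F hA hB hsupp hne using hinv
  intro v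
  refine ⟨∑ ω, (v ω / F ω ω.out) • ⟨F ω, fun t => ⟨(congrFun (hA ω) t).symm,
    (congrFun (hB ω) t).symm⟩⟩, ?_⟩
  rw [map_sum]
  ext ω'
  rw [Finset.sum_apply, Finset.sum_eq_single ω']
  · rw [map_smul, Pi.smul_apply, smul_eq_mul]
    exact div_mul_cancel₀ _ (hne ω')
  · intro ω _ hω
    rw [map_smul, Pi.smul_apply, smul_eq_mul]
    have : F ω ω'.out = 0 := hsupp ω _ fun h => hω (by
      have h1 : toOrbit hS.perm12 hS.perm23 ω'.out = ω' := Quotient.out_eq' ω'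
      have h2 : toOrbit hS.perm12 hS.perm23 ω.out = ω := Quotient.out_eq' ω
      rw [← h1, ← h2, h])
    exact mul_eq_zero_of_right _ this
  · intro h; exact absurd (Finset.mem_univ _) h

end QuantumBinomial

end

noncomputable section

namespace QuantumBinomial

/-! ### Sorted words of length three, and the dimension from a Gröbner basis -/

section SortedTriples

/-- The nondecreasing triples. -/
abbrev SortedTriple (n : ℕ) : Type :=
  {t : Fin n × Fin n × Fin n // t.1 ≤ t.2.1 ∧ t.2.1 ≤ t.2.2}

theorem card_sortedTriple (n : ℕ) : Fintype.card (SortedTriple n) = (n + 2).choose 3 := by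
  have h1 : ∀ c < n, ∑ b ∈ Finset.range n, (if b ≤ c then b + 1 else 0) = (c + 2).choose 2 := by
    intro c hc
    rw [← Finset.sum_filter]
    have : (Finset.range n).filter (· ≤ c) = Finset.range (c + 1) := by
      ext b; simp; omega
    rw [this]
    clear this hc
    induction c with
    | zero => rfl
    | succ c ih =>
      rw [Finset.sum_range_succ, ih, Nat.choose_succ_succ' (c + 2) 1, Nat.choose_one_right]; ring
  have h2 : ∑ c ∈ Finset.range n, (c + 2).choose 2 = (n + 2).choose 3 := by
    clear h1
    induction n with
    | zero => rfl
    | succ n ih => rw [Finset.sum_range_succ, ih, Nat.choose_succ_succ' (n + 2) 2]; ring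
  have h3 : ∀ b : Fin n, ∑ a : Fin n, (if a ≤ b then 1 else 0) = (b : ℕ) + 1 := by
    intro b
    rw [← Finset.card_filter, ← Fin.card_Iic]
    congr 1
    ext a; simp
  -- Sum over the last index `c`, then over the middle `b ≤ c`, which leaves `b + 1` choices for the
  -- first because indices start at 0.
  rw [Fintype.card_subtype, Finset.card_filter, ← h2, ← Finset.sum_congr rfl
    fun c hc => h1 c (Finset.mem_range.1 hc), ← Fin.sum_univ_eq_sum_range]
  rw [Fintype.sum_prod_type_right, Fintype.sum_prod_type_right]
  refine Finset.sum_congr rfl fun c _ => ?_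
  rw [← Fin.sum_univ_eq_sum_range fun b => if b ≤ (c : ℕ) then b + 1 else 0]
  refine Finset.sum_congr rfl fun b _ => ?_
  by_cases hbc : b ≤ c
  · simp only [hbc, and_true]
    rw [h3, if_pos (by exact hbc)]
  · simp only [hbc, and_false, if_false, Finset.sum_const_zero]
    rw [if_neg (by exact hbc)]

end SortedTriples

variable {k X : Type*} [Field k] {S : Set (FreeAlg k X)} {n : ℕ}

/-- The word with letters `x_a`, `x_b`, `x_c`. -/
def sortedLetters (e : Fin n ≃ X) (t : SortedTriple n) : List X :=
  [e t.1.1, e t.1.2.1, e t.1.2.2]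

theorem sortedLetters_injective (e : Fin n ≃ X) : Function.Injective (sortedLetters e) := by
  rintro ⟨⟨a, b, c⟩, h⟩ ⟨⟨a', b', c'⟩, h'⟩ heq
  simp only [sortedLetters, List.cons.injEq, EmbeddingLike.apply_eq_iff_eq, and_true] at heq
  obtain ⟨rfl, rfl, rfl⟩ := heq
  rfl

theorem not_isFactor_sortedLetters (e : Fin n ≃ X) (t : SortedTriple n) {i j : Fin n} (h : i < j) :
    ¬ IsFactor (FreeMonoid.of (e j) * FreeMonoid.of (e i))
      (FreeMonoid.ofList (sortedLetters e t)) := by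
  rintro ⟨u, v, huv⟩
  obtain ⟨⟨a, b, c⟩, hab, hbc⟩ := t
  have h1 : [e a, e b, e c] = u.toList ++ [e j, e i] ++ v.toList := congrArg FreeMonoid.toList huv
  rcases hu : u.toList with _ | ⟨x, u'⟩
  · rw [hu] at h1
    simp only [List.nil_append, List.cons_append, List.cons.injEq,
      EmbeddingLike.apply_eq_iff_eq] at h1
    obtain ⟨rfl, rfl, -⟩ := h1
    exact absurd hab (not_le.2 h)
  · rw [hu] at h1
    rcases u' with _ | ⟨y, u'⟩
    · simp only [List.nil_append, List.cons_append, List.cons.injEq,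
        EmbeddingLike.apply_eq_iff_eq] at h1
      obtain ⟨-, rfl, rfl, -⟩ := h1
      exact absurd hbc (not_le.2 h)
    · have := congrArg List.length h1
      simp at this
      omega

theorem eq_of_occurs_relation {p q : X × X} {c : k} {w : FreeMonoid X}
    (h : Occurs w (mon k p - c • mon k q)) :
    w = FreeMonoid.of p.1 * FreeMonoid.of p.2 ∨ w = FreeMonoid.of q.1 * FreeMonoid.of q.2 := by
  classical
  by_contra hne
  push Not at hne
  refine h ?_
  simp [mon, MonoidAlgebra.coeff_single, hne.1.symm, hne.2.symm]

theorem occurs_left_relation {p q : X × X} {c : k} (h : p ≠ q) :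
    Occurs (FreeMonoid.of p.1 * FreeMonoid.of p.2) (mon k p - c • mon k q) := by
  classical
  simp [Occurs, coeff_mon, h.symm]

/-- The leading monomial of a relation `x_j x_i - c x_{i'} x_{j'}` with `i' < j`. -/
theorem isLeading_relation (e : Fin n ≃ X) {i j i' j' : Fin n} (h : i' < j) (c : k) :
    IsLeading (DegLex e) (mon k (e j, e i) - c • mon k (e i', e j'))
      (FreeMonoid.of (e j) * FreeMonoid.of (e i)) := by
  have hne : ((e j, e i) : X × X) ≠ (e i', e j') := fun h1 =>
    h.ne' (e.injective (congrArg Prod.fst h1))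
  refine ⟨occurs_left_relation hne, fun v hv hv' => ?_⟩
  rcases eq_of_occurs_relation hv with rfl | rfl
  · exact absurd rfl hv'
  · refine List.Shortlex.of_lex rfl ?_
    exact List.Lex.rel (by simpa using h)

theorem IsLeading.unique {lt : FreeMonoid X → FreeMonoid X → Prop} (hlt : ∀ u v, lt u v → ¬ lt v u)
    {f : FreeAlg k X} {u v : FreeMonoid X} (hu : IsLeading lt f u) (hv : IsLeading lt f v) :
    u = v := by
  by_contra hne
  exact hlt _ _ (hu.2 v hv.1 (Ne.symm hne)) (hv.2 u hu.1 hne)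

theorem DegLex.asymm (e : Fin n ≃ X) (u v : FreeMonoid X) (h : DegLex e u v) :
    ¬ DegLex e v u := by
  have : Std.Asymm fun x y : X => e.symm x < e.symm y := ⟨fun _ _ h h' => lt_asymm h h'⟩
  exact Std.Asymm.asymm (r := List.Shortlex fun x y : X => e.symm x < e.symm y) _ _ h

/-- A nonzero combination lying in the ideal would have a sorted leading word, which contains no
factor `x_j x_i` with `j > i` and so is not divisible by a leading monomial of the basis. -/
theorem IsReducedGroebnerBasis.linearIndependent {e : Fin n ≃ X} {G : Set (FreeAlg k X)}
    (hG : IsSkewPolynomialType e G)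
    (h : IsReducedGroebnerBasis (DegLex e) G (TwoSidedIdeal.span S)) :
    LinearIndependent k fun t : SortedTriple n => proj S (word k (sortedLetters e t)) := by
  have hli : LinearIndependent k fun t : SortedTriple n => word k (sortedLetters e t) :=
    (MonoidAlgebra.basis (FreeMonoid X) k).linearIndependent.comp
      (fun t => FreeMonoid.ofList (sortedLetters e t)) (sortedLetters_injective e)
  refine hli.map (f := (proj S).toLinearMap) ?_
  rw [Submodule.disjoint_def]
  intro f hf hf0
  by_contra hne
  obtain ⟨w, hw, g, hg, u, hu, huw⟩ := h.leading f (proj_eq_zero_iff.1 hf0) hne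
  have hsupp : ∀ w, Occurs w f → ∃ t, w = FreeMonoid.ofList (sortedLetters e t) := by
    clear hw hf0 hne huw
    intro w
    induction hf using Submodule.span_induction with
    | mem x hx =>
      obtain ⟨t, rfl⟩ := hx
      intro hw
      refine ⟨t, ?_⟩
      by_contra hne
      exact hw (by classical simp [word, Ne.symm hne])
    | zero => intro hw; exact absurd (by simp) hw
    | add x y _ _ hx hy =>
      intro hw
      by_cases h1 : Occurs w x
      · exact hx h1
      · refine hy fun h2 => hw ?_
        rw [Occurs, not_not] at h1
        simp [h1, h2]
    | smul c x _ hx =>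
      intro hw
      refine hx fun h1 => hw ?_
      simp [h1]
  obtain ⟨t, rfl⟩ := hsupp w hw.1
  obtain ⟨c, i', j', rfl, -, hlt, -⟩ := hG
  obtain ⟨i, j, hij, rfl⟩ := hg
  obtain rfl := hu.unique (DegLex.asymm e) (isLeading_relation e (hlt i j hij).1 (c i j))
  exact not_isFactor_sortedLetters e t hij huw

theorem sortedLetters_mem_component (e : Fin n ≃ X) (t : SortedTriple n) :
    proj S (word k (sortedLetters e t)) ∈ component S 3 := by
  rw [component_three]
  exact Submodule.subset_span ⟨(e t.1.1, e t.1.2.1, e t.1.2.2), rfl⟩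

instance [Finite X] : Module.Finite k (component S 3) := by
  rw [component_three]
  exact Module.Finite.span_of_finite k (Set.finite_range _)

theorem IsQuantumBinomial.finrank_of_isBinomialSkewPolynomialRing [Fintype X]
    (hS : IsQuantumBinomial S) (h : IsBinomialSkewPolynomialRing S) :
    Module.finrank k (component S 3) = (Fintype.card X + 2).choose 3 := by
  obtain ⟨n, e, G, -, hG, hGB⟩ := h
  have hn : Fintype.card X = n := by rw [← Fintype.card_congr e, Fintype.card_fin]
  refine le_antisymm ?_ ?_
  · rw [hS.finrank_component_three]
    exact hS.finrank_cubicFunctionals_le.trans hS.card_orbits_le_choose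
  · have hli : LinearIndependent k fun t : SortedTriple n =>
        (⟨_, sortedLetters_mem_component e t⟩ : component S 3) :=
      LinearIndependent.of_comp (component S 3).subtype (hGB.linearIndependent hG)
    rw [hn, ← card_sortedTriple]
    exact hli.fintype_card_le_finrank

end QuantumBinomial

end

noncomputable section

/-! ### Weighted rewriting in dual form -/

section Rewriting

variable {k W : Type*} [Field k]

/-- Weighted rewriting along a well-founded relation: if any two steps from a word are identified
by all functions compatible with the steps from smaller words, then each function on irreducible
words extends to a function compatible with all steps. -/
theorem exists_compatible_extension {lt : W → W → Prop} (wf : WellFounded lt)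
    {Step : W → k → W → Prop} (hlt : ∀ w c w', Step w c w' → lt w' w)
    (hconf : ∀ w c₁ w₁ c₂ w₂, Step w c₁ w₁ → Step w c₂ w₂ → ∀ F : W → k,
      (∀ v c v', lt v w → Step v c v' → F v = c * F v') → c₁ * F w₁ = c₂ * F w₂) (φ : W → k) :
    ∃ N : W → k, (∀ w c w', Step w c w' → N w = c * N w') ∧
      ∀ w, (∀ c w', ¬ Step w c w') → N w = φ w := by
  classical
  -- One step is chosen at each reducible word; the confluence hypothesis, applied to `N` itself,
  -- shows by induction that the other steps agree with it.
  let N : W → k := wf.fix fun w ih =>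
    if h : ∃ p : k × W, Step w p.1 p.2 then
      h.choose.1 * ih h.choose.2 (hlt _ _ _ h.choose_spec) else φ w
  have hN : ∀ w, N w = if h : ∃ p : k × W, Step w p.1 p.2 then
      h.choose.1 * N h.choose.2 else φ w := fun w => wf.fix_eq _ w
  refine ⟨N, fun w => ?_, fun w hw => ?_⟩
  · induction w using wf.induction with
    | _ w ih =>
      intro c w' h
      have hex : ∃ p : k × W, Step w p.1 p.2 := ⟨(c, w'), h⟩
      rw [hN w, dif_pos hex]
      exact hconf w _ _ _ _ hex.choose_spec h N fun v c v' hv hs => ih v hv c v' hs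
  · rw [hN w, dif_neg fun ⟨p, hp⟩ => hw p.1 p.2 hp]

end Rewriting

namespace QuantumBinomial

variable {k X : Type*} [Field k] {S : Set (FreeAlg k X)} {n : ℕ}

/-! ### The degree-lexicographic order on words -/

section WordOrder

/-- The degree-lexicographic order on lists of letters. -/
abbrev WordLT (e : Fin n ≃ X) : List X → List X → Prop :=
  List.Shortlex fun x y => e.symm x < e.symm y

theorem lex_trans {r : X → X → Prop} (hr : ∀ a b c, r a b → r b c → r a c) {u v w : List X}
    (huv : List.Lex r u v) (hvw : List.Lex r v w) : List.Lex r u w := by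
  induction huv generalizing w with
  | nil => cases hvw <;> exact List.Lex.nil
  | cons h ih =>
    cases hvw with
    | cons h' => exact List.Lex.cons (ih h')
    | rel h' => exact List.Lex.rel h'
  | rel h =>
    cases hvw with
    | cons h' => exact List.Lex.rel h
    | rel h' => exact List.Lex.rel (hr _ _ _ h h')

theorem WordLT.trans (e : Fin n ≃ X) {u v w : List X} (huv : WordLT e u v) (hvw : WordLT e v w) :
    WordLT e u w := by
  rw [WordLT, List.shortlex_def] at *
  rcases huv with h | ⟨h, h'⟩ <;> rcases hvw with h1 | ⟨h1, h1'⟩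
  · exact Or.inl (h.trans h1)
  · exact Or.inl (h.trans_eq h1)
  · exact Or.inl (h.trans_lt h1)
  · exact Or.inr ⟨h.trans h1, lex_trans (r := fun x y => e.symm x < e.symm y)
      (fun _ _ _ h h' => lt_trans h h') h' h1'⟩

theorem wordLT_wf (e : Fin n ≃ X) : WellFounded (WordLT e) :=
  List.Shortlex.wf (InvImage.wf e.symm wellFounded_lt)

theorem wordLT_trichotomy (e : Fin n ≃ X) (u v : List X) :
    WordLT e u v ∨ u = v ∨ WordLT e v u := by
  have : Std.Trichotomous fun x y : X => e.symm x < e.symm y :=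
    ⟨fun a b h h' => e.symm.injective (le_antisymm (not_lt.1 h') (not_lt.1 h))⟩
  by_contra hne
  push Not at hne
  exact hne.2.1 (Std.Trichotomous.trichotomous (r := WordLT e) u v hne.1 hne.2.2)

theorem exists_isLeading (e : Fin n ≃ X) {f : FreeAlg k X} (hf : f ≠ 0) :
    ∃ w, IsLeading (DegLex e) f w := by
  have key : ∀ s : Finset (FreeMonoid X), s.Nonempty →
      ∃ w ∈ s, ∀ v ∈ s, v ≠ w → DegLex e v w := by
    intro s hs
    induction hs using Finset.Nonempty.cons_induction with
    | singleton a => exact ⟨a, by simp, by simp⟩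
    | cons a s ha hs ih =>
      obtain ⟨w, hw, hmax⟩ := ih
      rcases wordLT_trichotomy e a.toList w.toList with h | h | h
      · refine ⟨w, by simp [hw], fun v hv hne => ?_⟩
        rcases Finset.mem_cons.1 hv with rfl | hv
        · exact h
        · exact hmax v hv hne
      · exact absurd ((FreeMonoid.toList.injective h) ▸ hw) ha
      · refine ⟨a, by simp, fun v hv hne => ?_⟩
        rcases Finset.mem_cons.1 hv with rfl | hv
        · exact absurd rfl hne
        · by_cases hvw : v = w
          · rw [hvw]; exact h
          · exact WordLT.trans e (hmax v hv hvw) h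
  have hne : f.coeff.support.Nonempty := by
    rw [Finsupp.support_nonempty_iff]
    intro h0
    exact hf (MonoidAlgebra.coeff_injective (by simpa using h0))
  obtain ⟨w, hw, hmax⟩ := key _ hne
  exact ⟨w, Finsupp.mem_support_iff.1 hw, fun v hv => hmax v (Finsupp.mem_support_iff.2 hv)⟩

end WordOrder

/-- The relations rewrite `x_j x_i` with `j > i` to a multiple of `x_{i'} x_{j'}` with `i' < j`
and `i' < j'`, and each such monomial arises. -/
structure IsSkewEnumeration (S : Set (FreeAlg k X)) (e : Fin n ≃ X) : Prop where
  fst_lt : ∀ p : X × X, e.symm p.2 < e.symm p.1 → e.symm (assocMap S p).1 < e.symm p.1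
  ascent : ∀ p : X × X, e.symm p.2 < e.symm p.1 → e.symm (assocMap S p).1 < e.symm (assocMap S p).2
  descent : ∀ p : X × X, e.symm p.1 < e.symm p.2 →
    e.symm (assocMap S p).2 < e.symm (assocMap S p).1

/-! ### The enumeration compatible with the relations -/

section Enumeration

/-- The permutation `y ↦ ˣy`. -/
def IsQuantumBinomial.leftPerm (hS : IsQuantumBinomial S) (x : X) : Equiv.Perm X :=
  Equiv.ofBijective _ (hS.nondegenerate.1 x)

theorem IsQuantumBinomial.leftPerm_apply (hS : IsQuantumBinomial S) (x y : X) :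
    hS.leftPerm x y = (assocMap S (x, y)).1 := rfl

theorem IsQuantumBinomial.leftPerm_fst_snd (hS : IsQuantumBinomial S) (x y : X) :
    hS.leftPerm (assocMap S (x, y)).1 (assocMap S (x, y)).2 = x := by
  rw [leftPerm_apply, Prod.mk.eta, hS.assocMap_assocMap]

theorem IsQuantumBinomial.leftPerm_mul (hS : IsQuantumBinomial S) (h : IsBraidedOnTriples S)
    (x y : X) : hS.leftPerm x * hS.leftPerm y =
      hS.leftPerm (assocMap S (x, y)).1 * hS.leftPerm (assocMap S (x, y)).2 := by
  ext z
  exact (congrArg (fun t : X × X × X => t.1) (h (x, y, z)).1).symm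

/-- First coordinates of the braid relation give $l_xl_z=l_{{}^xz}\,l_{x^z}$, which with $y={}^xz$
is the identity required by `exists_rank_of_squareFree`. In the resulting order ${}^xy<x$ if and
only if $y<x$; applying this to a pair and to its image under the involution $r$ gives the three
conditions. -/
theorem IsQuantumBinomial.exists_isSkewEnumeration [Fintype X] (hS : IsQuantumBinomial S)
    (h : IsBraidedOnTriples S) : ∃ e : Fin (Fintype.card X) ≃ X, IsSkewEnumeration S e := by
  obtain ⟨r, hr, hlt⟩ := exists_rank_of_squareFree _ X hS.leftPerm rfl
    (fun x => by rw [hS.leftPerm_apply, hS.assocMap_diag]) (fun x y => by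
      set z := (hS.leftPerm x)⁻¹ y with hz
      have hy : y = (assocMap S (x, z)).1 := by
        rw [← hS.leftPerm_apply, hz]; exact ((hS.leftPerm x).apply_symm_apply y).symm
      have hx : (hS.leftPerm y)⁻¹ x = (assocMap S (x, z)).2 := by
        rw [Equiv.Perm.inv_eq_iff_eq, hy, hS.leftPerm_fst_snd]
      rw [hx, hS.leftPerm_mul h, ← hy])
  let L : LinearOrder X := LinearOrder.lift' r hr
  let e : Fin (Fintype.card X) ≃o X := Fintype.orderIsoFinOfCardEq X rfl
  have he : ∀ x y, e.symm x < e.symm y ↔ r x < r y := fun x y => e.symm.lt_iff_lt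
  simp only [hS.leftPerm_apply] at hlt
  have hfst : ∀ p : X × X, r p.2 < r p.1 → r (assocMap S p).1 < r p.1 := fun p hp =>
    (hlt p.1 p.2).1 hp
  refine ⟨e.toEquiv, fun p hp => ?_, fun p hp => ?_, fun p hp => ?_⟩
  · exact (he _ _).2 (hfst p ((he _ _).1 hp))
  · have hp' := (he _ _).1 hp
    refine (he _ _).2 (lt_of_le_of_ne (not_lt.1 fun h1 => ?_) fun h1 => ?_)
    · have h2 := hfst _ h1
      rw [hS.assocMap_assocMap] at h2
      exact lt_asymm h2 (hfst p hp')
    · have h2 : assocMap S p = ((assocMap S p).1, (assocMap S p).1) := Prod.ext rfl (hr h1).symm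
      have h3 := hS.assocMap_diag (assocMap S p).1
      rw [← h2, hS.assocMap_assocMap] at h3
      rw [← h3] at h1
      exact hp'.ne' h1
  · have hp' := (he _ _).1 hp
    refine (he _ _).2 ?_
    have h1 : r p.1 < r (assocMap S p).1 := by
      refine lt_of_le_of_ne (not_lt.1 fun h1 => ?_) fun h1 => ?_
      · exact lt_asymm hp' ((hlt p.1 p.2).2 h1)
      · exact hp'.ne (congrArg r (hS.eq_of_fst_eq (x := p.1) (y := p.2) (hr h1).symm))
    refine (hlt _ _).2 ?_
    rw [Prod.mk.eta, hS.assocMap_assocMap]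
    exact h1

end Enumeration

/-! ### Resolution of overlaps and the diamond lemma -/

section Confluence

variable {e : Fin n ≃ X}

theorem IsSkewEnumeration.wordLT (he : IsSkewEnumeration S e) (u v : List X) {p : X × X}
    (hp : e.symm p.2 < e.symm p.1) :
    WordLT e (u ++ [(assocMap S p).1, (assocMap S p).2] ++ v) (u ++ [p.1, p.2] ++ v) := by
  refine List.Shortlex.of_lex (by simp) ?_
  rw [List.append_assoc, List.append_assoc]
  exact List.Lex.append_left (fun x y => e.symm x < e.symm y) (List.Lex.rel (he.fst_lt p hp)) u

/-- The order on triples induced by the order on words. -/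
def TripleLT (e : Fin n ≃ X) (t t' : X × X × X) : Prop :=
  -- Quantifying over contexts lets a comparison of triples be used inside longer words.
  ∀ u v, WordLT e (u ++ letters t ++ v) (u ++ letters t' ++ v)

theorem tripleLT_wf (e : Fin n ≃ X) : WellFounded (TripleLT e) := by
  refine Subrelation.wf (r := InvImage (WordLT e) letters) ?_ (InvImage.wf _ (wordLT_wf e))
  intro t t' h
  have := h [] []
  simpa [InvImage] using this

theorem IsSkewEnumeration.map12_lt (he : IsSkewEnumeration S e) {t : X × X × X}
    (ht : e.symm t.2.1 < e.symm t.1) : TripleLT e (map12 S t) t := fun u v => by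
  simpa [letters, map12] using he.wordLT u (t.2.2 :: v) (p := (t.1, t.2.1)) ht

theorem IsSkewEnumeration.map23_lt (he : IsSkewEnumeration S e) {t : X × X × X}
    (ht : e.symm t.2.2 < e.symm t.2.1) : TripleLT e (map23 S t) t := fun u v => by
  simpa [letters, map23] using he.wordLT (u ++ [t.1]) v (p := t.2) ht

/-- The function `F` is compatible with the rewriting steps from the triple `t`. -/
def CompatibleAt (S : Set (FreeAlg k X)) (e : Fin n ≃ X) (F : X × X × X → k) (t : X × X × X) :
    Prop :=
  (e.symm t.2.1 < e.symm t.1 → F t = coef12 S t * F (map12 S t)) ∧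
    (e.symm t.2.2 < e.symm t.2.1 → F t = coef23 S t * F (map23 S t))

/-- The triple of letters with given indices. -/
def tripleOf (e : Fin n ≃ X) (τ : SortedTriple n) : X × X × X :=
  (e τ.1.1, e τ.1.2.1, e τ.1.2.2)

/-- The same reduction, with the same coefficient, is recorded in the algebra and for all compatible
functions. This allows identities in the component of degree three to be transferred to functions
that are known to be compatible only below a given word. -/
theorem IsSkewEnumeration.exists_normal_triple (he : IsSkewEnumeration S e) (t : X × X × X) :
    ∃ (c : k) (τ : SortedTriple n),
      proj S (word k (letters t)) = c • proj S (word k (sortedLetters e τ)) ∧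
      ∀ F : X × X × X → k, (∀ t', t' = t ∨ TripleLT e t' t → CompatibleAt S e F t') →
        F t = c * F (tripleOf e τ) := by
  induction t using (tripleLT_wf e).induction with
  | _ t ih =>
  by_cases h1 : e.symm t.2.1 < e.symm t.1
  · obtain ⟨c, τ, hc, hF⟩ := ih _ (he.map12_lt h1)
    refine ⟨coef12 S t * c, τ, by rw [proj_word_map12, hc, smul_smul], fun F hcomp => ?_⟩
    rw [(hcomp t (Or.inl rfl)).1 h1, mul_assoc, hF F]
    rintro t' (rfl | ht')
    · exact hcomp _ (Or.inr (he.map12_lt h1))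
    · exact hcomp _ (Or.inr fun u v => (ht' u v).trans e (he.map12_lt h1 u v))
  by_cases h2 : e.symm t.2.2 < e.symm t.2.1
  · obtain ⟨c, τ, hc, hF⟩ := ih _ (he.map23_lt h2)
    refine ⟨coef23 S t * c, τ, by rw [proj_word_map23, hc, smul_smul], fun F hcomp => ?_⟩
    rw [(hcomp t (Or.inl rfl)).2 h2, mul_assoc, hF F]
    rintro t' (rfl | ht')
    · exact hcomp _ (Or.inr (he.map23_lt h2))
    · exact hcomp _ (Or.inr fun u v => (ht' u v).trans e (he.map23_lt h2 u v))
  · refine ⟨1, ⟨(e.symm t.1, e.symm t.2.1, e.symm t.2.2), not_lt.1 h1, not_lt.1 h2⟩, ?_, ?_⟩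
    · simp [letters, sortedLetters]
    · intro F _
      simp [tripleOf]

/-- Rewriting shows that sorted words span the component, and their number equals its dimension. -/
theorem IsSkewEnumeration.linearIndependent [Fintype X] (he : IsSkewEnumeration S e)
    (hdim : Module.finrank k (component S 3) = (Fintype.card X + 2).choose 3) :
    LinearIndependent k fun τ : SortedTriple n => proj S (word k (sortedLetters e τ)) := by
  rw [linearIndependent_iff_card_eq_finrank_span, card_sortedTriple, Set.finrank]
  have hn : Fintype.card X = n := by rw [← Fintype.card_congr e, Fintype.card_fin]
  have : component S 3 =
      Submodule.span k (Set.range fun τ : SortedTriple n => proj S (word k (sortedLetters e τ))) := by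
    rw [component_three]
    refine le_antisymm (Submodule.span_le.2 ?_) (Submodule.span_mono ?_)
    · rintro _ ⟨t, rfl⟩
      obtain ⟨c, τ, hc, -⟩ := he.exists_normal_triple t
      simp only [hc]
      exact Submodule.smul_mem _ _ (Submodule.subset_span ⟨τ, rfl⟩)
    · rintro _ ⟨τ, rfl⟩
      exact ⟨tripleOf e τ, rfl⟩
  rw [← this, hdim, hn]

/-- The two reductions of an overlap represent the same element of the algebra, so by independence
of sorted words their normal forms agree, coefficient included. -/
theorem IsSkewEnumeration.confluent_triple (he : IsSkewEnumeration S e)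
    (hli : LinearIndependent k fun τ : SortedTriple n => proj S (word k (sortedLetters e τ)))
    {t : X × X × X} (h12 : e.symm t.2.1 < e.symm t.1) (h23 : e.symm t.2.2 < e.symm t.2.1)
    {F : X × X × X → k} (hF : ∀ t', TripleLT e t' t → CompatibleAt S e F t') :
    coef12 S t * F (map12 S t) = coef23 S t * F (map23 S t) := by
  obtain ⟨c, τ, hc, hF1⟩ := he.exists_normal_triple (map12 S t)
  obtain ⟨d, σ, hd, hF2⟩ := he.exists_normal_triple (map23 S t)
  rw [hF1 F, hF2 F, ← mul_assoc, ← mul_assoc]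
  · have h1 := (proj_word_map12 (S := S) t).symm.trans (proj_word_map23 t)
    rw [hc, hd, smul_smul, smul_smul] at h1
    have h2 : Finsupp.single τ (coef12 S t * c) = Finsupp.single σ (coef23 S t * d) :=
      hli (by rw [Finsupp.linearCombination_single, Finsupp.linearCombination_single, h1])
    have h3 := congrArg (Finsupp.linearCombination k fun τ => F (tripleOf e τ)) h2
    rwa [Finsupp.linearCombination_single, Finsupp.linearCombination_single, smul_eq_mul,
      smul_eq_mul] at h3
  · rintro t' (rfl | ht')
    · exact hF _ (he.map23_lt h23)
    · exact hF _ fun u v => (ht' u v).trans e (he.map23_lt h23 u v)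
  · rintro t' (rfl | ht')
    · exact hF _ (he.map12_lt h12)
    · exact hF _ fun u v => (ht' u v).trans e (he.map12_lt h12 u v)

/-- Two descents in a word coincide, overlap in one letter, or are disjoint. The overlap is
`confluent_triple` in a context; disjoint steps commute. -/
theorem IsSkewEnumeration.confluent_of_le (he : IsSkewEnumeration S e)
    (hli : LinearIndependent k fun τ : SortedTriple n => proj S (word k (sortedLetters e τ)))
    {w u u' v v' : List X} {p q : X × X} (hp : e.symm p.2 < e.symm p.1)
    (hq : e.symm q.2 < e.symm q.1) (hw : w = u ++ [p.1, p.2] ++ v) (hw' : w = u' ++ [q.1, q.2] ++ v')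
    (hle : u.length ≤ u'.length) {F : List X → k}
    (hF : ∀ u v (p : X × X), e.symm p.2 < e.symm p.1 → WordLT e (u ++ [p.1, p.2] ++ v) w →
      F (u ++ [p.1, p.2] ++ v) =
        assocCoef S p * F (u ++ [(assocMap S p).1, (assocMap S p).2] ++ v)) :
    assocCoef S p * F (u ++ [(assocMap S p).1, (assocMap S p).2] ++ v) =
      assocCoef S q * F (u' ++ [(assocMap S q).1, (assocMap S q).2] ++ v') := by
  have hlt1 := he.wordLT u v hp
  have hlt2 := he.wordLT u' v' hq
  rw [← hw] at hlt1
  rw [← hw'] at hlt2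
  obtain ⟨m, rfl⟩ : ∃ m, u' = u ++ m := by
    have h1 : u <+: w := ⟨[p.1, p.2] ++ v, by rw [hw, List.append_assoc]⟩
    have h2 : u' <+: w := ⟨[q.1, q.2] ++ v', by rw [hw', List.append_assoc]⟩
    obtain ⟨m, hm⟩ := List.prefix_of_prefix_length_le h1 h2 hle
    exact ⟨m, hm.symm⟩
  have heq : [p.1, p.2] ++ v = m ++ [q.1, q.2] ++ v' := by
    have := hw.symm.trans hw'
    simpa only [List.append_assoc, List.append_cancel_left_eq] using this
  obtain ⟨x, y⟩ := p
  obtain ⟨x', y'⟩ := q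
  match m with
  | [] =>
    simp only [List.nil_append, List.cons_append, List.cons.injEq] at heq
    obtain ⟨rfl, rfl, rfl⟩ := heq
    rw [List.append_nil]
  | [a] =>
    simp only [List.nil_append, List.cons_append, List.cons.injEq] at heq
    obtain ⟨rfl, rfl, rfl⟩ := heq
    have key := he.confluent_triple hli (t := (x, y, y')) hp hq
      (F := fun t => F (u ++ letters t ++ v')) (fun t ht => by
        have ht' : WordLT e (u ++ letters t ++ v') w := by
          rw [hw]; simpa [letters] using ht u v'
        constructor
        · intro hd
          have := hF u (t.2.2 :: v') (t.1, t.2.1) hd (by simpa [letters] using ht')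
          simpa [letters, map12, coef12] using this
        · intro hd
          have := hF (u ++ [t.1]) v' t.2 hd (by simpa [letters] using ht')
          simpa [letters, map23, coef23] using this)
    simpa [letters, map12, map23, coef12, coef23] using key
  | a :: b :: m =>
    simp only [List.nil_append, List.cons_append, List.cons.injEq] at heq
    obtain ⟨rfl, rfl, rfl⟩ := heq
    have h1 := hF (u ++ [(assocMap S (x, y)).1, (assocMap S (x, y)).2] ++ m) v' (x', y') hq
      (by simpa using hlt1)
    have h2 := hF u (m ++ [(assocMap S (x', y')).1, (assocMap S (x', y')).2] ++ v') (x, y) hp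
      (by simpa using hlt2)
    simp only [List.append_assoc, List.cons_append, List.nil_append] at h1 h2 ⊢
    rw [h1, h2, mul_left_comm]

/-- A word is rewritten by replacing a factor `x_j x_i`, `j > i`. -/
def RewriteStep (S : Set (FreeAlg k X)) (e : Fin n ≃ X) (w : List X) (c : k) (w' : List X) : Prop :=
  ∃ (u v : List X) (p : X × X), e.symm p.2 < e.symm p.1 ∧ w = u ++ [p.1, p.2] ++ v ∧
    c = assocCoef S p ∧ w' = u ++ [(assocMap S p).1, (assocMap S p).2] ++ v

theorem IsSkewEnumeration.exists_normalForm (he : IsSkewEnumeration S e)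
    (hli : LinearIndependent k fun τ : SortedTriple n => proj S (word k (sortedLetters e τ)))
    (φ : List X → k) : ∃ N : List X → k, (∀ w c w', RewriteStep S e w c w' → N w = c * N w') ∧
      ∀ w, (∀ c w', ¬ RewriteStep S e w c w') → N w = φ w := by
  refine exists_compatible_extension (wordLT_wf e) ?_ ?_ φ
  · rintro w c w' ⟨u, v, p, hp, rfl, rfl, rfl⟩
    exact he.wordLT u v hp
  · rintro w c₁ w₁ c₂ w₂ ⟨u, v, p, hp, hw, rfl, rfl⟩ ⟨u', v', q, hq, hw', rfl, rfl⟩ F hF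
    have hF' : ∀ u v (p : X × X), e.symm p.2 < e.symm p.1 → WordLT e (u ++ [p.1, p.2] ++ v) w →
        F (u ++ [p.1, p.2] ++ v) =
          assocCoef S p * F (u ++ [(assocMap S p).1, (assocMap S p).2] ++ v) :=
      fun u v p hp hlt => hF _ _ _ hlt ⟨u, v, p, hp, rfl, rfl, rfl⟩
    rcases le_total u.length u'.length with hle | hle
    · exact he.confluent_of_le hli hp hq hw hw' hle hF'
    · exact (he.confluent_of_le hli hq hp hw' hw hle hF').symm

/-- If the leading word were irreducible, the indicator of that word on irreducible words would
extend to a functional killing the ideal and vanishing on all smaller words. Its value on `f` is the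
leading coefficient, a contradiction. -/
theorem IsSkewEnumeration.exists_rewriteStep_of_isLeading (hS : IsQuantumBinomial S)
    (he : IsSkewEnumeration S e)
    (hli : LinearIndependent k fun τ : SortedTriple n => proj S (word k (sortedLetters e τ)))
    {f : FreeAlg k X} (hf : f ∈ TwoSidedIdeal.span S) {w : FreeMonoid X}
    (hw : IsLeading (DegLex e) f w) : ∃ c w', RewriteStep S e w.toList c w' := by
  classical
  by_contra hno
  push Not at hno
  obtain ⟨N, hstep, hirr⟩ := he.exists_normalForm hli fun v => if v = w.toList then 1 else 0
  have hNw : N w.toList = 1 := by rw [hirr _ hno, if_pos rfl]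
  have hNlt : ∀ v, WordLT e v w.toList → N v = 0 := by
    intro v
    induction v using (wordLT_wf e).induction with
    | _ v ih =>
      intro hv
      by_cases hs : ∃ c v', RewriteStep S e v c v'
      · obtain ⟨c, v', hs⟩ := hs
        have hlt : WordLT e v' v := by
          obtain ⟨u, u', p, hp, rfl, rfl, rfl⟩ := hs
          exact he.wordLT u u' hp
        rw [hstep _ _ _ hs, ih v' hlt (hlt.trans e hv), mul_zero]
      · push Not at hs
        rw [hirr _ hs, if_neg]
        rintro rfl
        exact DegLex.asymm e _ _ hv hv
  have hz : ofWords N f = 0 := by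
    refine hS.ofWords_eq_zero N (fun u v x y hxy => ?_) hf
    rcases lt_or_gt_of_ne (e.symm.injective.ne hxy) with h | h
    · have h1 := hstep _ _ _ ⟨u, v, assocMap S (x, y), he.descent (x, y) h, rfl, rfl, rfl⟩
      rw [h1, hS.assocMap_assocMap, smul_eq_mul, ← mul_assoc, hS.assocCoef_mul, one_mul]
    · exact hstep _ _ _ ⟨u, v, (x, y), h, rfl, rfl, rfl⟩
  rw [ofWords_eq_sum, Finsupp.sum, Finset.sum_eq_single w] at hz
  · rw [hNw, smul_eq_mul, mul_one] at hz
    exact hw.1 hz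
  · intro v hv hne
    rw [hNlt _ (hw.2 v (Finsupp.mem_support_iff.1 hv) hne), smul_zero]
  · intro h
    rw [Finsupp.notMem_support_iff.1 h, zero_smul]

end Confluence

/-! ### The skew-polynomial relations as reduced Gröbner basis -/

section SkewRing

variable {e : Fin n ≃ X}

/-- The relations `x_j x_i - c x_{i'} x_{j'}` with `i < j`. -/
def skewRelations (S : Set (FreeAlg k X)) (e : Fin n ≃ X) : Set (FreeAlg k X) :=
  {f | ∃ p : X × X, e.symm p.2 < e.symm p.1 ∧
    f = mon k p - assocCoef S p • mon k (assocMap S p)}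

theorem IsSkewEnumeration.span_skewRelations (hS : IsQuantumBinomial S)
    (he : IsSkewEnumeration S e) :
    TwoSidedIdeal.span (skewRelations S e) = TwoSidedIdeal.span S := by
  refine le_antisymm (TwoSidedIdeal.span_le.2 ?_) (TwoSidedIdeal.span_le.2 ?_)
  · rintro _ ⟨p, -, rfl⟩
    exact relation_mem_span S p
  · intro f hf
    obtain ⟨p, hp, rfl⟩ := hS.exists_eq_of_mem hf
    rcases lt_or_gt_of_ne (e.symm.injective.ne hp) with h | h
    · have h1 := TwoSidedIdeal.subset_span (s := skewRelations S e)
        ⟨assocMap S p, he.descent p h, rfl⟩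
      have h2 := (TwoSidedIdeal.span (skewRelations S e)).mul_mem_left
        (algebraMap k _ (-assocCoef S p)) _ h1
      rw [← Algebra.smul_def, hS.assocMap_assocMap, smul_sub, smul_smul, neg_mul,
        hS.assocCoef_mul, neg_one_smul, neg_smul] at h2
      have h3 : mon k p - assocCoef S p • mon k (assocMap S p) =
          -(assocCoef S p • mon k (assocMap S p)) - -mon k p := by abel
      rw [SetLike.mem_coe, h3]
      exact h2
    · exact TwoSidedIdeal.subset_span ⟨p, h, rfl⟩

theorem IsSkewEnumeration.isSkewPolynomialType (hS : IsQuantumBinomial S)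
    (he : IsSkewEnumeration S e) : IsSkewPolynomialType e (skewRelations S e) := by
  refine ⟨fun i j => assocCoef S (e j, e i), fun i j => e.symm (assocMap S (e j, e i)).1,
    fun i j => e.symm (assocMap S (e j, e i)).2, ?_, fun i j _ => assocCoef_ne_zero S _,
    fun i j hij => ?_, fun a b hab => ?_⟩
  · ext f
    constructor
    · rintro ⟨p, hp, rfl⟩
      exact ⟨e.symm p.2, e.symm p.1, hp, by simp⟩
    · rintro ⟨i, j, hij, rfl⟩
      exact ⟨(e j, e i), by simpa using hij, by simp⟩
  · have h1 := he.fst_lt (e j, e i) (by simpa using hij)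
    have h2 := he.ascent (e j, e i) (by simpa using hij)
    simp only [Equiv.symm_apply_apply] at h1
    exact ⟨h1, h2⟩
  · have h1 := he.descent (e a, e b) (by simpa using hab)
    refine ⟨_, _, h1, ?_, ?_⟩ <;> simp [hS.assocMap_assocMap]

theorem IsSkewEnumeration.isLeading (he : IsSkewEnumeration S e) {p : X × X}
    (hp : e.symm p.2 < e.symm p.1) :
    IsLeading (DegLex e) (mon k p - assocCoef S p • mon k (assocMap S p))
      (FreeMonoid.of p.1 * FreeMonoid.of p.2) := by
  have := isLeading_relation e (i := e.symm p.2) (j' := e.symm (assocMap S p).2)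
    (he.fst_lt p hp) (assocCoef S p)
  simpa using this

theorem IsSkewEnumeration.isReducedGroebnerBasis (hS : IsQuantumBinomial S)
    (he : IsSkewEnumeration S e)
    (hli : LinearIndependent k fun τ : SortedTriple n => proj S (word k (sortedLetters e τ))) :
    IsReducedGroebnerBasis (DegLex e) (skewRelations S e) (TwoSidedIdeal.span S) where
  subset := by
    rintro _ ⟨p, -, rfl⟩
    exact relation_mem_span S p
  leading f hf hne := by
    obtain ⟨w, hw⟩ := exists_isLeading e hne
    obtain ⟨c, w', u, v, p, hp, hwp, -, -⟩ := he.exists_rewriteStep_of_isLeading hS hli hf hw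
    exact ⟨w, hw, _, ⟨p, hp, rfl⟩, _, he.isLeading hp, FreeMonoid.ofList u, FreeMonoid.ofList v,
      FreeMonoid.toList.injective hwp⟩
  monic := by
    classical
    rintro _ ⟨p, hp, rfl⟩
    refine ⟨_, he.isLeading hp, ?_⟩
    have hne : assocMap S p ≠ p := fun h1 => (he.fst_lt p hp).ne (by rw [h1])
    simp [coeff_mon, hne]
  reduced := by
    rintro _ ⟨p, hp, rfl⟩ _ ⟨q, hq, rfl⟩ hne v hv u hu ⟨a, b, hab⟩
    obtain rfl := hu.unique (DegLex.asymm e) (he.isLeading hq)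
    have hlen : v.toList.length = 2 := by
      rcases eq_of_occurs_relation hv with rfl | rfl <;> rfl
    have hab' : v.toList = a.toList ++ [q.1, q.2] ++ b.toList := congrArg FreeMonoid.toList hab
    have hlen' := congrArg List.length hab'
    rw [hlen] at hlen'
    simp only [List.length_append, List.length_cons, List.length_nil] at hlen'
    have ha : a.toList = [] := List.length_eq_zero_iff.1 (by omega)
    have hb : b.toList = [] := List.length_eq_zero_iff.1 (by omega)
    rw [ha, hb, List.nil_append, List.append_nil] at hab'
    have hvq : v = FreeMonoid.of q.1 * FreeMonoid.of q.2 := FreeMonoid.toList.injective hab'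
    -- Both words have length two, so divisibility is equality. A shared leading word would make the
    -- relations equal, and a right-hand side is an ascent while leading words are descents.
    rcases eq_of_occurs_relation hv with h | h
    · rw [hvq, word_inj] at h
      exact hne (by rw [h])
    · rw [hvq, word_inj] at h
      have := he.ascent p hp
      rw [← h] at this
      exact lt_asymm this hq

theorem IsQuantumBinomial.isBinomialSkewPolynomialRing_of_isBraidedOnTriples [Fintype X]
    (hS : IsQuantumBinomial S) (h : IsBraidedOnTriples S) : IsBinomialSkewPolynomialRing S := by
  obtain ⟨e, he⟩ := hS.exists_isSkewEnumeration h
  have hli := he.linearIndependent (by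
    rw [hS.finrank_component_three, hS.finrank_eq_of_isBraidedOnTriples h])
  exact ⟨_, e, skewRelations S e, he.span_skewRelations hS, he.isSkewPolynomialType hS,
    he.isReducedGroebnerBasis hS hli⟩

end SkewRing

end QuantumBinomial

end

/-! ### The equivalence -/

theorem theorem4 {k X : Type*} [Field k] [Fintype X] (n : ℕ) (hn : Fintype.card X = n)
    (S : Set (QuantumBinomial.FreeAlg k X)) (hS : QuantumBinomial.IsQuantumBinomial S) :
    List.TFAE
      [QuantumBinomial.IsYangBaxterSolution (QuantumBinomial.assocLin S),
       QuantumBinomial.IsBinomialSkewPolynomialRing S,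
       Module.finrank k (QuantumBinomial.component S 3) = (n + 2).choose 3] := by
  subst hn
  rw [hS.isYangBaxterSolution_iff]
  tfae_have 1 → 2 := hS.isBinomialSkewPolynomialRing_of_isBraidedOnTriples
  tfae_have 2 → 3 := hS.finrank_of_isBinomialSkewPolynomialRing
  tfae_have 3 → 1 := fun h => hS.isBraidedOnTriples_of_finrank_eq
    (by rw [← hS.finrank_component_three, h])
  tfae_finish
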